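/- **Setting.** Let $\Bbbk$ be a field of characteristic zero, $q$ an indeterminate and $\Bbbk_q=\bigcup_{m\ge1}\Bbbk(q^{1/m})$, so that $q^r\in\Bbbk_q$ for all $r\in\mathbb Q$. Let $I$ be a finite set with $n$ elements, $A=(a_{ij})_{i,j\in I}$ a symmetrizable generalized Cartan matrix, $D=\mathrm{diag}(d_i)$ with positive integers $d_i$ such that $DA$ is symmetric, and $q_i:=q^{d_i}$. Let $Q=\bigoplus_{i}\mathbb Z\alpha_i$ and $\mathbb QQ=\mathbb Q\otimes Q$, with the symmetric bilinear form $(\alpha_i,\alpha_j)=d_ia_{ij}$. Let $\Psi=(\psi_{ij})\in\mathfrak{so}_n(\mathbb Q)$ be an antisymmetric rational matrix, and define linear endomorphisms $\psi_\pm$ of $\mathbb QQ$ by $$\psi_+(\alpha_l)=\sum_{i,j}\psi_{ij}\,a_{jl}\,d_i^{-1}\alpha_i,\qquad \psi_-(\alpha_l)=\sum_{i,j}\psi_{ji}\,a_{jl}\,d_i^{-1}\alpha_i .$$ Let $\mathbf q=(q_{ij})$ be the $q$-rational multiparameter corresponding to $\Psi$ (written $\Psi\leftrightsquigarrow\mathbf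 q$), that is $$q_{ij}=q^{R_{ij}},\qquad R=DA+A^T(\Psi^T-\Psi)A;$$ then $q_{ii}=q^{2d_i}$ and $q_{ij}q_{ji}=q_{ii}^{a_{ij}}$. Let also $\check{\mathbf q}=(q^{d_ia_{ij}})$ be the canonical multiparameter. Let $M\subset\mathbb QQ$ be a lattice (a finitely generated subgroup) with $Q\subseteq M$ and $\psi_+(M)\subseteq M$ (hence also $\psi_-(M)\subseteq M$). **The MpQUEA.** For a multiparameter $\mathbf p=(p_{ij})=(q^{P_{ij}})$ with $P\in M_n(\mathbb Q)$, $P_{ij}+P_{ji}=2d_ia_{ij}$, let $U_{\mathbf p,M_\bullet}(\mathfrak g_D)$ be the unital $\Bbbk_q$-algebra generated by $E_i,F_i$ $(i\in I)$ and $K_\mu,L_\mu$ $(\mu\in M)$, with the relations that $(\mu,\nu)\mapsto K_\mu L_\nu$ is a homomorphism from $M\times M$ to the group of units with commuting values, and, for $\mu=\sum_k\mu_k\alpha_k\in M$ and $i,j\in I$, $$K_\mu E_j=q^{\sum_k\mu_kP_{kj}}E_jK_\mu,\quad L_\mu E_j=q^{-\sum_kP_{jk}\mu_k}E_jL_\mu,\quad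 K_\mu F_j=q^{-\sum_k\mu_kP_{kj}}F_jK_\mu,\quad L_\mu F_j=q^{\sum_kP_{jk}\mu_k}F_jL_\mu,$$ $$E_iF_j-F_jE_i=\delta_{ij}\,\frac{p_{ii}}{p_{ii}-1}\,(K_{\alpha_i}-L_{\alpha_i}),$$ and, for $i\ne j$ and $m=1-a_{ij}$, $$\sum_{k=0}^{m}(-1)^k\binom mk_{\!p_{ii}}p_{ii}^{\binom k2}p_{ij}^k\,E_i^{m-k}E_jE_i^{k}=0,\qquad \sum_{k=0}^{m}(-1)^k\binom mk_{\!p_{ii}}p_{ii}^{\binom k2}p_{ij}^k\,F_i^{k}F_jF_i^{m-k}=0,$$ where $\binom mk_{p}$ is the Gaussian binomial coefficient built on $(s)_p=1+p+\dots+p^{s-1}$. It is a Hopf algebra in which all $K_\mu,L_\mu$ are group-like and $$\Delta(E_i)=E_i\otimes1+K_{\alpha_i}\otimes E_i,\qquad \Delta(F_i)=F_i\otimes L_{\alpha_i}+1\otimes F_i,\qquad \epsilon(E_i)=\epsilon(F_i)=0 .$$ Let $\mathcal I_\Psi$ be the two-sided (Hopf) ideal of $U_{\mathbf q,M_\bullet}(\mathfrak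 g_D)$ generated by the elements $K_\mu L_\mu-K_{2\psi_+(\mu)}L_{2\psi_-(\mu)}$, with $\mu\in M$ (equivalently, with $\mu$ in a $\mathbb Z$-basis of $M$), and put $$U_{\mathbf q,M_\bullet}(\mathfrak g)=U_{\mathbf q,M_\bullet}(\mathfrak g_D)/\mathcal I_\Psi .$$ **The TwQUEA.** As an algebra, $U^\Psi_{q,M}(\mathfrak g)=U_{q,M}(\mathfrak g)$ is the unital $\Bbbk_q$-algebra generated by $E_i,F_i$ $(i\in I)$ and $K_\mu$ $(\mu\in M)$ with relations $K_0=1$, $K_\mu K_\nu=K_{\mu+\nu}$, $K_\mu E_j=q^{(\mu,\alpha_j)}E_jK_\mu$, $K_\mu F_j=q^{-(\mu,\alpha_j)}F_jK_\mu$, $$E_iF_j-F_jE_i=\delta_{ij}\,\frac{K_{\alpha_i}-K_{-\alpha_i}}{q_i-q_i^{-1}},$$ and, for $i\neq j$ and $m=1-a_{ij}$, $$\sum_{k=0}^m(-1)^k{m\brack k}_{q_i}X_i^{m-k}X_jX_i^k=0\qquad(X=E\text{ and }X=F),$$ where ${m\brack k}_{q_i}$ is the binomial coefficient built on $[s]_{q_i}=(q_i^s-q_i^{-s})/(q_i-q_i^{-1})$.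 It is a Hopf algebra with the twisted structure in which all $K_\mu$ are group-like, $\epsilon(E_i)=\epsilon(F_i)=0$ and $$\Delta^{(\Psi)}(E_i)=E_i\otimes K_{\psi_-(\alpha_i)}+K_{\alpha_i+\psi_+(\alpha_i)}\otimes E_i,\qquad \Delta^{(\Psi)}(F_i)=F_i\otimes K_{-\alpha_i-\psi_-(\alpha_i)}+K_{-\psi_+(\alpha_i)}\otimes F_i .$$ **The cocycle deformation.** Let $p:U_{\check{\mathbf q},M_\bullet}(\mathfrak g_D)\to\Bbbk_q[M]$ be the Hopf algebra epimorphism onto the group algebra of $M$ with $K_\mu,L_\mu\mapsto\mu$ and $E_i,F_i\mapsto0$. Let $\sigma$ be the normalized Hopf $2$-cocycle of $U_{\check{\mathbf q},M_\bullet}(\mathfrak g_D)$ obtained by composing with $p\otimes p$ the bilinear extension to $\Bbbk_q[M]$ of the bicharacter $(\mu,\nu)\mapsto q^{-(\mu+\psi_-(\mu),\,\nu)}$; in particular $\sigma(K_{\alpha_i},K_{\alpha_j})=q^{-(DA+A^T\Psi A)_{ij}}$. Let $\big(U_{\check{\mathbf q},M_\bullet}(\mathfrak g_D)\big)_\sigma$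 be the same coalgebra with the product $a\cdot_\sigma b=\sigma(a_{(1)},b_{(1)})\,a_{(2)}b_{(2)}\,\sigma^{-1}(a_{(3)},b_{(3)})$, and let $$\big(U_{q,M_\bullet}(\mathfrak g)\big)_\sigma$$ be its quotient by the two-sided ideal generated by the elements $K_\mu\cdot_\sigma L_\mu-K_{2\psi_+(\mu)}\cdot_\sigma L_{2\psi_-(\mu)}$ $(\mu\in M)$. **Theorem.** (a) There exists an isomorphism of Hopf algebras $$U_{\mathbf q,M_\bullet}(\mathfrak g)\;\cong\;U^\Psi_{q,M}(\mathfrak g)$$ given, for all $\mu\in M$ and $i\in I$, by $$K_\mu\mapsto K_{\mu+\psi_+(\mu)-\psi_-(\mu)},\quad L_\mu\mapsto K_{-(\mu+\psi_-(\mu)-\psi_+(\mu))},\quad E_i\mapsto q_i\,K_{-\psi_-(\alpha_i)}E_i,\quad F_i\mapsto K_{\psi_+(\alpha_i)}F_i .$$ (b) There exists an isomorphism of Hopf algebras $$\big(U_{q,M_\bullet}(\mathfrak g)\big)_\sigma\;\cong\;U^\Psi_{q,M}(\mathfrak g)$$ given by the same formulas on the classes of $K_\mu,L_\mu,E_i,F_i$.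 -/

import Mathlib

open scoped TensorProduct

namespace QuantumDouble

section Base

variable {F : Type*} [Field F] {L : Type*} [AddCommGroup L] {J : Type*}

/-- Data for a Hopf algebra generated by a torus `K_a`, `a ∈ L`, and elements `X_j`, `j ∈ J`, with
`K_a X_j = wt_j(a) X_j K_a` and `Δ(X_j) = X_j ⊗ K_{right j} + K_{left j} ⊗ X_j`. -/
structure TorusDatum (F : Type*) [Field F] (L : Type*) [AddCommGroup L] (J : Type*) where
  wt : J → Multiplicative L →* F
  left : J → L
  right : J → L

/-- The generators `K_a` and `X_j`. -/
inductive TorusGen (L J : Type*)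
  | K : L → TorusGen L J
  | X : J → TorusGen L J

namespace TorusDatum

variable (D : TorusDatum F L J)

/-- `K_0 = 1`, `K_{a+b} = K_a K_b`, `K_a X_j = wt_j(a) X_j K_a`. -/
inductive Rel : FreeAlgebra F (TorusGen L J) → FreeAlgebra F (TorusGen L J) → Prop
  | K_zero : Rel (FreeAlgebra.ι F (.K 0)) 1
  | K_add (a b : L) :
      Rel (FreeAlgebra.ι F (.K (a + b))) (FreeAlgebra.ι F (.K a) * FreeAlgebra.ι F (.K b))
  | K_mul_X (a : L) (j : J) :
      Rel (FreeAlgebra.ι F (.K a) * FreeAlgebra.ι F (.X j))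
        (D.wt j (.ofAdd a) • (FreeAlgebra.ι F (.X j) * FreeAlgebra.ι F (.K a)))

/-- The algebra generated by the `K_a` and the `X_j` with the relations above. -/
def Alg : Type _ := RingQuot D.Rel

noncomputable instance : Ring D.Alg := inferInstanceAs (Ring (RingQuot D.Rel))

noncomputable instance : Algebra F D.Alg := inferInstanceAs (Algebra F (RingQuot D.Rel))

/-- The projection from the free algebra. -/
noncomputable def proj : FreeAlgebra F (TorusGen L J) →ₐ[F] D.Alg := RingQuot.mkAlgHom F D.Rel

/-- The class of a generator. -/
noncomputable def gen (g : TorusGen L J) : D.Alg := D.proj (FreeAlgebra.ι F g)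

noncomputable abbrev K (a : L) : D.Alg := D.gen (.K a)

noncomputable abbrev X (j : J) : D.Alg := D.gen (.X j)

theorem K_zero : D.K 0 = 1 :=
  (RingQuot.mkAlgHom_rel F (Rel.K_zero (D := D))).trans (map_one D.proj)

theorem K_add (a b : L) : D.K (a + b) = D.K a * D.K b :=
  (RingQuot.mkAlgHom_rel F (Rel.K_add (D := D) a b)).trans (map_mul D.proj _ _)

theorem K_mul_X (a : L) (j : J) : D.K a * D.X j = D.wt j (.ofAdd a) • (D.X j * D.K a) := by
  have h : D.proj _ = D.proj _ := RingQuot.mkAlgHom_rel F (Rel.K_mul_X (D := D) a j)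
  simp only [map_mul, map_smul] at h
  exact h

theorem wt_mul_wt_neg (j : J) (a : L) : D.wt j (.ofAdd a) * D.wt j (.ofAdd (-a)) = 1 := by
  rw [← map_mul, ← ofAdd_add, add_neg_cancel, ofAdd_zero, map_one]

theorem X_mul_K (a : L) (j : J) : D.X j * D.K a = D.wt j (.ofAdd (-a)) • (D.K a * D.X j) := by
  rw [K_mul_X, smul_smul, mul_comm, wt_mul_wt_neg, one_smul]

theorem K_neg_mul (a : L) : D.K (-a) * D.K a = 1 := by
  rw [← K_add, neg_add_cancel, K_zero]

theorem K_mul_neg (a : L) : D.K a * D.K (-a) = 1 := by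
  rw [← K_add, add_neg_cancel, K_zero]

/-- The images `k`, `x` of the generators satisfy the relations. -/
structure Respects {A : Type*} [Semiring A] [Algebra F A] (k : L → A) (x : J → A) : Prop where
  K_zero : k 0 = 1
  K_add : ∀ a b, k (a + b) = k a * k b
  K_mul_X : ∀ a j, k a * x j = D.wt j (.ofAdd a) • (x j * k a)

variable {D} in
/-- The universal property of the presentation. -/
noncomputable def lift {A : Type*} [Semiring A] [Algebra F A] {k : L → A} {x : J → A}
    (h : D.Respects k x) : D.Alg →ₐ[F] A :=
  RingQuot.liftAlgHom F ⟨FreeAlgebra.lift F (fun | .K a => k a | .X j => x j), by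
    rintro _ _ (_ | ⟨a, b⟩ | ⟨a, j⟩)
    · simpa using h.K_zero
    · simpa using h.K_add a b
    · simpa using h.K_mul_X a j⟩

theorem lift_K {A : Type*} [Semiring A] [Algebra F A] {k : L → A} {x : J → A}
    (h : D.Respects k x) (a : L) : lift h (D.K a) = k a :=
  (RingQuot.liftAlgHom_mkAlgHom_apply F _ _ _).trans (FreeAlgebra.lift_ι_apply _ _)

theorem lift_X {A : Type*} [Semiring A] [Algebra F A] {k : L → A} {x : J → A}
    (h : D.Respects k x) (j : J) : lift h (D.X j) = x j :=
  (RingQuot.liftAlgHom_mkAlgHom_apply F _ _ _).trans (FreeAlgebra.lift_ι_apply _ _)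

theorem algHom_ext {A : Type*} [Semiring A] [Algebra F A] {f g : D.Alg →ₐ[F] A}
    (h : ∀ x, f (D.gen x) = g (D.gen x)) : f = g := by
  apply RingQuot.ringQuot_ext' F
  exact FreeAlgebra.hom_ext (funext fun x ↦ h x)

theorem comul_respects : D.Respects (fun a ↦ D.K a ⊗ₜ[F] D.K a)
    (fun j ↦ D.X j ⊗ₜ[F] D.K (D.right j) + D.K (D.left j) ⊗ₜ[F] D.X j) where
  K_zero := by simp [K_zero, Algebra.TensorProduct.one_def]
  K_add := by intro a b; simp [K_add]
  K_mul_X := by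
    intro a j
    simp only [mul_add, add_mul, Algebra.TensorProduct.tmul_mul_tmul, K_mul_X, smul_add,
      TensorProduct.smul_tmul', TensorProduct.tmul_smul, ← K_add, add_comm a]

/-- `Δ(K_a) = K_a ⊗ K_a`, `Δ(X_j) = X_j ⊗ K_{right j} + K_{left j} ⊗ X_j`. -/
noncomputable def comulHom : D.Alg →ₐ[F] D.Alg ⊗[F] D.Alg := lift D.comul_respects

theorem counit_respects : D.Respects (fun _ ↦ (1 : F)) (fun _ ↦ 0) :=
  ⟨rfl, by simp, by simp⟩

/-- `ε(K_a) = 1`, `ε(X_j) = 0`. -/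
noncomputable def counitHom : D.Alg →ₐ[F] F := lift D.counit_respects

theorem comulHom_K (a : L) : D.comulHom (D.K a) = D.K a ⊗ₜ[F] D.K a :=
  D.lift_K D.comul_respects a

theorem comulHom_X (j : J) : D.comulHom (D.X j) =
    D.X j ⊗ₜ[F] D.K (D.right j) + D.K (D.left j) ⊗ₜ[F] D.X j :=
  D.lift_X D.comul_respects j

theorem counitHom_K (a : L) : D.counitHom (D.K a) = 1 :=
  D.lift_K D.counit_respects a

theorem counitHom_X (j : J) : D.counitHom (D.X j) = 0 :=
  D.lift_X D.counit_respects j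

noncomputable instance : Bialgebra F D.Alg :=
  Bialgebra.ofAlgHom D.comulHom D.counitHom
    (by
      apply algHom_ext
      rintro (a | j)
      · simp [comulHom_K]
      · simp [comulHom_X, comulHom_K, TensorProduct.tmul_add, TensorProduct.add_tmul, add_assoc])
    (by
      apply algHom_ext
      rintro (a | j)
      · simp [comulHom_K, counitHom_K]
      · simp [comulHom_X, counitHom_K, counitHom_X])
    (by
      apply algHom_ext
      rintro (a | j)
      · simp [comulHom_K, counitHom_K]
      · simp [comulHom_X, counitHom_K, counitHom_X])

theorem comul_K (a : L) : Coalgebra.comul (R := F) (D.K a) = D.K a ⊗ₜ[F] D.K a :=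
  D.comulHom_K a

theorem comul_X (j : J) : Coalgebra.comul (R := F) (D.X j) =
    D.X j ⊗ₜ[F] D.K (D.right j) + D.K (D.left j) ⊗ₜ[F] D.X j :=
  D.comulHom_X j

theorem counit_K (a : L) : Coalgebra.counit (R := F) (D.K a) = 1 :=
  D.counitHom_K a

theorem counit_X (j : J) : Coalgebra.counit (R := F) (D.X j) = 0 :=
  D.counitHom_X j

open MulOpposite in
theorem antipode_respects : D.Respects (fun a ↦ op (D.K (-a)))
    (fun j ↦ op (-(D.K (-D.left j) * D.X j * D.K (-D.right j)))) where
  K_zero := by simp [K_zero]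
  K_add := by intro a b; simp [← op_mul, ← K_add, add_comm]
  K_mul_X := by
    intro a j
    simp only [← op_mul, ← op_smul, neg_mul, mul_neg, smul_neg]
    congr 2
    rw [mul_assoc, ← K_add, add_comm, K_add, ← mul_assoc, mul_assoc _ (D.X j), X_mul_K, neg_neg,
      mul_smul_comm, smul_mul_assoc, ← mul_assoc, ← K_add, add_comm, K_add]
    simp only [mul_assoc]

/-- `S(K_a) = K_{-a}`, `S(X_j) = -K_{-left j} X_j K_{-right j}`, as an anti-homomorphism. -/
noncomputable def antipodeHom : D.Alg →ₐ[F] D.Algᵐᵒᵖ := lift D.antipode_respects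

/-- The antipode. -/
noncomputable def antipodeMap : D.Alg →ₗ[F] D.Alg :=
  (MulOpposite.opLinearEquiv F).symm.toLinearMap ∘ₗ D.antipodeHom.toLinearMap

theorem antipodeMap_mul (x y : D.Alg) :
    D.antipodeMap (x * y) = D.antipodeMap y * D.antipodeMap x := by
  simp [antipodeMap]

theorem antipodeMap_one : D.antipodeMap 1 = 1 := by
  simp [antipodeMap]

theorem antipodeMap_K (a : L) : D.antipodeMap (D.K a) = D.K (-a) := by
  simp [antipodeMap, antipodeHom, lift_K]

theorem antipodeMap_X (j : J) :
    D.antipodeMap (D.X j) = -(D.K (-D.left j) * D.X j * D.K (-D.right j)) := by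
  simp [antipodeMap, antipodeHom, lift_X]

theorem induction {p : D.Alg → Prop} (x : D.Alg)
    (hs : ∀ c : F, p (algebraMap F _ c)) (hg : ∀ g, p (D.gen g))
    (ha : ∀ x y, p x → p y → p (x + y)) (hm : ∀ x y, p x → p y → p (x * y)) : p x := by
  obtain ⟨y, rfl⟩ : ∃ y : FreeAlgebra F (TorusGen L J), D.proj y = x :=
    RingQuot.mkAlgHom_surjective F D.Rel x
  induction y using FreeAlgebra.induction with
  | grade0 c => simpa using hs c
  | grade1 g => exact hg g
  | mul a b h1 h2 => simpa using hm _ _ h1 h2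
  | add a b h1 h2 => simpa using ha _ _ h1 h2

open LinearMap in
theorem antipode_rTensor_mul (t : D.Alg ⊗[F] D.Alg) (c : F)
    (h : mul' F D.Alg (D.antipodeMap.rTensor D.Alg t) = algebraMap F _ c) (u : D.Alg ⊗[F] D.Alg) :
    mul' F D.Alg (D.antipodeMap.rTensor D.Alg (t * u)) =
      algebraMap F _ c * mul' F D.Alg (D.antipodeMap.rTensor D.Alg u) := by
  have key : ∀ (t : D.Alg ⊗[F] D.Alg) (a b : D.Alg),
      mul' F D.Alg (D.antipodeMap.rTensor D.Alg (t * a ⊗ₜ[F] b)) =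
        D.antipodeMap a * mul' F D.Alg (D.antipodeMap.rTensor D.Alg t) * b := by
    intro t a b
    induction t with
    | zero => simp
    | tmul x y => simp [antipodeMap_mul, mul_assoc]
    | add x y hx hy => simp only [add_mul, map_add, hx, hy, mul_add]
  induction u with
  | zero => simp
  | tmul x y => rw [key, h, ← Algebra.commutes]; simp [mul_assoc]
  | add x y hx hy => simp only [map_add, hx, hy, mul_add]

open LinearMap in
theorem antipode_lTensor_mul (u : D.Alg ⊗[F] D.Alg) (c : F)
    (h : mul' F D.Alg (D.antipodeMap.lTensor D.Alg u) = algebraMap F _ c) (t : D.Alg ⊗[F] D.Alg) :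
    mul' F D.Alg (D.antipodeMap.lTensor D.Alg (t * u)) =
      mul' F D.Alg (D.antipodeMap.lTensor D.Alg t) * algebraMap F _ c := by
  have key : ∀ (u : D.Alg ⊗[F] D.Alg) (a b : D.Alg),
      mul' F D.Alg (D.antipodeMap.lTensor D.Alg (a ⊗ₜ[F] b * u)) =
        a * mul' F D.Alg (D.antipodeMap.lTensor D.Alg u) * D.antipodeMap b := by
    intro u a b
    induction u with
    | zero => simp
    | tmul x y => simp [antipodeMap_mul, mul_assoc]
    | add x y hx hy => simp only [add_mul, map_add, hx, hy, mul_add]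
  induction t with
  | zero => simp
  | tmul x y => rw [key, h, mul_assoc, Algebra.commutes]; simp [mul_assoc]
  | add x y hx hy => simp only [map_add, hx, hy, add_mul]

noncomputable instance : HopfAlgebra F D.Alg where
  antipode := D.antipodeMap
  mul_antipode_rTensor_comul := by
    ext x
    induction x using D.induction with
    | hs c =>
      simp [Algebra.TensorProduct.one_def, antipodeMap_one, Algebra.algebraMap_eq_smul_one]
    | hg g =>
      cases g with
      | K a => simp [comul_K, counit_K, antipodeMap_K, K_neg_mul]
      | X j => simp [comul_X, counit_X, antipodeMap_X, antipodeMap_K, mul_assoc, K_neg_mul]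
    | ha x y hx hy => simpa using! congr($hx + $hy)
    | hm x y hx hy =>
      simp only [LinearMap.comp_apply, Algebra.linearMap_apply] at hx hy ⊢
      rw [Bialgebra.comul_mul, antipode_rTensor_mul _ _ _ hx, hy, Bialgebra.counit_mul, map_mul]
  mul_antipode_lTensor_comul := by
    ext x
    induction x using D.induction with
    | hs c =>
      simp [Algebra.TensorProduct.one_def, antipodeMap_one, Algebra.algebraMap_eq_smul_one]
    | hg g =>
      cases g with
      | K a => simp [comul_K, counit_K, antipodeMap_K, K_mul_neg]
      | X j =>
        simp [comul_X, counit_X, antipodeMap_X, antipodeMap_K, ← mul_assoc, K_mul_neg]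
    | ha x y hx hy => simpa using! congr($hx + $hy)
    | hm x y hx hy =>
      simp only [LinearMap.comp_apply, Algebra.linearMap_apply] at hx hy ⊢
      rw [Bialgebra.comul_mul, antipode_lTensor_mul _ _ _ hy, hx, Bialgebra.counit_mul, map_mul]

theorem antipode_K (a : L) : HopfAlgebra.antipode F (D.K a) = D.K (-a) :=
  D.antipodeMap_K a

theorem antipode_X (j : J) : HopfAlgebra.antipode F (D.X j) =
    -(D.K (-D.left j) * D.X j * D.K (-D.right j)) :=
  D.antipodeMap_X j

end TorusDatum
end Base

section SkewPrimitive

variable (F : Type*) [Field F] {A : Type*} [Ring A]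

/-- `u` is a skew-primitive element: `Δ(u) = u ⊗ g + h ⊗ u` with `g`, `h` group-like. -/
def IsSkewPrimitive [Bialgebra F A] (u : A) : Prop :=
  ∃ g h : A, IsGroupLikeElem F g ∧ IsGroupLikeElem F h ∧
    Coalgebra.comul (R := F) u = u ⊗ₜ[F] g + h ⊗ₜ[F] u

/-- The two-sided ideal generated by a set. -/
abbrev idealOf (S : Set A) : Ideal A := (TwoSidedIdeal.span S).asIdeal

variable {F}

theorem idealOf_le {B : Type*} [Ring B] (f : A →+* B) {S : Set A}
    (h : ∀ u ∈ S, f u = 0) {x : A} (hx : x ∈ idealOf S) : f x = 0 := by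
  have hle : TwoSidedIdeal.span S ≤ TwoSidedIdeal.ker f :=
    TwoSidedIdeal.span_le.2 fun u hu ↦ (TwoSidedIdeal.mem_ker f).2 (h u hu)
  exact (TwoSidedIdeal.mem_ker f).1 (hle (TwoSidedIdeal.mem_asIdeal.1 hx))

theorem IsSkewPrimitive.counit_eq_zero [Bialgebra F A] {u : A} (hu : IsSkewPrimitive F u) :
    Coalgebra.counit (R := F) u = 0 := by
  obtain ⟨g, h, hg, hh, e⟩ := hu
  have h2 := congr(Coalgebra.counit (R := F) (TensorProduct.lid F A $(Coalgebra.rTensor_counit_comul (R := F) u)))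
  rw [e] at h2
  simpa [hg.counit_eq_one, hh.counit_eq_one] using h2

theorem isCoideal_idealOf [Bialgebra F A] {S : Set A} (hS : ∀ u ∈ S, IsSkewPrimitive F u) :
    ((idealOf S).restrictScalars F).IsCoideal where
  counit_eq_zero x hx := idealOf_le (Bialgebra.counitAlgHom F A : A →+* F)
    (fun u hu ↦ (hS u hu).counit_eq_zero) hx
  map_mkQ_comul_eq_zero x hx := by
    refine idealOf_le (RingHomClass.toRingHom ((Algebra.TensorProduct.map (Ideal.Quotient.mkₐ F (idealOf S))
      (Ideal.Quotient.mkₐ F (idealOf S))).comp (Bialgebra.comulAlgHom F A)))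
      (fun u hu ↦ ?_) hx
    obtain ⟨g, h, hg, hh, e⟩ := hS u hu
    have hu0 : Ideal.Quotient.mk (idealOf S) u = 0 :=
      Ideal.Quotient.eq_zero_iff_mem.2 (TwoSidedIdeal.mem_asIdeal.2 (TwoSidedIdeal.subset_span hu))
    simp [e, hu0]

theorem isHopfIdeal_idealOf [HopfAlgebra F A] {S : Set A} (hS : ∀ u ∈ S, IsSkewPrimitive F u) :
    (idealOf S).IsHopfIdeal F where
  toIsCoideal := isCoideal_idealOf hS
  antipode_mem x hx := by
    rw [← Ideal.Quotient.eq_zero_iff_mem, ← MulOpposite.op_eq_zero_iff]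
    refine idealOf_le (RingHomClass.toRingHom (((Ideal.Quotient.mkₐ F (idealOf S)).op).comp (HopfAlgebra.antipodeAlgHomOp F A)))
      (fun u hu ↦ ?_) hx
    obtain ⟨g, h, hg, hh, e⟩ := hS u hu
    have e1 : HopfAlgebra.antipode F u = - (HopfAlgebra.antipode F h * u * HopfAlgebra.antipode F g) := by
      have h1 := HopfAlgebra.mul_antipode_rTensor_comul_apply (R := F) u
      have h2 := HopfAlgebra.mul_antipode_lTensor_comul_apply (R := F) g
      rw [hg.comul_eq_tmul_self, hg.counit_eq_one] at h2
      rw [e, (hS u hu).counit_eq_zero] at h1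
      simp at h1 h2
      rw [add_eq_zero_iff_eq_neg] at h1
      rw [← neg_mul, ← h1, mul_assoc, h2, mul_one]
    have hu0 : Ideal.Quotient.mk (idealOf S) u = 0 :=
      Ideal.Quotient.eq_zero_iff_mem.2 (TwoSidedIdeal.mem_asIdeal.2 (TwoSidedIdeal.subset_span hu))
    have : Ideal.Quotient.mk (idealOf S) (HopfAlgebra.antipode F u) = 0 := by
      rw [e1]; simp [hu0]
    simpa using this

theorem IsSkewPrimitive.sub_of_isGroupLikeElem [Bialgebra F A] {a b : A} (ha : IsGroupLikeElem F a)
    (hb : IsGroupLikeElem F b) : IsSkewPrimitive F (a - b) :=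
  ⟨a, b, ha, hb, by
    rw [map_sub, ha.comul_eq_tmul_self, hb.comul_eq_tmul_self]
    simp [TensorProduct.sub_tmul, TensorProduct.tmul_sub]⟩

end SkewPrimitive

section QNumbers

variable {F : Type*} [Field F]

/-- `(n)_p = (p ^ n - 1) / (p - 1)`, written as `1 + p + ⋯ + p ^ (n - 1)`. -/
def qInt (p : F) (n : ℕ) : F := ∑ i ∈ Finset.range n, p ^ i

/-- `(n)_p!`. -/
def qFactorial (p : F) (n : ℕ) : F := ∏ i ∈ Finset.range n, qInt p (i + 1)

/-- The Gaussian binomial coefficient `(n choose k)_p`. -/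
def qBinom (p : F) (n k : ℕ) : F := qFactorial p n / (qFactorial p k * qFactorial p (n - k))

/-- `[n]_q = (q ^ n - q ^ (-n)) / (q - q ^ (-1))`. -/
def qIntSym (q : F) (n : ℕ) : F := (q ^ n - q⁻¹ ^ n) / (q - q⁻¹)

/-- `[n]_q!`. -/
def qFactorialSym (q : F) (n : ℕ) : F := ∏ i ∈ Finset.range n, qIntSym q (i + 1)

/-- The symmetric Gaussian binomial coefficient `[n choose k]_q`. -/
def qBinomSym (q : F) (n k : ℕ) : F :=
  qFactorialSym q n / (qFactorialSym q k * qFactorialSym q (n - k))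

theorem qFactorial_succ (p : F) (n : ℕ) :
    qFactorial p (n + 1) = qFactorial p n * qInt p (n + 1) := Finset.prod_range_succ ..

theorem qFactorial_ne_zero {p : F} (hp : ∀ n, qInt p (n + 1) ≠ 0) (n : ℕ) :
    qFactorial p n ≠ 0 := Finset.prod_ne_zero_iff.2 fun i _ ↦ hp i

theorem qBinom_zero {p : F} (hp : ∀ n, qInt p (n + 1) ≠ 0) (n : ℕ) : qBinom p n 0 = 1 := by
  have h0 : qFactorial p 0 = 1 := by simp [qFactorial]
  simp [qBinom, h0, qFactorial_ne_zero hp n]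

theorem qBinom_self {p : F} (hp : ∀ n, qInt p (n + 1) ≠ 0) (n : ℕ) : qBinom p n n = 1 := by
  have h0 : qFactorial p 0 = 1 := by simp [qFactorial]
  simp [qBinom, h0, qFactorial_ne_zero hp n]

theorem qBinom_symm (p : F) {n k : ℕ} (h : k ≤ n) : qBinom p n (n - k) = qBinom p n k := by
  rw [qBinom, qBinom, Nat.sub_sub_self h, mul_comm (qFactorial p k)]

theorem qInt_add (p : F) (a b : ℕ) : qInt p (a + b) = qInt p a + p ^ a * qInt p b := by
  simp [qInt, Finset.sum_range_add, pow_add, Finset.mul_sum]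

theorem qBinom_succ {p : F} (hp : ∀ n, qInt p (n + 1) ≠ 0) {n k : ℕ} (h : k < n) :
    qBinom p (n + 1) (k + 1) = qBinom p n (k + 1) + p ^ (n - k) * qBinom p n k := by
  obtain ⟨m, rfl⟩ : ∃ m, n = k + 1 + m := ⟨n - (k + 1), by omega⟩
  have e1 : k + 1 + m + 1 - (k + 1) = m + 1 := by omega
  have e2 : k + 1 + m - (k + 1) = m := by omega
  have e3 : k + 1 + m - k = m + 1 := by omega
  have h1 := qFactorial_ne_zero hp k
  have h2 := qFactorial_ne_zero hp m
  have h3 := hp k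
  have h4 := hp m
  rw [qBinom, qBinom, qBinom, e1, e2, e3, qFactorial_succ p (k + 1 + m), qFactorial_succ p k,
    qFactorial_succ p m, show k + 1 + m + 1 = (m + 1) + (k + 1) by omega, qInt_add p (m + 1)]
  field_simp
  try ring

/-- The coefficients `(-1) ^ k (m choose k)_p p ^ (k choose 2) s ^ k`. -/
def serreCoeff (p s : F) (m k : ℕ) : F := (-1) ^ k * qBinom p m k * p ^ k.choose 2 * s ^ k

theorem serreCoeff_succ {p : F} (hp : ∀ n, qInt p (n + 1) ≠ 0) (s : F) {n k : ℕ} (h : k < n) :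
    serreCoeff p s (n + 1) (k + 1) = serreCoeff p s n (k + 1) - p ^ n * s * serreCoeff p s n k := by
  obtain ⟨l, rfl⟩ : ∃ l, n = k + l := ⟨n - k, by omega⟩
  rw [serreCoeff, qBinom_succ hp h, serreCoeff, serreCoeff, Nat.choose_succ_succ', Nat.choose_one_right,
    Nat.add_sub_cancel_left]
  ring

theorem serreCoeff_last {p : F} (hp : ∀ n, qInt p (n + 1) ≠ 0) (s : F) (n : ℕ) :
    serreCoeff p s (n + 1) (n + 1) = - (p ^ n * s * serreCoeff p s n n) := by
  rw [serreCoeff, serreCoeff, qBinom_self hp, qBinom_self hp, Nat.choose_succ_succ', Nat.choose_one_right]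
  ring

variable {A : Type*} [Ring A] [Algebra F A]

/-- `∑ k, c_k X ^ (m - k) Y X ^ k`. -/
def serreSum (c : ℕ → F) (m : ℕ) (X Y : A) : A :=
  ∑ k ∈ Finset.range (m + 1), c k • (X ^ (m - k) * Y * X ^ k)

/-- `∑ k, c_k X ^ k Y X ^ (m - k)`. -/
def serreSumRev (c : ℕ → F) (m : ℕ) (X Y : A) : A :=
  ∑ k ∈ Finset.range (m + 1), c k • (X ^ k * Y * X ^ (m - k))

theorem serreSum_succ {p : F} (hp : ∀ n, qInt p (n + 1) ≠ 0) (s : F) (n : ℕ) (X Y : A) :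
    serreSum (serreCoeff p s (n + 1)) (n + 1) X Y =
      X * serreSum (serreCoeff p s n) n X Y -
        (p ^ n * s) • (serreSum (serreCoeff p s n) n X Y * X) := by
  have h0 : serreCoeff p s (n + 1) 0 = serreCoeff p s n 0 := by
    simp [serreCoeff, qBinom_zero hp]
  rw [serreSum, Finset.sum_range_succ, Finset.sum_range_succ', h0, serreCoeff_last hp]
  have h1 : ∀ k ∈ Finset.range n,
      serreCoeff p s (n + 1) (k + 1) • (X ^ (n + 1 - (k + 1)) * Y * X ^ (k + 1)) =
      X * (serreCoeff p s n (k + 1) • (X ^ (n - (k + 1)) * Y * X ^ (k + 1))) -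
      (p ^ n * s) • (serreCoeff p s n k • (X ^ (n - k) * Y * X ^ k) * X) := by
    intro k hk
    have hk := Finset.mem_range.1 hk
    rw [serreCoeff_succ hp s hk, show n + 1 - (k + 1) = n - k by omega,
      show n - k = (n - (k + 1)) + 1 by omega, sub_smul, mul_smul_comm, smul_mul_assoc, smul_smul,
      pow_succ' X (n - (k + 1)), pow_succ X k]
    simp only [mul_assoc]
  rw [Finset.sum_congr rfl h1, Finset.sum_sub_distrib, ← Finset.mul_sum, ← Finset.smul_sum,
    ← Finset.sum_mul]
  conv_rhs => rw [serreSum]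
  conv_rhs => enter [1]; rw [Finset.sum_range_succ']
  conv_rhs => enter [2]; rw [Finset.sum_range_succ]
  simp only [mul_add, add_mul, smul_add, pow_zero, Nat.sub_zero, mul_one, Nat.sub_self, one_mul,
    mul_smul_comm, smul_mul_assoc, smul_smul, neg_smul, pow_succ' X n, mul_assoc]
  rw [← pow_succ, pow_succ']
  abel

theorem serreSum_zero (p s : F) (X Y : A) : serreSum (serreCoeff p s 0) 0 X Y = Y := by
  simp [serreSum, serreCoeff, qBinom, qFactorial]

theorem serreSum_comm {p : F} (hp : ∀ n, qInt p (n + 1) ≠ 0) (s : F) (n : ℕ) (X Y Z : A)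
    (h1 : Z * X = p • (X * Z)) (h2 : Z * Y = s • (Y * Z)) :
    Z * serreSum (serreCoeff p s n) n X Y =
      (p ^ n * s) • (serreSum (serreCoeff p s n) n X Y * Z) := by
  induction n with
  | zero => simpa [serreSum_zero] using h2
  | succ n ih =>
    rw [serreSum_succ hp]
    set U := serreSum (serreCoeff p s n) n X Y
    rw [mul_sub, ← mul_assoc, h1, mul_smul_comm, ← mul_assoc Z, ih, smul_mul_assoc, mul_assoc X, ih,
      smul_mul_assoc, mul_assoc U, h1, sub_mul]
    simp only [mul_smul_comm, smul_mul_assoc, smul_smul, mul_assoc, smul_sub]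
    congr 2 <;> ring

theorem serreSum_left {p : F} (hp : ∀ n, qInt p (n + 1) ≠ 0) (s : F) (n : ℕ) (X X' Y : A)
    (h1 : X' * X = p • (X * X')) (h2 : X' * Y = s • (Y * X')) :
    serreSum (serreCoeff p s n) n (X + X') Y = serreSum (serreCoeff p s n) n X Y := by
  induction n with
  | zero => simp [serreSum_zero]
  | succ n ih =>
    rw [serreSum_succ hp, serreSum_succ hp, ih, add_mul, serreSum_comm hp s n X Y X' h1 h2, mul_add,
      smul_add]
    abel

theorem serreSumRev_right {p : F} (hp : ∀ n, qInt p (n + 1) ≠ 0) (r : F) (n : ℕ) (X X' Y : A)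
    (h1 : X' * X = p • (X * X')) (h2 : Y * X = r • (X * Y)) :
    serreSumRev (serreCoeff p r n) n (X + X') Y = serreSumRev (serreCoeff p r n) n X' Y := by
  have key : ∀ Z : A, MulOpposite.op (serreSumRev (serreCoeff p r n) n Z Y) =
      serreSum (serreCoeff p r n) n (MulOpposite.op Z) (MulOpposite.op Y) := by
    intro Z
    simp [serreSumRev, serreSum, ← MulOpposite.op_mul, ← MulOpposite.op_pow, ← MulOpposite.op_smul,
      mul_assoc]
  apply MulOpposite.op_injective
  rw [key, key, add_comm, MulOpposite.op_add]
  apply serreSum_left hp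
  · rw [← MulOpposite.op_mul, h1]; simp
  · rw [← MulOpposite.op_mul, h2]; simp

theorem choose_two_aux {n k l : ℕ} (h : n + 1 = k + l) :
    (n + 1).choose 2 + k.choose 2 = l.choose 2 + n * k := by
  have h1 : ∀ a : ℕ, 2 * a.choose 2 + a = a * a := by
    intro a
    induction a with
    | zero => rfl
    | succ a ih => rw [Nat.choose_succ_succ', Nat.choose_one_right]; linarith
  have h2 := h1 (n + 1)
  have h3 := h1 k
  have h4 := h1 l
  zify at *
  have h5 : (n : ℤ) = k + l - 1 := by linarith
  rw [h5] at h2 ⊢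
  linarith

theorem serreSumRev_eq {p r s : F} {n : ℕ} (h : p ^ n * r * s = 1) (X Y : A) :
    serreSumRev (serreCoeff p r (n + 1)) (n + 1) X Y = 
      ((-1) ^ (n + 1) * r ^ (n + 1) * p ^ (n + 1).choose 2) •
        serreSum (serreCoeff p s (n + 1)) (n + 1) X Y := by
  rw [serreSumRev, ← Finset.sum_range_reflect, serreSum, Finset.smul_sum]
  refine Finset.sum_congr rfl fun k hk ↦ ?_
  have hk : k ≤ n + 1 := Nat.lt_succ_iff.1 (Finset.mem_range.1 hk)
  rw [show n + 1 + 1 - 1 - k = n + 1 - k by omega, Nat.sub_sub_self hk, smul_smul]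
  congr 1
  rw [serreCoeff, serreCoeff, qBinom_symm p hk]
  obtain ⟨l, hl⟩ : ∃ l, n + 1 = k + l := ⟨n + 1 - k, by omega⟩
  have e := choose_two_aux hl
  have hk1 : (p ^ n * r * s) ^ k = 1 := by rw [h, one_pow]
  have hs : ((-1 : F) ^ k) * (-1) ^ k = 1 := by rw [← mul_pow]; simp
  have hpe : p ^ (n + 1).choose 2 * p ^ k.choose 2 = p ^ l.choose 2 * (p ^ n) ^ k := by
    rw [← pow_add, e, pow_add, pow_mul]
  rw [hl, Nat.add_sub_cancel_left, ← hl]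
  rw [mul_pow, mul_pow] at hk1
  calc (-1) ^ l * qBinom p (n + 1) k * p ^ l.choose 2 * r ^ l
      = (-1) ^ l * qBinom p (n + 1) k * p ^ l.choose 2 * r ^ l * (((-1 : F) ^ k) * (-1) ^ k) *
          ((p ^ n) ^ k * r ^ k * s ^ k) := by rw [hs, hk1]; ring
    _ = (-1) ^ (k + l) * r ^ (k + l) * ((-1) ^ k * qBinom p (n + 1) k * s ^ k) *
          (p ^ l.choose 2 * (p ^ n) ^ k) := by ring
    _ = _ := by rw [← hpe, hl]; ring

theorem serreSum_add {p r s : F} (hp : ∀ n, qInt p (n + 1) ≠ 0) {n : ℕ} (h : p ^ n * r * s = 1)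
    {X X' Y Y' : A} (h1 : X' * X = p • (X * X')) (h2 : X' * Y = s • (Y * X'))
    (h3 : Y' * X = r • (X * Y')) :
    serreSum (serreCoeff p s (n + 1)) (n + 1) (X + X') (Y + Y') =
      serreSum (serreCoeff p s (n + 1)) (n + 1) X Y +
        serreSum (serreCoeff p s (n + 1)) (n + 1) X' Y' := by
  have hadd : serreSum (serreCoeff p s (n + 1)) (n + 1) (X + X') (Y + Y') =
      serreSum (serreCoeff p s (n + 1)) (n + 1) (X + X') Y +
        serreSum (serreCoeff p s (n + 1)) (n + 1) (X + X') Y' := by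
    simp [serreSum, mul_add, add_mul, Finset.sum_add_distrib]
  rw [hadd, serreSum_left hp s _ X X' Y h1 h2]
  congr 1
  have h4 := serreSumRev_right hp r (n + 1) X X' Y' h1 h3
  rw [serreSumRev_eq h, serreSumRev_eq h] at h4
  have hp0 : p ≠ 0 ∨ n = 0 := by
    by_contra! hc
    rw [hc.1, zero_pow hc.2] at h
    simp at h
  have hc : (-1 : F) ^ (n + 1) * r ^ (n + 1) * p ^ (n + 1).choose 2 ≠ 0 := by
    have hr : r ≠ 0 := by rintro rfl; simp at h
    rcases hp0 with hp0 | rfl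
    · simp [hr, hp0]
    · simp [hr]
  exact smul_right_injective A hc h4

theorem serreSumRev_add {p r s : F} (hp : ∀ n, qInt p (n + 1) ≠ 0) {n : ℕ} (h : p ^ n * r * s = 1)
    {X X' Y Y' : A} (h1 : X' * X = p • (X * X')) (h2 : X' * Y = s • (Y * X'))
    (h3 : Y' * X = r • (X * Y')) :
    serreSumRev (serreCoeff p r (n + 1)) (n + 1) (X + X') (Y + Y') =
      serreSumRev (serreCoeff p r (n + 1)) (n + 1) X Y +
        serreSumRev (serreCoeff p r (n + 1)) (n + 1) X' Y' := by
  rw [serreSumRev_eq h, serreSumRev_eq h, serreSumRev_eq h, serreSum_add hp h h1 h2 h3, smul_add]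

end QNumbers

section SkewRelations

namespace TorusDatum

variable {F : Type*} [Field F] {L : Type*} [AddCommGroup L] {J : Type*} (D : TorusDatum F L J)

theorem isGroupLikeElem_K (a : L) : IsGroupLikeElem F (D.K a) := ⟨D.counit_K a, D.comul_K a⟩

theorem commute_K (a b : L) : Commute (D.K a) (D.K b) := by
  rw [Commute, SemiconjBy, ← K_add, ← K_add, add_comm]

theorem cross (i j : J) (a b : L) : (D.K b ⊗ₜ[F] D.X i) * (D.X j ⊗ₜ[F] D.K a) =
    (D.wt j (.ofAdd b) * D.wt i (.ofAdd (-a))) • ((D.X j ⊗ₜ[F] D.K a) * (D.K b ⊗ₜ[F] D.X i)) := by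
  rw [Algebra.TensorProduct.tmul_mul_tmul, Algebra.TensorProduct.tmul_mul_tmul, D.K_mul_X b,
    D.X_mul_K a,
    TensorProduct.tmul_smul, TensorProduct.smul_tmul', smul_smul, mul_comm, TensorProduct.smul_tmul']

theorem cross_inv (i j : J) (a b : L) {c : F}
    (h : D.wt j (.ofAdd b) * D.wt i (.ofAdd (-a)) * c = 1) :
    (D.X j ⊗ₜ[F] D.K a) * (D.K b ⊗ₜ[F] D.X i) =
      c • ((D.K b ⊗ₜ[F] D.X i) * (D.X j ⊗ₜ[F] D.K a)) := by
  rw [cross, smul_smul, mul_comm, h, one_smul]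

theorem map_serreSum {A B : Type*} [Ring A] [Algebra F A] [Ring B] [Algebra F B] (f : A →ₐ[F] B)
    (c : ℕ → F) (m : ℕ) (x y : A) : f (serreSum c m x y) = serreSum c m (f x) (f y) := by
  simp [serreSum]

theorem map_serreSumRev {A B : Type*} [Ring A] [Algebra F A] [Ring B] [Algebra F B] (f : A →ₐ[F] B)
    (c : ℕ → F) (m : ℕ) (x y : A) : f (serreSumRev c m x y) = serreSumRev c m (f x) (f y) := by
  simp [serreSumRev]

theorem pow_mul_mul_pow {A : Type*} [Ring A] {g h : A} (e : Commute g h) {m k : ℕ} (hk : k ≤ m) :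
    g ^ (m - k) * h * g ^ k = g ^ m * h := by
  rw [mul_assoc, ← (e.pow_left k).eq, ← mul_assoc, ← pow_add, Nat.sub_add_cancel hk]

theorem pow_mul_mul_pow_rev {A : Type*} [Ring A] {g h : A} (e : Commute g h) {m k : ℕ}
    (hk : k ≤ m) : g ^ k * h * g ^ (m - k) = g ^ m * h := by
  rw [mul_assoc, ← (e.pow_left _).eq, ← mul_assoc, ← pow_add, Nat.add_sub_cancel' hk]

section
variable {A : Type*} [Ring A] [Algebra F A] (c : ℕ → F) (m : ℕ) (x y : A) {g h : A}

theorem serreSum_tmul_right (e : Commute g h) :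
    serreSum c m (x ⊗ₜ[F] g) (y ⊗ₜ[F] h) = serreSum c m x y ⊗ₜ[F] (g ^ m * h) := by
  rw [serreSum, serreSum, TensorProduct.sum_tmul]
  refine Finset.sum_congr rfl fun k hk ↦ ?_
  simp [TensorProduct.smul_tmul', pow_mul_mul_pow e (Nat.lt_succ_iff.1 (Finset.mem_range.1 hk))]

theorem serreSum_tmul_left (e : Commute g h) :
    serreSum c m (g ⊗ₜ[F] x) (h ⊗ₜ[F] y) = (g ^ m * h) ⊗ₜ[F] serreSum c m x y := by
  rw [serreSum, serreSum, TensorProduct.tmul_sum]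
  refine Finset.sum_congr rfl fun k hk ↦ ?_
  simp [pow_mul_mul_pow e (Nat.lt_succ_iff.1 (Finset.mem_range.1 hk))]

theorem serreSumRev_tmul_right (e : Commute g h) :
    serreSumRev c m (x ⊗ₜ[F] g) (y ⊗ₜ[F] h) = serreSumRev c m x y ⊗ₜ[F] (g ^ m * h) := by
  rw [serreSumRev, serreSumRev, TensorProduct.sum_tmul]
  refine Finset.sum_congr rfl fun k hk ↦ ?_
  simp [TensorProduct.smul_tmul', pow_mul_mul_pow_rev e (Nat.lt_succ_iff.1 (Finset.mem_range.1 hk))]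

theorem serreSumRev_tmul_left (e : Commute g h) :
    serreSumRev c m (g ⊗ₜ[F] x) (h ⊗ₜ[F] y) = (g ^ m * h) ⊗ₜ[F] serreSumRev c m x y := by
  rw [serreSumRev, serreSumRev, TensorProduct.tmul_sum]
  refine Finset.sum_congr rfl fun k hk ↦ ?_
  simp [pow_mul_mul_pow_rev e (Nat.lt_succ_iff.1 (Finset.mem_range.1 hk))]

end

theorem isSkewPrimitive_serreSum {p r s : F} (hp : ∀ n, qInt p (n + 1) ≠ 0) {n : ℕ}
    (h : p ^ n * r * s = 1) {i j : J}
    (h1 : D.wt i (.ofAdd (D.left i)) * D.wt i (.ofAdd (-D.right i)) = p)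
    (h2 : D.wt j (.ofAdd (D.left i)) * D.wt i (.ofAdd (-D.right j)) = s)
    (h3 : D.wt i (.ofAdd (D.left j)) * D.wt j (.ofAdd (-D.right i)) = r) :
    IsSkewPrimitive F (serreSum (serreCoeff p s (n + 1)) (n + 1) (D.X i) (D.X j)) := by
  refine ⟨D.K (D.right i) ^ (n + 1) * D.K (D.right j), D.K (D.left i) ^ (n + 1) * D.K (D.left j),
    (D.isGroupLikeElem_K _).pow.mul (D.isGroupLikeElem_K _),
    (D.isGroupLikeElem_K _).pow.mul (D.isGroupLikeElem_K _), ?_⟩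
  rw [← serreSum_tmul_right _ _ _ _ (D.commute_K _ _), ← serreSum_tmul_left _ _ _ _ (D.commute_K _ _),
    ← serreSum_add hp h, ← comul_X, ← comul_X]
  · exact map_serreSum (Bialgebra.comulAlgHom F D.Alg) _ _ _ _
  · rw [cross, h1]
  · rw [cross, h2]
  · rw [cross, h3]

theorem isSkewPrimitive_serreSumRev {p r s : F} (hp : ∀ n, qInt p (n + 1) ≠ 0) {n : ℕ}
    (h : p ^ n * r * s = 1) {i j : J}
    (h1 : D.wt i (.ofAdd (D.left i)) * D.wt i (.ofAdd (-D.right i)) * p = 1)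
    (h2 : D.wt i (.ofAdd (D.left j)) * D.wt j (.ofAdd (-D.right i)) * s = 1)
    (h3 : D.wt j (.ofAdd (D.left i)) * D.wt i (.ofAdd (-D.right j)) * r = 1) :
    IsSkewPrimitive F (serreSumRev (serreCoeff p r (n + 1)) (n + 1) (D.X i) (D.X j)) := by
  refine ⟨D.K (D.right i) ^ (n + 1) * D.K (D.right j), D.K (D.left i) ^ (n + 1) * D.K (D.left j),
    (D.isGroupLikeElem_K _).pow.mul (D.isGroupLikeElem_K _),
    (D.isGroupLikeElem_K _).pow.mul (D.isGroupLikeElem_K _), ?_⟩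
  rw [← serreSumRev_tmul_right _ _ _ _ (D.commute_K _ _),
    ← serreSumRev_tmul_left _ _ _ _ (D.commute_K _ _),
    add_comm (serreSumRev _ _ _ _), ← serreSumRev_add hp h,
    add_comm (D.K (D.left i) ⊗ₜ[F] D.X i), ← comul_X,
    add_comm (D.K (D.left j) ⊗ₜ[F] D.X j), ← comul_X]
  · exact map_serreSumRev (Bialgebra.comulAlgHom F D.Alg) _ _ _ _
  · rw [cross_inv _ _ _ _ _ h1]
  · rw [cross_inv _ _ _ _ _ h2]
  · rw [cross_inv _ _ _ _ _ h3]

/-- `[X_i, X_j] - c (K_a - K_b)` is skew-primitive under compatibility of the weights. -/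
theorem isSkewPrimitive_commutator {i j : J} {a b : L} {c : F}
    (h1 : D.wt i (.ofAdd (D.left j)) = D.wt j (.ofAdd (D.right i)))
    (h2 : D.wt j (.ofAdd (D.left i)) = D.wt i (.ofAdd (D.right j)))
    (h3 : c = 0 ∨ D.left i + D.left j = a ∧ D.right i + D.right j = b) :
    IsSkewPrimitive F (D.X i * D.X j - D.X j * D.X i - c • (D.K a - D.K b)) := by
  refine ⟨D.K (D.right i + D.right j), D.K (D.left i + D.left j), D.isGroupLikeElem_K _,
    D.isGroupLikeElem_K _, ?_⟩
  have hc : Coalgebra.comul (R := F) (c • (D.K a - D.K b)) =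
      (c • (D.K a - D.K b)) ⊗ₜ[F] D.K (D.right i + D.right j) +
      D.K (D.left i + D.left j) ⊗ₜ[F] (c • (D.K a - D.K b)) := by
    rcases h3 with rfl | ⟨rfl, rfl⟩
    · simp
    · simp [comul_K, TensorProduct.sub_tmul, TensorProduct.tmul_sub, ← TensorProduct.smul_tmul',
        ← smul_add]
  rw [map_sub, hc, map_sub, Bialgebra.comul_mul, Bialgebra.comul_mul, comul_X, comul_X]
  have e1 : (D.X i * D.K (D.left j)) ⊗ₜ[F] (D.K (D.right i) * D.X j) =
      (D.K (D.left j) * D.X i) ⊗ₜ[F] (D.X j * D.K (D.right i)) := by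
    rw [K_mul_X, K_mul_X, h1, TensorProduct.tmul_smul, TensorProduct.smul_tmul']
  have e2 : (D.K (D.left i) * D.X j) ⊗ₜ[F] (D.X i * D.K (D.right j)) =
      (D.X j * D.K (D.left i)) ⊗ₜ[F] (D.K (D.right j) * D.X i) := by
    rw [K_mul_X, K_mul_X, h2, TensorProduct.tmul_smul, TensorProduct.smul_tmul']
  simp only [mul_add, add_mul, Algebra.TensorProduct.tmul_mul_tmul, e1, e2,
    TensorProduct.sub_tmul, TensorProduct.tmul_sub, ← K_add]
  rw [add_comm (D.right j), add_comm (D.left j)]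
  abel

end TorusDatum
end SkewRelations

section GroundField

variable (𝕜 : Type*) [Field 𝕜]

/-- `𝕜_q = ⋃_m 𝕜(q^{1/m})`: the field of fractions of the group algebra of `(ℚ, +)`, whose
basis element of index `r` is `q ^ r`. -/
abbrev QField : Type _ := FractionRing (AddMonoidAlgebra 𝕜 ℚ)

/-- `r ↦ q ^ r`. -/
noncomputable def qPowHom : Multiplicative ℚ →* QField 𝕜 :=
  (algebraMap (AddMonoidAlgebra 𝕜 ℚ) (QField 𝕜)).toMonoidHom.comp (AddMonoidAlgebra.of 𝕜 ℚ)

/-- `q ^ r`. -/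
noncomputable def qPow (r : ℚ) : QField 𝕜 := qPowHom 𝕜 (.ofAdd r)

/-- The character `x ↦ q ^ w(x)`. -/
noncomputable def qChar {L : Type*} [AddCommGroup L] (w : L →+ ℚ) : Multiplicative L →* QField 𝕜 :=
  (qPowHom 𝕜).comp (AddMonoidHom.toMultiplicative w)

variable {𝕜}

theorem qChar_ofAdd {L : Type*} [AddCommGroup L] (w : L →+ ℚ) (x : L) :
    qChar 𝕜 w (.ofAdd x) = qPow 𝕜 (w x) := rfl

theorem qPow_zero : qPow 𝕜 0 = 1 := map_one (qPowHom 𝕜)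

theorem qPow_add (r s : ℚ) : qPow 𝕜 (r + s) = qPow 𝕜 r * qPow 𝕜 s := map_mul (qPowHom 𝕜) _ _

theorem qPow_pow (r : ℚ) (n : ℕ) : qPow 𝕜 r ^ n = qPow 𝕜 (n * r) := by
  induction n with
  | zero => simp [qPow_zero]
  | succ n ih => rw [pow_succ, ih, ← qPow_add]; congr 1; push_cast; ring

theorem qPow_ne_zero (r : ℚ) : qPow 𝕜 r ≠ 0 := by
  intro h
  have := qPow_add (𝕜 := 𝕜) r (-r)
  simp [h, qPow_zero] at this

theorem qPow_eq_one {r : ℚ} (h : qPow 𝕜 r = 1) : r = 0 := by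
  rw [← qPow_zero (𝕜 := 𝕜)] at h
  have h1 := IsFractionRing.injective (AddMonoidAlgebra 𝕜 ℚ) (QField 𝕜) h
  exact Multiplicative.ofAdd.injective (AddMonoidAlgebra.of_injective h1)

theorem qInt_qPow_ne_zero {r : ℚ} (hr : r ≠ 0) (n : ℕ) : qInt (qPow 𝕜 r) (n + 1) ≠ 0 := by
  intro h
  have h1 := geom_sum_mul (qPow 𝕜 r) (n + 1)
  rw [qInt] at h
  rw [h, zero_mul, qPow_pow, eq_comm, sub_eq_zero] at h1
  have := qPow_eq_one h1
  have h3 : ((n + 1 : ℕ) : ℚ) ≠ 0 := by positivity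
  simp_all

end GroundField

section Symmetric

variable {F : Type*} [Field F]

theorem qInt_sq {q : F} (h0 : q ≠ 0) (h1 : q ^ 2 ≠ 1) (n : ℕ) :
    qInt (q ^ 2) (n + 1) = q ^ n * qIntSym q (n + 1) := by
  have h2 : q ^ 2 - 1 ≠ 0 := sub_ne_zero.2 h1
  rw [qInt, geom_sum_eq h1, qIntSym, inv_pow]
  field_simp
  ring

theorem qFactorial_sq {q : F} (h0 : q ≠ 0) (h1 : q ^ 2 ≠ 1) (n : ℕ) :
    qFactorial (q ^ 2) n = q ^ n.choose 2 * qFactorialSym q n := by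
  induction n with
  | zero => simp [qFactorial, qFactorialSym]
  | succ n ih =>
    rw [qFactorial_succ, ih, qInt_sq h0 h1, qFactorialSym, qFactorialSym, Finset.prod_range_succ,
      Nat.choose_succ_succ', Nat.choose_one_right]
    ring

theorem serreCoeff_sq {q s : F} (h0 : q ≠ 0) (h1 : q ^ 2 ≠ 1) {n : ℕ} (hs : s * q ^ n = 1) {k : ℕ}
    (hk : k ≤ n + 1) : serreCoeff (q ^ 2) s (n + 1) k = (-1) ^ k * qBinomSym q (n + 1) k := by
  obtain ⟨l, hl⟩ : ∃ l, n + 1 = k + l := ⟨n + 1 - k, by omega⟩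
  have e := choose_two_aux hl
  have hsk : s ^ k * q ^ (n * k) = 1 := by rw [pow_mul, ← mul_pow, hs, one_pow]
  have e2 : q ^ (n + 1).choose 2 * q ^ k.choose 2 = q ^ l.choose 2 * q ^ (n * k) := by
    rw [← pow_add, e, pow_add]
  have hkl : n + 1 - k = l := by omega
  rw [serreCoeff, qBinom, qBinomSym, hkl, qFactorial_sq h0 h1, qFactorial_sq h0 h1,
    qFactorial_sq h0 h1, mul_mul_mul_comm, mul_div_mul_comm]
  have : q ^ (n + 1).choose 2 / (q ^ k.choose 2 * q ^ l.choose 2) * (q ^ 2) ^ k.choose 2 * s ^ k = 1 := by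
    rw [← pow_mul, mul_comm 2, pow_mul, sq, mul_assoc]
    field_simp
    calc _ = q ^ (n + 1).choose 2 * q ^ k.choose 2 * s ^ k := by ring
      _ = _ := by rw [e2]; linear_combination (q ^ l.choose 2) * hsk
  linear_combination ((-1) ^ k * (qFactorialSym q (n + 1) / (qFactorialSym q k * qFactorialSym q l))) * this

variable {A : Type*} [Ring A] [Bialgebra F A]

theorem IsSkewPrimitive.smul {u : A} (hu : IsSkewPrimitive F u) (c : F) :
    IsSkewPrimitive F (c • u) := by
  obtain ⟨g, h, hg, hh, e⟩ := hu
  exact ⟨g, h, hg, hh, by simp [e, TensorProduct.smul_tmul']⟩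

end Symmetric

section Lie

/-- A symmetrizable generalized Cartan matrix `A`, with positive integers `d_i` such that
`d_i a_ij = d_j a_ji`. -/
structure CartanDatum (I : Type*) where
  A : Matrix I I ℤ
  d : I → ℕ
  diag : ∀ i, A i i = 2
  off_diag : ∀ i j, i ≠ j → A i j ≤ 0
  zero_iff : ∀ i j, A i j = 0 → A j i = 0
  d_pos : ∀ i, 0 < d i
  symm : ∀ i j, d i * A i j = d j * A j i

/-- The simple root `α_i`, as a vector of `ℚQ = ℚ ^ I`. -/
def simpleRoot {I : Type*} [DecidableEq I] (i : I) : I → ℚ := Pi.single i 1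

/-- A lattice `M` in `ℚQ` containing the root lattice. -/
structure RootLattice (I : Type*) [DecidableEq I] where
  carrier : AddSubgroup (I → ℚ)
  fg : carrier.FG
  simpleRoot_mem : ∀ i, simpleRoot i ∈ carrier

variable {I : Type*} [Fintype I] [DecidableEq I]

namespace CartanDatum

variable (C : CartanDatum I)

/-- `A`, with rational entries. -/
def cartan : Matrix I I ℚ := C.A.map (fun a : ℤ ↦ (a : ℚ))

/-- The symmetric matrix `D A`. -/
def symmetrized : Matrix I I ℚ := Matrix.of fun i j ↦ (C.d i : ℚ) * (C.A i j : ℚ)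

/-- The symmetric form on `ℚQ` with `(α_i, α_j) = d_i a_ij`. -/
noncomputable def form : LinearMap.BilinForm ℚ (I → ℚ) := Matrix.toBilin' C.symmetrized

/-- `ψ_+(α_l) = ∑ i j, ψ_ij a_jl d_i⁻¹ α_i`. -/
noncomputable def psiPlus (Ψ : Matrix I I ℚ) : (I → ℚ) →ₗ[ℚ] (I → ℚ) :=
  Matrix.toLin' (Matrix.of fun i l ↦ ∑ j, Ψ i j * C.cartan j l * (C.d i : ℚ)⁻¹)

/-- `ψ_-(α_l) = ∑ i j, ψ_ji a_jl d_i⁻¹ α_i`. -/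
noncomputable def psiMinus (Ψ : Matrix I I ℚ) : (I → ℚ) →ₗ[ℚ] (I → ℚ) :=
  Matrix.toLin' (Matrix.of fun i l ↦ ∑ j, Ψ j i * C.cartan j l * (C.d i : ℚ)⁻¹)

end CartanDatum

/-- A `q`-rational multiparameter of Cartan type: `q_ij = q ^ R_ij` with `R_ij ∈ ℚ`, such that
`q_ij q_ji = q ^ (2 d_i a_ij)` (hence `q_ii = q ^ (2 d_i)` and `q_ij q_ji = q_ii ^ a_ij`). -/
structure Multiparameter {I : Type*} (C : CartanDatum I) where
  R : Matrix I I ℚ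
  cartan : ∀ i j, R i j + R j i = 2 * ((C.d i : ℚ) * (C.A i j : ℚ))

/-- An antisymmetric rational twist matrix `Ψ` with `ψ_+(M) ⊆ M`. -/
structure ToralTwist (C : CartanDatum I) (M : RootLattice I) where
  Ψ : Matrix I I ℚ
  antisymm : Ψ.transpose = -Ψ
  psiPlus_mem : ∀ μ ∈ M.carrier, C.psiPlus Ψ μ ∈ M.carrier

namespace CartanDatum

variable (C : CartanDatum I)

theorem form_root (x : I → ℚ) (j : I) :
    C.form x (simpleRoot j) = ∑ k, x k * ((C.d k : ℚ) * (C.A k j : ℚ)) := by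
  simp [form, Matrix.toBilin'_apply, simpleRoot, Pi.single_apply, symmetrized]

theorem form_root_root (i j : I) :
    C.form (simpleRoot i) (simpleRoot j) = (C.d i : ℚ) * (C.A i j : ℚ) := by
  rw [form_root]
  simp [simpleRoot, Pi.single_apply]

theorem form_psi_root (Ψ : Matrix I I ℚ) (i j : I) :
    C.form (C.psiPlus Ψ (simpleRoot i)) (simpleRoot j) =
      C.form (C.psiMinus Ψ (simpleRoot j)) (simpleRoot i) := by
  have hd : ∀ k, (C.d k : ℚ) ≠ 0 := fun k ↦ by exact_mod_cast (C.d_pos k).ne'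
  rw [form_root, form_root]
  simp only [psiPlus, psiMinus, simpleRoot, Matrix.toLin'_apply, Matrix.mulVec_single_one,
    Matrix.col_apply, Matrix.of_apply, Finset.sum_mul, cartan, Matrix.map_apply]
  rw [Finset.sum_comm]
  refine Finset.sum_congr rfl fun k _ ↦ Finset.sum_congr rfl fun l _ ↦ ?_
  have h1 := hd k
  have h2 := hd l
  field_simp

theorem psiMinus_eq_neg {Ψ : Matrix I I ℚ} (h : Ψ.transpose = -Ψ) (x : I → ℚ) :
    C.psiMinus Ψ x = -C.psiPlus Ψ x := by
  have h1 : ∀ i j, Ψ j i = -Ψ i j := fun i j ↦ congr_fun (congr_fun h i) j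
  have h2 : C.psiMinus Ψ = -C.psiPlus Ψ := by
    rw [psiMinus, psiPlus, ← map_neg]
    congr 1
    ext i l
    rw [Matrix.neg_apply, Matrix.of_apply, Matrix.of_apply, ← Finset.sum_neg_distrib]
    refine Finset.sum_congr rfl fun j _ ↦ ?_
    rw [h1 i j]
    ring
  rw [h2, LinearMap.neg_apply]

end CartanDatum

namespace ToralTwist

variable {C : CartanDatum I} {M : RootLattice I} (T : ToralTwist C M)

/-- `ψ_+`, as an endomorphism of `M`. -/
noncomputable def plus : M.carrier →+ M.carrier :=
  ((C.psiPlus T.Ψ).toAddMonoidHom.comp M.carrier.subtype).codRestrict M.carrier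
    fun μ ↦ T.psiPlus_mem μ μ.2

/-- `ψ_-`, as an endomorphism of `M`. -/
noncomputable def minus : M.carrier →+ M.carrier :=
  ((C.psiMinus T.Ψ).toAddMonoidHom.comp M.carrier.subtype).codRestrict M.carrier
    fun μ ↦ by
      have h := M.carrier.neg_mem (T.psiPlus_mem μ μ.2)
      rw [← C.psiMinus_eq_neg T.antisymm] at h
      exact h

end ToralTwist

end Lie

section QuantumGroups

variable (𝕜 : Type*) [Field 𝕜] {I : Type*} [Fintype I] [DecidableEq I] {C : CartanDatum I}

/-- `α_i`, as an element of `M`. -/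
def RootLattice.root (M : RootLattice I) (i : I) : M.carrier := ⟨simpleRoot i, M.simpleRoot_mem i⟩

/-- The index `1 - a_ij` of the Serre relations. -/
def CartanDatum.serreIndex {I : Type*} (C : CartanDatum I) (i j : I) : ℕ := (1 - C.A i j).toNat

theorem CartanDatum.serreIndex_eq {I : Type*} (C : CartanDatum I) {i j : I} (h : i ≠ j) :
    ∃ n : ℕ, C.serreIndex i j = n + 1 ∧ (C.A i j : ℚ) = -n := by
  have h1 := C.off_diag i j h
  refine ⟨(-C.A i j).toNat, by unfold CartanDatum.serreIndex; omega, ?_⟩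
  have : (((-C.A i j).toNat : ℤ) : ℚ) = ((-C.A i j : ℤ) : ℚ) := by
    rw [Int.toNat_of_nonneg (by omega)]
  push_cast at this
  linarith

namespace Multiparameter

variable (P : Multiparameter C) (M : RootLattice I)

/-- `K_μ L_ν E_j = q ^ (w_j(μ, ν)) E_j K_μ L_ν`, where `K_{α_k} E_j = q_kj E_j K_{α_k}` and
`L_{α_k} E_j = q_jk⁻¹ E_j L_{α_k}`. -/
noncomputable def weight (j : I) : M.carrier × M.carrier →+ ℚ where
  toFun x := ∑ k, (x.1 : I → ℚ) k * P.R k j - ∑ k, P.R j k * (x.2 : I → ℚ) k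
  map_zero' := by simp
  map_add' x y := by simp [add_mul, mul_add, Finset.sum_add_distrib]; ring

/-- The torus data of `U_{𝐪,M•}(𝔤_D)`: `inl i` stands for `E_i`, `inr i` for `F_i`, and `(μ, ν)` for
`K_μ L_ν`. Here `Δ(E_i) = E_i ⊗ 1 + K_{α_i} ⊗ E_i` and `Δ(F_i) = F_i ⊗ L_{α_i} + 1 ⊗ F_i`. -/
noncomputable def torusDatum : TorusDatum (QField 𝕜) (M.carrier × M.carrier) (I ⊕ I) where
  wt := Sum.elim (fun i ↦ qChar 𝕜 (P.weight M i)) (fun i ↦ qChar 𝕜 (-P.weight M i))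
  left := Sum.elim (fun i ↦ (M.root i, 0)) (fun _ ↦ 0)
  right := Sum.elim (fun _ ↦ 0) (fun i ↦ (0, M.root i))

/-- The remaining relations of `U_{𝐪,M•}(𝔤_D)`:
`E_i F_j - F_j E_i = δ_ij q_ii (K_{α_i} - L_{α_i}) / (q_ii - 1)` and, for `i ≠ j`, `m = 1 - a_ij`,
`∑ k, (-1) ^ k (m choose k)_{q_ii} q_ii ^ (k choose 2) q_ij ^ k E_i ^ (m - k) E_j E_i ^ k = 0`,
`∑ k, (-1) ^ k (m choose k)_{q_ii} q_ii ^ (k choose 2) q_ij ^ k F_i ^ k F_j F_i ^ (m - k) = 0`. -/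
inductive Relator : (P.torusDatum 𝕜 M).Alg → Prop
  | commutator (i j : I) : Relator
      ((P.torusDatum 𝕜 M).X (.inl i) * (P.torusDatum 𝕜 M).X (.inr j) -
        (P.torusDatum 𝕜 M).X (.inr j) * (P.torusDatum 𝕜 M).X (.inl i) -
        (if i = j then qPow 𝕜 (P.R i i) / (qPow 𝕜 (P.R i i) - 1) else 0) •
          ((P.torusDatum 𝕜 M).K (M.root i, 0) - (P.torusDatum 𝕜 M).K (0, M.root i)))
  | serre_E (i j : I) (h : i ≠ j) : Relator
      (serreSum (serreCoeff (qPow 𝕜 (P.R i i)) (qPow 𝕜 (P.R i j)) (C.serreIndex i j))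
        (C.serreIndex i j) ((P.torusDatum 𝕜 M).X (.inl i)) ((P.torusDatum 𝕜 M).X (.inl j)))
  | serre_F (i j : I) (h : i ≠ j) : Relator
      (serreSumRev (serreCoeff (qPow 𝕜 (P.R i i)) (qPow 𝕜 (P.R i j)) (C.serreIndex i j))
        (C.serreIndex i j) ((P.torusDatum 𝕜 M).X (.inr i)) ((P.torusDatum 𝕜 M).X (.inr j)))

theorem R_diag {I : Type*} {C : CartanDatum I} (P : Multiparameter C) (i : I) :
    P.R i i = 2 * C.d i := by
  have := P.cartan i i
  rw [C.diag] at this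
  push_cast at this
  linarith

theorem weight_root_left (i j : I) : P.weight M j (M.root i, 0) = P.R i j := by
  simp [weight, RootLattice.root, simpleRoot, Pi.single_apply]

theorem weight_root_right (i j : I) : P.weight M j (0, M.root i) = -P.R j i := by
  simp [weight, RootLattice.root, simpleRoot, Pi.single_apply]

variable {𝕜 M P} in
theorem Relator.isSkewPrimitive {u : (P.torusDatum 𝕜 M).Alg} (hu : P.Relator 𝕜 M u) :
    IsSkewPrimitive (QField 𝕜) u := by
  have hd : ∀ i, P.R i i ≠ 0 := by
    intro i
    have := C.d_pos i
    rw [R_diag]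
    positivity
  cases hu with
  | commutator i j =>
    apply TorusDatum.isSkewPrimitive_commutator
    · simp [torusDatum, qChar]
    · simp [torusDatum, qChar_ofAdd, weight_root_left, weight_root_right]
    · by_cases h : i = j
      · subst h; right; simp [torusDatum]
      · left; simp [h]
  | serre_E i j h =>
    obtain ⟨n, hn, ha⟩ := C.serreIndex_eq h
    rw [hn]
    refine TorusDatum.isSkewPrimitive_serreSum _ (qInt_qPow_ne_zero (hd i)) (r := qPow 𝕜 (P.R j i))
      ?_ ?_ ?_ ?_
    · rw [qPow_pow, ← qPow_add, ← qPow_add, add_assoc, add_comm (P.R j i), P.cartan, R_diag, ha,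
        ← qPow_zero]
      congr 1; ring
    all_goals
      simp [torusDatum, qChar_ofAdd, weight_root_left]
  | serre_F i j h =>
    obtain ⟨n, hn, ha⟩ := C.serreIndex_eq h
    rw [hn]
    refine TorusDatum.isSkewPrimitive_serreSumRev _ (qInt_qPow_ne_zero (hd i))
      (s := qPow 𝕜 (P.R j i)) ?_ ?_ ?_ ?_
    · rw [qPow_pow, ← qPow_add, ← qPow_add, add_assoc, P.cartan, R_diag, ha,
        ← qPow_zero]
      congr 1; ring
    all_goals
      simp [torusDatum, qChar_ofAdd, -neg_zero, -Prod.neg_mk, weight_root_right, qPow_ne_zero]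

/-- The multiparameter quantum group `U_{𝐪,M•}(𝔤_D)`, with both toral parts indexed by `M`. -/
def Double : Type _ := (P.torusDatum 𝕜 M).Alg ⧸ idealOf {u | P.Relator 𝕜 M u}

noncomputable instance : Ring (P.Double 𝕜 M) :=
  inferInstanceAs (Ring ((P.torusDatum 𝕜 M).Alg ⧸ idealOf {u | P.Relator 𝕜 M u}))

noncomputable instance : HopfAlgebra (QField 𝕜) (P.Double 𝕜 M) :=
  have : (idealOf {u | P.Relator 𝕜 M u}).IsHopfIdeal (QField 𝕜) :=
    isHopfIdeal_idealOf fun _ hu ↦ Relator.isSkewPrimitive hu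
  inferInstanceAs (HopfAlgebra (QField 𝕜)
    ((P.torusDatum 𝕜 M).Alg ⧸ idealOf {u | P.Relator 𝕜 M u}))

end Multiparameter
end QuantumGroups

section QuantumGroups2

variable (𝕜 : Type*) [Field 𝕜] {I : Type*} [Fintype I] [DecidableEq I] {C : CartanDatum I}

namespace Multiparameter

variable (P : Multiparameter C) (M : RootLattice I)

namespace Double

/-- The class of an element of the presenting algebra. -/
noncomputable def mk (x : (P.torusDatum 𝕜 M).Alg) : P.Double 𝕜 M :=
  Ideal.Quotient.mk (idealOf {u | P.Relator 𝕜 M u}) x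

noncomputable def E (i : I) : P.Double 𝕜 M := mk 𝕜 P M ((P.torusDatum 𝕜 M).X (.inl i))

noncomputable def F (i : I) : P.Double 𝕜 M := mk 𝕜 P M ((P.torusDatum 𝕜 M).X (.inr i))

noncomputable def K (μ : M.carrier) : P.Double 𝕜 M := mk 𝕜 P M ((P.torusDatum 𝕜 M).K (μ, 0))

noncomputable def L (μ : M.carrier) : P.Double 𝕜 M := mk 𝕜 P M ((P.torusDatum 𝕜 M).K (0, μ))

theorem isGroupLikeElem_mk {a : M.carrier × M.carrier} :
    IsGroupLikeElem (QField 𝕜) (mk 𝕜 P M ((P.torusDatum 𝕜 M).K a)) := by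
  have : (idealOf {u | P.Relator 𝕜 M u}).IsHopfIdeal (QField 𝕜) :=
    isHopfIdeal_idealOf fun _ hu ↦ Relator.isSkewPrimitive hu
  exact (TorusDatum.isGroupLikeElem_K _ a).map
    (Bialgebra.Quotient.mkBialgHom (idealOf {u | P.Relator 𝕜 M u}))

end Double
end Multiparameter

namespace ToralTwist

variable {M : RootLattice I} (T : ToralTwist C M)

/-- The functional `γ ↦ (γ, α_j)` on `M`. -/
noncomputable def weight (C : CartanDatum I) (M : RootLattice I) (j : I) : M.carrier →+ ℚ :=
  (C.form.flip (simpleRoot j)).toAddMonoidHom.comp M.carrier.subtype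

/-- The torus data of `U^Ψ_{q,M}(𝔤)`: `inl i` stands for `E_i`, `inr i` for `F_i`. Here
`Δ(E_i) = E_i ⊗ K_{ψ_-(α_i)} + K_{α_i + ψ_+(α_i)} ⊗ E_i` and
`Δ(F_i) = F_i ⊗ K_{-α_i - ψ_-(α_i)} + K_{-ψ_+(α_i)} ⊗ F_i`. -/
noncomputable def torusDatum : TorusDatum (QField 𝕜) M.carrier (I ⊕ I) where
  wt := Sum.elim (fun i ↦ qChar 𝕜 (weight C M i)) (fun i ↦ qChar 𝕜 (-weight C M i))
  left := Sum.elim (fun i ↦ M.root i + T.plus (M.root i)) (fun i ↦ -T.plus (M.root i))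
  right := Sum.elim (fun i ↦ T.minus (M.root i)) (fun i ↦ -(M.root i + T.minus (M.root i)))

/-- The remaining relations of `U_{q,M}(𝔤)`:
`E_i F_j - F_j E_i = δ_ij (K_{α_i} - K_{-α_i}) / (q_i - q_i⁻¹)` with `q_i = q ^ d_i` and, for
`i ≠ j`, `m = 1 - a_ij`, `∑ k, (-1) ^ k [m choose k]_{q_i} E_i ^ (m - k) E_j E_i ^ k = 0`, and
the same for the `F_i`. -/
inductive Relator : (T.torusDatum 𝕜).Alg → Prop
  | commutator (i j : I) : Relator
      ((T.torusDatum 𝕜).X (.inl i) * (T.torusDatum 𝕜).X (.inr j) -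
        (T.torusDatum 𝕜).X (.inr j) * (T.torusDatum 𝕜).X (.inl i) -
        (if i = j then (qPow 𝕜 (C.d i) - (qPow 𝕜 (C.d i))⁻¹)⁻¹ else 0) •
          ((T.torusDatum 𝕜).K (M.root i) - (T.torusDatum 𝕜).K (-M.root i)))
  | serre_E (i j : I) (h : i ≠ j) : Relator
      (serreSum (fun k ↦ (-1) ^ k * qBinomSym (qPow 𝕜 (C.d i)) (C.serreIndex i j) k)
        (C.serreIndex i j) ((T.torusDatum 𝕜).X (.inl i)) ((T.torusDatum 𝕜).X (.inl j)))
  | serre_F (i j : I) (h : i ≠ j) : Relator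
      (serreSum (fun k ↦ (-1) ^ k * qBinomSym (qPow 𝕜 (C.d i)) (C.serreIndex i j) k)
        (C.serreIndex i j) ((T.torusDatum 𝕜).X (.inr i)) ((T.torusDatum 𝕜).X (.inr j)))

theorem weight_root (i j : I) : weight C M j (M.root i) = C.d i * C.A i j :=
  C.form_root_root i j

theorem weight_plus (i j : I) :
    weight C M j (T.plus (M.root i)) = weight C M i (T.minus (M.root j)) :=
  C.form_psi_root T.Ψ i j

variable {𝕜 T} in
theorem Relator.isSkewPrimitive {u : (T.torusDatum 𝕜).Alg} (hu : T.Relator 𝕜 u) :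
    IsSkewPrimitive (QField 𝕜) u := by
  have hd : ∀ i, (C.d i : ℚ) * C.A i i ≠ 0 := by
    intro i
    have := C.d_pos i
    rw [C.diag]
    positivity
  have hA : ∀ i j, (C.d i : ℚ) * C.A i j = C.d j * C.A j i := by
    intro i j
    exact_mod_cast C.symm i j
  have hcoeff : ∀ (i j : I) (n : ℕ), (C.A i j : ℚ) = -n → ∀ X Y : (T.torusDatum 𝕜).Alg,
      serreSum (fun k ↦ (-1) ^ k * qBinomSym (qPow 𝕜 (C.d i)) (n + 1) k) (n + 1) X Y =
      serreSum (serreCoeff (qPow 𝕜 (C.d i * C.A i i)) (qPow 𝕜 (C.d i * C.A i j)) (n + 1)) (n + 1)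
        X Y := by
    intro i j n ha X Y
    refine Finset.sum_congr rfl fun k hk ↦ ?_
    have e : qPow 𝕜 (C.d i * C.A i i) = qPow 𝕜 (C.d i) ^ 2 := by
      rw [qPow_pow, C.diag]; congr 1; push_cast; ring
    rw [e, serreCoeff_sq (qPow_ne_zero _) _ _ (Nat.lt_succ_iff.1 (Finset.mem_range.1 hk))]
    · rw [← e]
      intro h
      exact hd i (qPow_eq_one h)
    · rw [qPow_pow, ← qPow_add, ha, ← qPow_zero]; congr 1; ring
  have hprod : ∀ (i j : I) (n : ℕ), (C.A i j : ℚ) = -n →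
      qPow 𝕜 (C.d i * C.A i i) ^ n * qPow 𝕜 (C.d i * C.A i j) * qPow 𝕜 (C.d i * C.A i j) = 1 := by
    intro i j n ha
    rw [qPow_pow, ← qPow_add, ← qPow_add, ha, C.diag, ← qPow_zero]
    congr 1; push_cast; ring
  cases hu with
  | commutator i j =>
    apply TorusDatum.isSkewPrimitive_commutator
    · simp only [torusDatum, Sum.elim_inl, Sum.elim_inr, qChar_ofAdd, map_neg, weight_plus,
        AddMonoidHom.neg_apply]
    · simp only [torusDatum, Sum.elim_inl, Sum.elim_inr, qChar_ofAdd, map_neg, map_add,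
        weight_plus, weight_root, AddMonoidHom.neg_apply, hA i j, neg_add]
    · by_cases h : i = j
      · subst h; right; simp [torusDatum]
      · left; simp [h]
  | serre_E i j h =>
    obtain ⟨n, hn, ha⟩ := C.serreIndex_eq h
    rw [hn, hcoeff i j n ha]
    refine TorusDatum.isSkewPrimitive_serreSum _ (qInt_qPow_ne_zero (hd i)) (hprod i j n ha)
      ?_ ?_ ?_
    all_goals
      simp only [torusDatum, Sum.elim_inl, qChar_ofAdd, map_add, map_neg, weight_plus,
        ← qPow_add, weight_root]
      congr 1
      linarith [hA i j]
  | serre_F i j h =>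
    obtain ⟨n, hn, ha⟩ := C.serreIndex_eq h
    rw [hn, hcoeff i j n ha]
    have h1 := TorusDatum.isSkewPrimitive_serreSumRev (T.torusDatum 𝕜)
      (i := .inr i) (j := .inr j) (qInt_qPow_ne_zero (hd i)) (hprod i j n ha) ?_ ?_ ?_
    · rw [serreSumRev_eq (hprod i j n ha)] at h1
      have h2 := h1.smul ((-1) ^ (n + 1) * qPow 𝕜 (C.d i * C.A i j) ^ (n + 1) *
        qPow 𝕜 (C.d i * C.A i i) ^ (n + 1).choose 2)⁻¹
      rwa [smul_smul, inv_mul_cancel₀ (by simp [qPow_ne_zero]), one_smul] at h2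
    all_goals
      simp only [torusDatum, Sum.elim_inr, qChar_ofAdd, map_add, map_neg, weight_plus,
        ← qPow_add, weight_root, AddMonoidHom.neg_apply]
      rw [← qPow_zero]
      congr 1
      linarith [hA i j]

/-- The twisted polynomial quantum group `U^Ψ_{q,M}(𝔤)`: the algebra `U_{q,M}(𝔤)` with the
coproduct twisted by `Ψ`. -/
def TwistedQuantumGroup : Type _ := (T.torusDatum 𝕜).Alg ⧸ idealOf {u | T.Relator 𝕜 u}

namespace TwistedQuantumGroup

noncomputable instance : Ring (T.TwistedQuantumGroup 𝕜) :=
  inferInstanceAs (Ring ((T.torusDatum 𝕜).Alg ⧸ idealOf {u | T.Relator 𝕜 u}))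

noncomputable instance : HopfAlgebra (QField 𝕜) (T.TwistedQuantumGroup 𝕜) :=
  have : (idealOf {u | T.Relator 𝕜 u}).IsHopfIdeal (QField 𝕜) :=
    isHopfIdeal_idealOf fun _ hu ↦ Relator.isSkewPrimitive hu
  inferInstanceAs (HopfAlgebra (QField 𝕜) ((T.torusDatum 𝕜).Alg ⧸ idealOf {u | T.Relator 𝕜 u}))

/-- The class of an element of the presenting algebra. -/
noncomputable def mk (x : (T.torusDatum 𝕜).Alg) : T.TwistedQuantumGroup 𝕜 :=
  Ideal.Quotient.mk (idealOf {u | T.Relator 𝕜 u}) x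

noncomputable def E (i : I) : T.TwistedQuantumGroup 𝕜 := mk 𝕜 T ((T.torusDatum 𝕜).X (.inl i))

noncomputable def F (i : I) : T.TwistedQuantumGroup 𝕜 := mk 𝕜 T ((T.torusDatum 𝕜).X (.inr i))

noncomputable def K (γ : M.carrier) : T.TwistedQuantumGroup 𝕜 := mk 𝕜 T ((T.torusDatum 𝕜).K γ)

end TwistedQuantumGroup
end ToralTwist

namespace Multiparameter

variable {M : RootLattice I} (P : Multiparameter C) (T : ToralTwist C M)

/-- Generators of the ideal `I_Ψ`: the elements `K_μ L_μ - K_{2 ψ_+(μ)} L_{2 ψ_-(μ)}`. Those with `μ`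
in a `ℤ`-basis of `M` generate the same ideal. -/
def psiRelators : Set (P.Double 𝕜 M) :=
  Set.range fun μ : M.carrier ↦ Double.K 𝕜 P M μ * Double.L 𝕜 P M μ -
    Double.K 𝕜 P M (2 • T.plus μ) * Double.L 𝕜 P M (2 • T.minus μ)

theorem isSkewPrimitive_of_mem_psiRelators {u : P.Double 𝕜 M} (hu : u ∈ P.psiRelators 𝕜 T) :
    IsSkewPrimitive (QField 𝕜) u := by
  obtain ⟨μ, rfl⟩ := hu
  exact .sub_of_isGroupLikeElem
    ((Double.isGroupLikeElem_mk 𝕜 P M).mul (Double.isGroupLikeElem_mk 𝕜 P M))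
    ((Double.isGroupLikeElem_mk 𝕜 P M).mul (Double.isGroupLikeElem_mk 𝕜 P M))

/-- The multiparameter quantum group `U_{𝐪,M•}(𝔤) = U_{𝐪,M•}(𝔤_D) / I_Ψ`. -/
def Single : Type _ := P.Double 𝕜 M ⧸ idealOf (P.psiRelators 𝕜 T)

namespace Single

noncomputable instance : Ring (P.Single 𝕜 T) :=
  inferInstanceAs (Ring (P.Double 𝕜 M ⧸ idealOf (P.psiRelators 𝕜 T)))

noncomputable instance : HopfAlgebra (QField 𝕜) (P.Single 𝕜 T) :=
  have : (idealOf (P.psiRelators 𝕜 T)).IsHopfIdeal (QField 𝕜) :=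
    isHopfIdeal_idealOf fun _ hu ↦ P.isSkewPrimitive_of_mem_psiRelators 𝕜 T hu
  inferInstanceAs (HopfAlgebra (QField 𝕜) (P.Double 𝕜 M ⧸ idealOf (P.psiRelators 𝕜 T)))

/-- The class of an element of `U_{𝐪,M•}(𝔤_D)`. -/
noncomputable def mk (x : P.Double 𝕜 M) : P.Single 𝕜 T :=
  Ideal.Quotient.mk (idealOf (P.psiRelators 𝕜 T)) x

end Single
end Multiparameter
end QuantumGroups2

section Cocycle

open WithConv Coalgebra

variable (F : Type*) [Field F] (H : Type*) [Ring H] [Bialgebra F H]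

/-- `(a ⊗ b) ⊗ c ↦ ε(c) a ⊗ b`. -/
noncomputable def proj12 : (H ⊗[F] H) ⊗[F] H →ₗc[F] H ⊗[F] H :=
  (Coalgebra.TensorProduct.rid F F (H ⊗[F] H)).toCoalgHom.comp
    (Coalgebra.TensorProduct.map (CoalgHom.id F (H ⊗[F] H)) (counitCoalgHom F H))

/-- `(a ⊗ b) ⊗ c ↦ ε(a) b ⊗ c`. -/
noncomputable def proj23 : (H ⊗[F] H) ⊗[F] H →ₗc[F] H ⊗[F] H :=
  Coalgebra.TensorProduct.map ((Coalgebra.TensorProduct.lid F H).toCoalgHom.comp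
    (Coalgebra.TensorProduct.map (counitCoalgHom F H) (CoalgHom.id F H))) (CoalgHom.id F H)

/-- `(a ⊗ b) ⊗ c ↦ a b ⊗ c`. -/
noncomputable def mul12 : (H ⊗[F] H) ⊗[F] H →ₗc[F] H ⊗[F] H :=
  Coalgebra.TensorProduct.map (Bialgebra.mulCoalgHom F H) (CoalgHom.id F H)

/-- `(a ⊗ b) ⊗ c ↦ a ⊗ b c`. -/
noncomputable def mul23 : (H ⊗[F] H) ⊗[F] H →ₗc[F] H ⊗[F] H :=
  (Coalgebra.TensorProduct.map (CoalgHom.id F H) (Bialgebra.mulCoalgHom F H)).comp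
    (Coalgebra.TensorProduct.assoc F F H H H).toCoalgHom

variable {F H}

/-- Precomposition of a functional with a coalgebra homomorphism. -/
def pull {C C' A : Type*} [AddCommGroup C] [Module F C] [Coalgebra F C] [AddCommGroup C']
    [Module F C'] [Coalgebra F C'] [Ring A] [Algebra F A]
    (f : WithConv (C' →ₗ[F] A)) (g : C →ₗc[F] C') : WithConv (C →ₗ[F] A) :=
  toConv (f.ofConv ∘ₗ g.toLinearMap)

section
variable {C C' C'' A B : Type*} [AddCommGroup C] [Module F C] [Coalgebra F C] [AddCommGroup C']
    [Module F C'] [Coalgebra F C'] [AddCommGroup C'']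
    [Module F C''] [Coalgebra F C''] [Ring A] [Algebra F A] [Ring B] [Algebra F B]

theorem pull_mul (f f' : WithConv (C' →ₗ[F] A)) (g : C →ₗc[F] C') :
    pull (f * f') g = pull f g * pull f' g :=
  ofConv_injective (LinearMap.convMul_comp_coalgHom_distrib f f' g)

theorem pull_one (g : C →ₗc[F] C') : pull (1 : WithConv (C' →ₗ[F] A)) g = 1 := by
  ext x
  simp [pull]

theorem pull_pull (f : WithConv (C'' →ₗ[F] A)) (g : C' →ₗc[F] C'') (h : C →ₗc[F] C') :
    pull (pull f g) h = pull f (g.comp h) := rfl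

variable (A) in
/-- A functional as a convolution element with scalar values in `A`. -/
noncomputable def scalar (f : WithConv (C →ₗ[F] F)) : WithConv (C →ₗ[F] A) :=
  toConv (Algebra.linearMap F A ∘ₗ f.ofConv)

theorem scalar_mul (f g : WithConv (C →ₗ[F] F)) : scalar A (f * g) = scalar A f * scalar A g :=
  ofConv_injective (LinearMap.algHom_comp_convMul_distrib (Algebra.ofId F A) f g)

theorem scalar_one : scalar A (1 : WithConv (C →ₗ[F] F)) = 1 := by
  ext x
  simp [scalar]

theorem pull_scalar (f : WithConv (C' →ₗ[F] F)) (g : C →ₗc[F] C') :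
    pull (scalar A f) g = scalar A (pull f g) := rfl

theorem push_scalar_mul (g : A →ₗ[F] B) (s : WithConv (C →ₗ[F] F)) (f : WithConv (C →ₗ[F] A)) :
    toConv (g ∘ₗ (scalar A s * f).ofConv) = scalar B s * toConv (g ∘ₗ f.ofConv) := by
  ext c
  have h1 := (ℛ F c).convMul_apply (scalar A s) f
  have h2 := (ℛ F c).convMul_apply (scalar B s) (toConv (g ∘ₗ f.ofConv))
  simp only [LinearMap.comp_apply]
  rw [h1, h2, map_sum]
  refine Finset.sum_congr rfl fun i _ ↦ ?_
  simp [scalar, ← Algebra.smul_def]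

theorem push_mul_scalar (g : A →ₗ[F] B) (s : WithConv (C →ₗ[F] F)) (f : WithConv (C →ₗ[F] A)) :
    toConv (g ∘ₗ (f * scalar A s).ofConv) = toConv (g ∘ₗ f.ofConv) * scalar B s := by
  ext c
  have h1 := (ℛ F c).convMul_apply f (scalar A s)
  have h2 := (ℛ F c).convMul_apply (toConv (g ∘ₗ f.ofConv)) (scalar B s)
  simp only [LinearMap.comp_apply]
  rw [h1, h2, map_sum]
  refine Finset.sum_congr rfl fun i _ ↦ ?_
  simp [scalar, ← Algebra.commutes, ← Algebra.smul_def]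

end

variable (F H) in
/-- A normalized, convolution-invertible Hopf 2-cocycle. -/
structure TwoCocycle where
  σ : WithConv (H ⊗[F] H →ₗ[F] F)
  σinv : WithConv (H ⊗[F] H →ₗ[F] F)
  mul_inv : σ * σinv = 1
  inv_mul : σinv * σ = 1
  one_left : ∀ a : H, σ (1 ⊗ₜ[F] a) = counit (R := F) a
  one_right : ∀ a : H, σ (a ⊗ₜ[F] 1) = counit (R := F) a
  /-- `σ(b₁, c₁) σ(a, b₂ c₂) = σ(a₁, b₁) σ(a₂ b₂, c)`. -/
  cocycle : pull σ (proj23 F H) * pull σ (mul23 F H) = pull σ (proj12 F H) * pull σ (mul12 F H)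

namespace TwoCocycle

variable (s : TwoCocycle F H)

/-- The deformed product `a ⊗ b ↦ σ(a₁, b₁) a₂ b₂ σ⁻¹(a₃, b₃)`. -/
noncomputable def mulMap : H ⊗[F] H →ₗ[F] H :=
  (scalar H s.σ * toConv (LinearMap.mul' F H) * scalar H s.σinv).ofConv

theorem map_mulMap_id : toConv (TensorProduct.map s.mulMap (LinearMap.id (R := F) (M := H))) =
    scalar (H ⊗[F] H) (pull s.σ (proj12 F H)) * toConv (mul12 F H).toLinearMap *
      scalar (H ⊗[F] H) (pull s.σinv (proj12 F H)) := by
  have e : ∀ f : WithConv (H ⊗[F] H →ₗ[F] F), scalar (H ⊗[F] H) (pull f (proj12 F H)) =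
      toConv (TensorProduct.map (scalar H f).ofConv (1 : WithConv (H →ₗ[F] H)).ofConv) := by
    intro f
    ext x y z
    simp [scalar, pull, proj12, LinearMap.convOne_def, Algebra.algebraMap_eq_smul_one,
      Algebra.TensorProduct.one_def, TensorProduct.smul_tmul', smul_smul]
    rw [← TensorProduct.smul_tmul' (counit z) x y, map_smul, smul_eq_mul]
  have e2 : toConv (mul12 F H).toLinearMap =
      toConv (TensorProduct.map (toConv (LinearMap.mul' F H)).ofConv
        (toConv (LinearMap.id (R := F) (M := H))).ofConv) := rfl
  rw [e, e, e2, TensorProduct.map_convMul_map, TensorProduct.map_convMul_map, one_mul, mul_one]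
  rfl

theorem map_id_mulMap : toConv (TensorProduct.map (LinearMap.id (R := F) (M := H)) s.mulMap ∘ₗ
    (TensorProduct.assoc F H H H).toLinearMap) =
    scalar (H ⊗[F] H) (pull s.σ (proj23 F H)) * toConv (mul23 F H).toLinearMap *
      scalar (H ⊗[F] H) (pull s.σinv (proj23 F H)) := by
  have e : ∀ f : WithConv (H ⊗[F] H →ₗ[F] F), scalar (H ⊗[F] H) (pull f (proj23 F H)) =
      pull (toConv (TensorProduct.map (1 : WithConv (H →ₗ[F] H)).ofConv (scalar H f).ofConv))
        (Coalgebra.TensorProduct.assoc F F H H H).toCoalgHom := by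
    intro f
    ext x y z
    simp [scalar, pull, proj23, LinearMap.convOne_def, Algebra.algebraMap_eq_smul_one,
      Algebra.TensorProduct.one_def, TensorProduct.smul_tmul', smul_smul]
    rw [← TensorProduct.smul_tmul' (counit x) y z, map_smul, smul_eq_mul, mul_comm]
  have e2 : toConv (mul23 F H).toLinearMap =
      pull (toConv (TensorProduct.map (toConv (LinearMap.id (R := F) (M := H))).ofConv
        (toConv (LinearMap.mul' F H)).ofConv))
        (Coalgebra.TensorProduct.assoc F F H H H).toCoalgHom := rfl
  rw [e, e, e2, ← pull_mul, ← pull_mul, TensorProduct.map_convMul_map,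
    TensorProduct.map_convMul_map, one_mul, mul_one]
  rfl

theorem pull_mulMap {C : Type*} [AddCommGroup C] [Module F C] [Coalgebra F C]
    (g : C →ₗc[F] H ⊗[F] H) : toConv (s.mulMap ∘ₗ g.toLinearMap) =
      scalar H (pull s.σ g) * toConv (LinearMap.mul' F H ∘ₗ g.toLinearMap) *
        scalar H (pull s.σinv g) := by
  change pull (toConv s.mulMap) g = _
  rw [mulMap, toConv_ofConv, pull_mul, pull_mul]
  rfl

theorem pull_inv_eq {C : Type*} [AddCommGroup C] [Module F C] [Coalgebra F C]
    (g g' h h' : C →ₗc[F] H ⊗[F] H) (e : pull s.σ g * pull s.σ g' = pull s.σ h * pull s.σ h') :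
    pull s.σinv g' * pull s.σinv g = pull s.σinv h' * pull s.σinv h := by
  have h1 : ∀ g : C →ₗc[F] H ⊗[F] H, pull s.σ g * pull s.σinv g = 1 := fun g ↦ by
    rw [← pull_mul, s.mul_inv, pull_one]
  have h2 : ∀ g : C →ₗc[F] H ⊗[F] H, pull s.σinv g * pull s.σ g = 1 := fun g ↦ by
    rw [← pull_mul, s.inv_mul, pull_one]
  refine left_inv_eq_right_inv (a := pull s.σ g * pull s.σ g') ?_ ?_
  · rw [mul_assoc, ← mul_assoc _ (pull s.σ g), h2, one_mul, h2]
  · rw [e, mul_assoc, ← mul_assoc _ (pull s.σinv h'), h1, one_mul, h1]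

theorem mulMap_assoc : s.mulMap ∘ₗ TensorProduct.map s.mulMap LinearMap.id =
    s.mulMap ∘ₗ TensorProduct.map LinearMap.id s.mulMap ∘ₗ
      (TensorProduct.assoc F H H H).toLinearMap := by
  apply toConv_injective
  have h1 := congr(toConv (s.mulMap ∘ₗ $(s.map_mulMap_id).ofConv))
  have h2 := congr(toConv (s.mulMap ∘ₗ $(s.map_id_mulMap).ofConv))
  rw [push_mul_scalar, push_scalar_mul, ofConv_toConv] at h1 h2
  refine h1.trans (Eq.trans ?_ h2.symm)
  rw [ofConv_toConv, ofConv_toConv, pull_mulMap, pull_mulMap]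
  have e : LinearMap.mul' F H ∘ₗ (mul12 F H).toLinearMap =
      LinearMap.mul' F H ∘ₗ (mul23 F H).toLinearMap := by
    ext x y z
    simp [mul12, mul23, mul_assoc]
  rw [e]
  simp only [← mul_assoc]
  rw [← scalar_mul, ← scalar_mul, s.cocycle]
  simp only [mul_assoc]
  rw [← scalar_mul, ← scalar_mul, s.pull_inv_eq _ _ _ _ s.cocycle]

theorem counit_mulMap (x : H ⊗[F] H) : counit (R := F) (s.mulMap x) = counit (R := F) x := by
  have h : toConv (counit (R := F) (A := H) ∘ₗ s.mulMap) = 1 := by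
    have h1 := push_mul_scalar (counit (R := F) (A := H)) s.σinv
      (scalar H s.σ * toConv (LinearMap.mul' F H))
    rw [push_scalar_mul] at h1
    refine h1.trans ?_
    have e : ∀ f : WithConv (H ⊗[F] H →ₗ[F] F), scalar F f = f := fun f ↦ rfl
    have e2 : toConv (counit (R := F) (A := H) ∘ₗ LinearMap.mul' F H) = 1 := by
      ext x y
      simp [LinearMap.convOne_def, mul_comm]
    rw [ofConv_toConv, e, e, e2, mul_one, s.mul_inv]
  exact congr(($h).ofConv x)

/-- `a ↦ 1 ⊗ a`. -/
noncomputable def inclRight (F H : Type*) [Field F] [Ring H] [Bialgebra F H] :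
    H →ₗc[F] H ⊗[F] H :=
  (Coalgebra.TensorProduct.map (Bialgebra.unitBialgHom F H).toCoalgHom (CoalgHom.id F H)).comp
    (Coalgebra.TensorProduct.lid F H).symm.toCoalgHom

/-- `a ↦ a ⊗ 1`. -/
noncomputable def inclLeft (F H : Type*) [Field F] [Ring H] [Bialgebra F H] :
    H →ₗc[F] H ⊗[F] H :=
  (Coalgebra.TensorProduct.map (CoalgHom.id F H) (Bialgebra.unitBialgHom F H).toCoalgHom).comp
    (Coalgebra.TensorProduct.rid F F H).symm.toCoalgHom

theorem inclRight_apply (a : H) : inclRight F H a = 1 ⊗ₜ a := by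
  have h : (Bialgebra.unitBialgHom F H).toCoalgHom 1 = (1 : H) :=
    map_one (Bialgebra.unitBialgHom F H)
  simp [inclRight, h]

theorem inclLeft_apply (a : H) : inclLeft F H a = a ⊗ₜ 1 := by
  have h : (Bialgebra.unitBialgHom F H).toCoalgHom 1 = (1 : H) :=
    map_one (Bialgebra.unitBialgHom F H)
  simp [inclLeft, h]

theorem mulMap_comp_eq_id (g : H →ₗc[F] H ⊗[F] H) (h1 : pull s.σ g = 1)
    (h2 : LinearMap.mul' F H ∘ₗ g.toLinearMap = LinearMap.id) (a : H) : s.mulMap (g a) = a := by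
  have h3 : pull s.σinv g = 1 := by
    have h4 : pull s.σinv g * pull s.σ g = 1 := by rw [← pull_mul, s.inv_mul, pull_one]
    rwa [h1, mul_one] at h4
  have h5 := s.pull_mulMap g
  rw [h1, h2, h3, scalar_one, one_mul, mul_one] at h5
  exact congr(($h5).ofConv a)

theorem one_mulMap (a : H) : s.mulMap (1 ⊗ₜ a) = a := by
  rw [← inclRight_apply]
  apply s.mulMap_comp_eq_id
  · ext x
    simpa [pull, inclRight_apply] using s.one_left x
  · ext x
    simp [inclRight_apply]

theorem mulMap_one (a : H) : s.mulMap (a ⊗ₜ 1) = a := by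
  rw [← inclLeft_apply]
  apply s.mulMap_comp_eq_id
  · ext x
    simpa [pull, inclLeft_apply] using s.one_right x
  · ext x
    simp [inclLeft_apply]

theorem comul_mulMap : comul ∘ₗ s.mulMap =
    TensorProduct.map s.mulMap s.mulMap ∘ₗ comul (R := F) (A := H ⊗[F] H) := by
  apply toConv_injective
  have hl := push_mul_scalar (comul (R := F) (A := H)) s.σinv
    (scalar H s.σ * toConv (LinearMap.mul' F H))
  rw [push_scalar_mul, ofConv_toConv] at hl
  refine hl.trans ?_
  let i₁ : H →ₐ[F] H ⊗[F] H := Algebra.TensorProduct.includeLeft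
  let i₂ : H →ₐ[F] H ⊗[F] H := Algebra.TensorProduct.includeRight
  have key : ∀ f g : H ⊗[F] H →ₗ[F] H,
      toConv (TensorProduct.map f g ∘ₗ comul (R := F) (A := H ⊗[F] H)) =
      toConv (i₁.toLinearMap ∘ₗ f) * toConv (i₂.toLinearMap ∘ₗ g) := by
    intro f g
    rw [LinearMap.convMul_def, ← LinearMap.comp_assoc]
    congr 2
    ext x y z w
    simp [i₁, i₂]
  rw [key]
  have h1 := push_mul_scalar i₁.toLinearMap s.σinv (scalar H s.σ * toConv (LinearMap.mul' F H))
  have h2 := push_mul_scalar i₂.toLinearMap s.σinv (scalar H s.σ * toConv (LinearMap.mul' F H))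
  rw [push_scalar_mul, ofConv_toConv] at h1 h2
  have h3 : toConv (comul (R := F) (A := H) ∘ₗ LinearMap.mul' F H) =
      toConv (i₁.toLinearMap ∘ₗ LinearMap.mul' F H) *
        toConv (i₂.toLinearMap ∘ₗ LinearMap.mul' F H) := by
    rw [← key]
    congr 1
    exact ((Bialgebra.mulCoalgHom F H).map_comp_comul).symm
  change _ = toConv (i₁.toLinearMap ∘ₗ s.mulMap) * toConv (i₂.toLinearMap ∘ₗ s.mulMap)
  rw [mulMap, h1, h2, h3]
  have h4 : scalar (H ⊗[F] H) s.σinv * scalar (H ⊗[F] H) s.σ = 1 := by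
    rw [← scalar_mul, s.inv_mul, scalar_one]
  simp only [mul_assoc]
  rw [← mul_assoc (scalar _ s.σinv) (scalar _ s.σ), h4, one_mul]

/-- The cocycle deformation `H_σ`. -/
def Deformed (_ : TwoCocycle F H) : Type _ := H

noncomputable instance : AddCommGroup s.Deformed := inferInstanceAs (AddCommGroup H)

noncomputable instance : Module F s.Deformed := inferInstanceAs (Module F H)

noncomputable instance : Coalgebra F s.Deformed := inferInstanceAs (Coalgebra F H)

/-- The identity `H → H_σ`. -/
def toDeformed : H ≃ₗ[F] s.Deformed := LinearEquiv.refl F H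

theorem comul_toDeformed (x : H) : comul (R := F) (s.toDeformed x) =
    TensorProduct.map s.toDeformed.toLinearMap s.toDeformed.toLinearMap (comul (R := F) x) := by
  have : TensorProduct.map s.toDeformed.toLinearMap s.toDeformed.toLinearMap =
      LinearMap.id (R := F) (M := H ⊗[F] H) := TensorProduct.map_id
  rw [this]
  rfl

noncomputable instance : Ring s.Deformed :=
  { (inferInstance : AddCommGroup s.Deformed) with
    mul := fun a b ↦ s.toDeformed (s.mulMap (s.toDeformed.symm a ⊗ₜ[F] s.toDeformed.symm b))
    one := s.toDeformed 1
    left_distrib := fun a b c ↦ by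
      change s.toDeformed (s.mulMap _) = s.toDeformed (s.mulMap _) + s.toDeformed (s.mulMap _)
      rw [map_add, TensorProduct.tmul_add, map_add, map_add]
    right_distrib := fun a b c ↦ by
      change s.toDeformed (s.mulMap _) = s.toDeformed (s.mulMap _) + s.toDeformed (s.mulMap _)
      rw [map_add, TensorProduct.add_tmul, map_add, map_add]
    zero_mul := fun a ↦ by
      change s.toDeformed (s.mulMap _) = 0
      rw [map_zero, TensorProduct.zero_tmul, map_zero, map_zero]
    mul_zero := fun a ↦ by
      change s.toDeformed (s.mulMap _) = 0
      rw [map_zero, TensorProduct.tmul_zero, map_zero, map_zero]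
    mul_assoc := fun a b c ↦ congr(s.toDeformed ($s.mulMap_assoc ((a ⊗ₜ[F] b) ⊗ₜ[F] c)))
    one_mul := fun a ↦ s.one_mulMap a
    mul_one := fun a ↦ s.mulMap_one a }

theorem toDeformed_mul_toDeformed (a b : H) :
    s.toDeformed a * s.toDeformed b = s.toDeformed (s.mulMap (a ⊗ₜ[F] b)) := rfl

noncomputable instance : Algebra F s.Deformed :=
  Algebra.ofModule
    (fun r x y ↦ by
      change s.toDeformed (s.mulMap _) = r • s.toDeformed (s.mulMap _)
      rw [map_smul, ← TensorProduct.smul_tmul', map_smul, map_smul])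
    (fun r x y ↦ by
      change s.toDeformed (s.mulMap _) = r • s.toDeformed (s.mulMap _)
      rw [map_smul, TensorProduct.tmul_smul, map_smul, map_smul])

theorem comul_mul_aux (a b : H) : comul (R := F) (s.toDeformed a * s.toDeformed b) =
    comul (R := F) (s.toDeformed a) * comul (R := F) (s.toDeformed b) := by
  have key : ∀ t u : H ⊗[F] H,
      TensorProduct.map s.toDeformed.toLinearMap s.toDeformed.toLinearMap
        (TensorProduct.map s.mulMap s.mulMap
          (TensorProduct.tensorTensorTensorComm F H H H H (t ⊗ₜ[F] u))) =
      TensorProduct.map s.toDeformed.toLinearMap s.toDeformed.toLinearMap t *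
        TensorProduct.map s.toDeformed.toLinearMap s.toDeformed.toLinearMap u := by
    intro t u
    induction t with
    | zero => simp
    | add x y hx hy => rw [TensorProduct.add_tmul, map_add, map_add, map_add, map_add, hx, hy, add_mul]
    | tmul x y =>
      induction u with
      | zero => simp
      | add z w hz hw =>
        rw [TensorProduct.tmul_add, map_add, map_add, map_add, map_add, hz, hw, mul_add]
      | tmul z w => simp [toDeformed_mul_toDeformed]
  rw [toDeformed_mul_toDeformed, comul_toDeformed, comul_toDeformed, comul_toDeformed, ← key]
  have h := congr($s.comul_mulMap (a ⊗ₜ[F] b))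
  simp only [LinearMap.comp_apply] at h
  rw [h]
  rfl

noncomputable instance : Bialgebra F s.Deformed :=
  Bialgebra.mk' F s.Deformed (Bialgebra.counit_one (R := F) (A := H))
    (fun {a b} ↦ by
      change counit (R := F) (A := H) (s.mulMap _) = _
      rw [counit_mulMap, TensorProduct.counit_tmul, smul_eq_mul, mul_comm]
      rfl)
    (Bialgebra.comul_one (R := F) (A := H))
    (fun {a b} ↦ s.comul_mul_aux (s.toDeformed.symm a) (s.toDeformed.symm b))

end TwoCocycle
end Cocycle

section ToralCocycle

open WithConv Coalgebra

variable {F : Type*} [Field F]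

section Pullback

variable {H H' : Type*} [Ring H] [Bialgebra F H] [Ring H'] [Bialgebra F H']

theorem pull_congr {C C₁ C₂ : Type*} [AddCommGroup C] [Module F C] [Coalgebra F C] [AddCommGroup C₁]
    [Module F C₁] [Coalgebra F C₁] [AddCommGroup C₂] [Module F C₂] [Coalgebra F C₂]
    {D : Type*} [AddCommGroup D] [Module F D] [Coalgebra F D] (f : WithConv (D →ₗ[F] F))
    {g₁ : C₁ →ₗc[F] D} {h₁ : C →ₗc[F] C₁} {g₂ : C₂ →ₗc[F] D} {h₂ : C →ₗc[F] C₂}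
    (e : g₁.toLinearMap ∘ₗ h₁.toLinearMap = g₂.toLinearMap ∘ₗ h₂.toLinearMap) :
    pull (pull f g₁) h₁ = pull (pull f g₂) h₂ := by
  unfold pull
  rw [ofConv_toConv, ofConv_toConv, LinearMap.comp_assoc, LinearMap.comp_assoc, e]

/-- The pull-back of a 2-cocycle along a bialgebra homomorphism. -/
noncomputable def TwoCocycle.comap (p : H →ₐc[F] H') (s : TwoCocycle F H') : TwoCocycle F H where
  σ := pull s.σ (Coalgebra.TensorProduct.map p.toCoalgHom p.toCoalgHom)
  σinv := pull s.σinv (Coalgebra.TensorProduct.map p.toCoalgHom p.toCoalgHom)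
  mul_inv := by rw [← pull_mul, s.mul_inv, pull_one]
  inv_mul := by rw [← pull_mul, s.inv_mul, pull_one]
  one_left a := by
    have h : p.toCoalgHom 1 = 1 := map_one p
    have h2 : counit (R := F) (p.toCoalgHom a) = counit (R := F) a :=
      CoalgHomClass.counit_comp_apply p a
    simpa [pull, h, h2] using s.one_left (p.toCoalgHom a)
  one_right a := by
    have h : p.toCoalgHom 1 = 1 := map_one p
    have h2 : counit (R := F) (p.toCoalgHom a) = counit (R := F) a :=
      CoalgHomClass.counit_comp_apply p a
    simpa [pull, h, h2] using s.one_right (p.toCoalgHom a)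
  cocycle := by
    have hm : ∀ a b : H, p.toCoalgHom (a * b) = p.toCoalgHom a * p.toCoalgHom b := map_mul p
    have h2 : ∀ a : H, counit (R := F) (p.toCoalgHom a) = counit (R := F) a :=
      CoalgHomClass.counit_comp_apply p
    let q := Coalgebra.TensorProduct.map p.toCoalgHom p.toCoalgHom
    let r := Coalgebra.TensorProduct.map q p.toCoalgHom
    have e1 : pull (pull s.σ q) (proj23 F H) = pull (pull s.σ (proj23 F H')) r :=
      pull_congr _ (by ext x y z; simp [q, r, proj23, h2])
    have e2 : pull (pull s.σ q) (mul23 F H) = pull (pull s.σ (mul23 F H')) r :=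
      pull_congr _ (by ext x y z; simp [q, r, mul23, hm])
    have e3 : pull (pull s.σ q) (proj12 F H) = pull (pull s.σ (proj12 F H')) r :=
      pull_congr _ (by ext x y z; simp [q, r, proj12, h2])
    have e4 : pull (pull s.σ q) (mul12 F H) = pull (pull s.σ (mul12 F H')) r :=
      pull_congr _ (by ext x y z; simp [q, r, mul12, hm])
    change pull (pull s.σ q) _ * pull (pull s.σ q) _ = pull (pull s.σ q) _ * pull (pull s.σ q) _
    rw [e1, e2, e3, e4, ← pull_mul, ← pull_mul, s.cocycle]

end Pullback

section Bicharacter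

variable {Λ : Type*} [AddCommGroup Λ]

/-- The functional on `F[Λ] ⊗ F[Λ]` with `μ ⊗ ν ↦ b(μ, ν)`. -/
noncomputable def bilinOfFun {Λ : Type*} (b : Λ → Λ → F) :
    AddMonoidAlgebra F Λ ⊗[F] AddMonoidAlgebra F Λ →ₗ[F] F :=
  TensorProduct.lift ((Finsupp.linearCombination F fun μ ↦
    (Finsupp.linearCombination F (b μ)) ∘ₗ (AddMonoidAlgebra.coeffLinearEquiv F).toLinearMap) ∘ₗ
      (AddMonoidAlgebra.coeffLinearEquiv F).toLinearMap)

theorem bilinOfFun_single {Λ : Type*} (b : Λ → Λ → F) (μ ν : Λ) :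
    bilinOfFun b (AddMonoidAlgebra.single μ 1 ⊗ₜ[F] AddMonoidAlgebra.single ν 1) = b μ ν := by
  simp [bilinOfFun]

/-- The 2-cocycle on the group algebra `F[Λ]` defined by a bicharacter `b`. -/
noncomputable def TwoCocycle.ofBicharacter (b : Λ → Λ → F) (hb : ∀ μ ν, b μ ν ≠ 0)
    (hl : ∀ μ μ' ν, b (μ + μ') ν = b μ ν * b μ' ν)
    (hr : ∀ μ ν ν', b μ (ν + ν') = b μ ν * b μ ν') :
    TwoCocycle F (AddMonoidAlgebra F Λ) where
  σ := toConv (bilinOfFun b)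
  σinv := toConv (bilinOfFun fun μ ν ↦ (b μ ν)⁻¹)
  mul_inv := by
    apply ofConv_injective
    ext μ ν
    simp [bilinOfFun_single, hb, LinearMap.convOne_def]
  inv_mul := by
    apply ofConv_injective
    ext μ ν
    simp [bilinOfFun_single, hb, LinearMap.convOne_def]
  one_left := by
    have h : ∀ ν, b 0 ν = 1 := fun ν ↦ by
      have := hl 0 0 ν
      rw [add_zero] at this
      exact (mul_eq_left₀ (hb 0 ν)).1 this.symm
    suffices h2 : bilinOfFun b ∘ₗ TensorProduct.mk F _ (AddMonoidAlgebra F Λ) 1 =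
        counit (R := F) (A := AddMonoidAlgebra F Λ) from fun a ↦ congr($h2 a)
    ext ν
    simp [AddMonoidAlgebra.one_def, bilinOfFun_single, h]
  one_right := by
    have h : ∀ μ, b μ 0 = 1 := fun μ ↦ by
      have := hr μ 0 0
      rw [add_zero] at this
      exact (mul_eq_left₀ (hb μ 0)).1 this.symm
    suffices h2 : bilinOfFun b ∘ₗ (TensorProduct.mk F (AddMonoidAlgebra F Λ) _).flip 1 =
        counit (R := F) (A := AddMonoidAlgebra F Λ) from fun a ↦ congr($h2 a)
    ext ν
    simp [AddMonoidAlgebra.one_def, bilinOfFun_single, h]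
  cocycle := by
    apply ofConv_injective
    ext μ ν κ
    simp [bilinOfFun_single, pull, proj12, proj23, mul12, mul23,
      AddMonoidAlgebra.single_mul_single, hl, hr]
    ring

end Bicharacter
end ToralCocycle

section Deformation

variable (𝕜 : Type*) [Field 𝕜] {I : Type*} [Fintype I] [DecidableEq I] {C : CartanDatum I}

namespace Multiparameter

/-- The canonical multiparameter, `q_ij = q ^ (d_i a_ij)`. -/
def canonical (C : CartanDatum I) : Multiparameter C where
  R := C.symmetrized
  cartan i j := by
    have h : (C.d i : ℚ) * C.A i j = C.d j * C.A j i := by exact_mod_cast C.symm i j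
    rw [CartanDatum.symmetrized, Matrix.of_apply, Matrix.of_apply, ← h]
    ring

variable (P : Multiparameter C) (M : RootLattice I)

theorem toral_respects : (P.torusDatum 𝕜 M).Respects
    (fun x ↦ (AddMonoidAlgebra.single (x.1 + x.2) 1 : AddMonoidAlgebra (QField 𝕜) M.carrier))
    (fun _ ↦ 0) where
  K_zero := by simp [AddMonoidAlgebra.one_def]
  K_add x y := by
    rw [AddMonoidAlgebra.single_mul_single, mul_one, Prod.fst_add, Prod.snd_add, add_add_add_comm]
  K_mul_X := by simp

theorem toral_relator {u : (P.torusDatum 𝕜 M).Alg} (hu : P.Relator 𝕜 M u) :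
    TorusDatum.lift (P.toral_respects 𝕜 M) u = 0 := by
  cases hu with
  | commutator i j =>
    rw [map_sub, map_sub, map_mul, map_mul, map_smul, map_sub, TorusDatum.lift_X,
      TorusDatum.lift_X, TorusDatum.lift_K, TorusDatum.lift_K, add_zero, zero_add, sub_self]
    simp
  | serre_E i j h =>
    rw [TorusDatum.map_serreSum, TorusDatum.lift_X, TorusDatum.lift_X]
    simp [serreSum]
  | serre_F i j h =>
    rw [TorusDatum.map_serreSumRev, TorusDatum.lift_X, TorusDatum.lift_X]
    simp [serreSumRev]

/-- The Hopf algebra projection of `U_{𝐪,M•}(𝔤_D)` onto the group algebra of `M`, with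
`K_μ, L_μ ↦ μ` and `E_i, F_i ↦ 0`. -/
noncomputable def toralHom :
    P.Double 𝕜 M →ₐc[QField 𝕜] AddMonoidAlgebra (QField 𝕜) M.carrier :=
  have : (idealOf {u | P.Relator 𝕜 M u}).IsHopfIdeal (QField 𝕜) :=
    isHopfIdeal_idealOf fun _ hu ↦ Relator.isSkewPrimitive hu
  let f : ((P.torusDatum 𝕜 M).Alg ⧸ idealOf {u | P.Relator 𝕜 M u}) →ₐ[QField 𝕜]
      AddMonoidAlgebra (QField 𝕜) M.carrier :=
    Ideal.Quotient.liftₐ _ (TorusDatum.lift (P.toral_respects 𝕜 M)) fun _ hx ↦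
      idealOf_le (RingHomClass.toRingHom (TorusDatum.lift (P.toral_respects 𝕜 M)))
        (fun _ hu ↦ P.toral_relator 𝕜 M hu) hx
  have hf : ∀ x, f (Ideal.Quotient.mk _ x) = TorusDatum.lift (P.toral_respects 𝕜 M) x :=
    fun _ ↦ rfl
  BialgHom.ofAlgHom (A := (P.torusDatum 𝕜 M).Alg ⧸ idealOf {u | P.Relator 𝕜 M u}) f
    (by
      refine Ideal.Quotient.algHom_ext _ (TorusDatum.algHom_ext _ ?_)
      rintro (a | j)
      · simp [hf, TorusDatum.lift_K, TorusDatum.counit_K]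
      · simp [hf, TorusDatum.lift_X, TorusDatum.counit_X])
    (by
      refine Ideal.Quotient.algHom_ext _ (TorusDatum.algHom_ext _ ?_)
      rintro (a | j)
      · simp [hf, TorusDatum.lift_K, TorusDatum.comul_K]
      · simp [hf, TorusDatum.lift_X, TorusDatum.comul_X])

end Multiparameter

namespace ToralTwist

variable {M : RootLattice I} (T : ToralTwist C M)

/-- The bicharacter `(μ, ν) ↦ q ^ (-(μ + ψ_-(μ), ν))` of `M`. -/
noncomputable def bicharacter (μ ν : M.carrier) : QField 𝕜 :=
  qPow 𝕜 (-C.form (μ + T.minus μ : M.carrier) (ν : I → ℚ))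

/-- The toral 2-cocycle `σ` of `U_{q̌,M•}(𝔤_D)`: the pull-back of the bicharacter along the
projection onto the group algebra of `M`. Thus `σ(K_μ, K_ν) = q ^ (-(μ + ψ_-(μ), ν))`, the same
with `L`'s in place of `K`'s, and `σ` vanishes if some `E_i` or `F_i` occurs. -/
noncomputable def cocycle :
    TwoCocycle (QField 𝕜) ((Multiparameter.canonical C).Double 𝕜 M) :=
  (TwoCocycle.ofBicharacter (T.bicharacter 𝕜) (fun _ _ ↦ qPow_ne_zero _)
    (fun μ μ' ν ↦ by
      rw [bicharacter, bicharacter, bicharacter, ← qPow_add]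
      congr 1
      simp only [map_add, AddSubgroup.coe_add, LinearMap.add_apply]
      ring)
    (fun μ ν ν' ↦ by
      rw [bicharacter, bicharacter, bicharacter, ← qPow_add]
      congr 1
      simp only [map_add, AddSubgroup.coe_add]
      ring)).comap ((Multiparameter.canonical C).toralHom 𝕜 M)

/-- The class of `x` in `(U_{q̌,M•}(𝔤_D))_σ`. -/
noncomputable def toDeformedDouble (x : (Multiparameter.canonical C).Double 𝕜 M) :
    (T.cocycle 𝕜).Deformed := (T.cocycle 𝕜).toDeformed x

/-- Generators of the ideal `I_Ψ`, inside `(U_{q̌,M•}(𝔤_D))_σ`. -/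
def deformedRelators : Set (T.cocycle 𝕜).Deformed :=
  Set.range fun μ : M.carrier ↦
    T.toDeformedDouble 𝕜 (.K 𝕜 _ M μ) * T.toDeformedDouble 𝕜 (.L 𝕜 _ M μ) -
      T.toDeformedDouble 𝕜 (.K 𝕜 _ M (2 • T.plus μ)) *
        T.toDeformedDouble 𝕜 (.L 𝕜 _ M (2 • T.minus μ))

theorem isGroupLikeElem_toDeformed {F H : Type*} [Field F] [Ring H] [Bialgebra F H]
    (s : TwoCocycle F H) {x : H} (hx : IsGroupLikeElem F x) :
    IsGroupLikeElem F (s.toDeformed x) :=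
  ⟨hx.counit_eq_one, by
    rw [s.comul_toDeformed, hx.comul_eq_tmul_self]
    rfl⟩

theorem isSkewPrimitive_of_mem_deformedRelators {u : (T.cocycle 𝕜).Deformed}
    (hu : u ∈ T.deformedRelators 𝕜) : IsSkewPrimitive (QField 𝕜) u := by
  obtain ⟨μ, rfl⟩ := hu
  exact .sub_of_isGroupLikeElem
    ((isGroupLikeElem_toDeformed _ (Multiparameter.Double.isGroupLikeElem_mk 𝕜 _ M)).mul
      (isGroupLikeElem_toDeformed _ (Multiparameter.Double.isGroupLikeElem_mk 𝕜 _ M)))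
    ((isGroupLikeElem_toDeformed _ (Multiparameter.Double.isGroupLikeElem_mk 𝕜 _ M)).mul
      (isGroupLikeElem_toDeformed _ (Multiparameter.Double.isGroupLikeElem_mk 𝕜 _ M)))

/-- The deformed quantum group `(U_{q,M•}(𝔤))_σ`: the quotient of the cocycle deformation
`(U_{q̌,M•}(𝔤_D))_σ` by its two-sided ideal generated by the elements
`K_μ L_μ - K_{2 ψ_+(μ)} L_{2 ψ_-(μ)}`. -/
def DeformedSingle : Type _ := (T.cocycle 𝕜).Deformed ⧸ idealOf (T.deformedRelators 𝕜)

namespace DeformedSingle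

noncomputable instance : Ring (T.DeformedSingle 𝕜) :=
  inferInstanceAs (Ring ((T.cocycle 𝕜).Deformed ⧸ idealOf (T.deformedRelators 𝕜)))

noncomputable instance : Bialgebra (QField 𝕜) (T.DeformedSingle 𝕜) :=
  have : ((idealOf (T.deformedRelators 𝕜)).restrictScalars (QField 𝕜)).IsCoideal :=
    isCoideal_idealOf fun _ hu ↦ T.isSkewPrimitive_of_mem_deformedRelators 𝕜 hu
  inferInstanceAs (Bialgebra (QField 𝕜)
    ((T.cocycle 𝕜).Deformed ⧸ idealOf (T.deformedRelators 𝕜)))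

/-- The class of an element of `U_{q̌,M•}(𝔤_D)`. -/
noncomputable def mk (x : (Multiparameter.canonical C).Double 𝕜 M) : T.DeformedSingle 𝕜 :=
  Ideal.Quotient.mk (idealOf (T.deformedRelators 𝕜)) (T.toDeformedDouble 𝕜 x)

end DeformedSingle
end ToralTwist
end Deformation

end QuantumDouble

/-!
# The multiparameter and the twisted quantum group are isomorphic

Since `Ψ` is antisymmetric, `ψ_- = -ψ_+`, and all algebras in question differ only by how a torus
is attached to the elements `E_i`, `F_i`.

*The first isomorphism.* Call `(k, e, f)` a triple shifted by an endomorphism `η` of `M` if it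
satisfies the relations of `U_{q,M}(𝔤)`, except that the commutator of `e_i` and `f_i` involves
`k_{±α_i + 2 η(α_i)}` and the Serre relations have the parameters `q ^ (d_i a_ij + 2 (η(α_i),
α_j))` (`IsShiftedTriple`). If `θ` is antisymmetric on the roots, replacing `e_i`, `f_i` by
`k_{θ(α_i)} e_i`, `k_{θ(α_i)} f_i` turns a shift by `η` into a shift by `η + θ`
(`IsShiftedTriple.shift`). Now `U^Ψ_{q,M}(𝔤)` is, as an algebra, universal for triples with shift
`0`, and `U_{𝐪,M•}(𝔤)` is universal for triples with shift `ψ_+`: modulo `I_Ψ` the torus `M × M`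
of the double becomes `M` by way of `(μ, ν) ↦ μ + 2 ψ_+(μ) + 2 ψ_+(ν) - ν`
(`Multiparameter.Single.presentation_K`). The shifts by `ψ_+` and by `-ψ_+` therefore give
mutually inverse homomorphisms. Compatibility with the coproducts is a check on generators, and
with the antipodes it is automatic (`map_antipode_of_bialgHom`).

*The second isomorphism.* The cocycle comes from a bicharacter `q ^ β` of the group algebra of
`M`, so the deformed product of two elements that are homogeneous for both coactions of the group
algebra is a power of `q` times their product (`mulMap_tmul`). Hence the generators satisfy, for
the deformed product, the relations of the multiparameter obtained from `q̌` by adding `β(α_i,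
α_j) - β(α_j, α_i)` to the exponents, which is `𝐪` (`deformed_relator`,
`ToralTwist.isDeformation`). This gives a homomorphism from `U_{𝐪,M•}(𝔤_D)` to the deformation of
`U_{q̌,M•}(𝔤_D)`. Deforming back by `q ^ (-β)` gives its inverse, because the two scalars cancel
on products of homogeneous elements (`deformHom_deformHom`). The isomorphism matches the
generators of the two ideals `I_Ψ`, so it descends to `U_{𝐪,M•}(𝔤) ≅ (U_{q,M•}(𝔤))_σ`, and the
second claim follows from the first.
-/

namespace QuantumDouble

/-! ### Homomorphisms of bialgebras -/

section Bialgebra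

variable {F : Type*} [Field F] {A B : Type*} [Ring A] [Ring B]

open WithConv in
/-- Both `f ∘ S` and `S ∘ f` are convolution inverses of `f`. -/
theorem map_antipode_of_bialgHom [HopfAlgebra F A] [HopfAlgebra F B] (f : A →ₐc[F] B) (x : A) :
    f (HopfAlgebra.antipode F x) = HopfAlgebra.antipode F (f x) := by
  let φ : WithConv (A →ₗ[F] B) := toConv (f.toCoalgHom.toLinearMap)
  have h1 : toConv (f.toCoalgHom.toLinearMap ∘ₗ HopfAlgebra.antipode F) * φ = 1 := by
    apply ofConv_injective
    have h := LinearMap.algHom_comp_convMul_distrib (AlgHomClass.toAlgHom f)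
      (toConv (HopfAlgebra.antipode F)) (toConv (LinearMap.id (R := F) (M := A)))
    rw [LinearMap.antipode_mul_id, LinearMap.algHom_comp_convOne] at h
    exact h.symm
  have h2 : φ * toConv (HopfAlgebra.antipode F ∘ₗ f.toCoalgHom.toLinearMap) = 1 := by
    apply ofConv_injective
    have h := LinearMap.convMul_comp_coalgHom_distrib (toConv (LinearMap.id (R := F) (M := B)))
      (toConv (HopfAlgebra.antipode F)) f.toCoalgHom
    rw [LinearMap.id_mul_antipode, LinearMap.convOne_comp_coalgHom] at h
    exact h.symm
  exact congr(($(left_inv_eq_right_inv h1 h2)).ofConv x)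

/-- The map induced on the quotient by the two-sided ideal generated by `S`. -/
noncomputable def idealOfLift [Algebra F A] [Algebra F B] {S : Set A} (f : A →ₐ[F] B)
    (h : ∀ u ∈ S, f u = 0) : (A ⧸ idealOf S) →ₐ[F] B :=
  Ideal.Quotient.liftₐ _ f fun _ hx ↦ idealOf_le (RingHomClass.toRingHom f) h hx

theorem mk_idealOf_eq_zero {S : Set A} {u : A} (hu : u ∈ S) :
    Ideal.Quotient.mk (idealOf S) u = 0 :=
  Ideal.Quotient.eq_zero_iff_mem.2 (TwoSidedIdeal.mem_asIdeal.2 (TwoSidedIdeal.subset_span hu))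

namespace TorusDatum

variable {L : Type*} [AddCommGroup L] {J : Type*} (D : TorusDatum F L J)

variable {D} in
/-- An algebra homomorphism out of a quotient `π` of `D.Alg` is a homomorphism of bialgebras as
soon as the images of the generators have the right coproducts. -/
noncomputable def bialgHomOfGen [Bialgebra F A] [Bialgebra F B] (π : D.Alg →ₐc[F] A)
    (hπ : Function.Surjective π) (f : A →ₐ[F] B)
    (hK : ∀ a, IsGroupLikeElem F (f (π (D.K a))))
    (hX : ∀ j, Coalgebra.comul (R := F) (f (π (D.X j))) =
      f (π (D.X j)) ⊗ₜ[F] f (π (D.K (D.right j))) + f (π (D.K (D.left j))) ⊗ₜ[F] f (π (D.X j))) :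
    A →ₐc[F] B :=
  BialgHom.ofAlgHom f
    (by
      have h : ((Bialgebra.counitAlgHom F B).comp f).comp (π : D.Alg →ₐ[F] A) =
          (Bialgebra.counitAlgHom F A).comp (π : D.Alg →ₐ[F] A) := by
        apply algHom_ext
        rintro (a | j)
        · simpa [D.counit_K] using (hK a).counit_eq_one
        · simpa [D.counit_X] using
            IsSkewPrimitive.counit_eq_zero (F := F) ⟨_, _, hK _, hK _, hX j⟩
      ext x
      obtain ⟨y, rfl⟩ := hπ x
      exact congr($h y))
    (by
      have h : ((Algebra.TensorProduct.map f f).comp (Bialgebra.comulAlgHom F A)).comp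
            (π : D.Alg →ₐ[F] A) =
          ((Bialgebra.comulAlgHom F B).comp f).comp (π : D.Alg →ₐ[F] A) := by
        apply algHom_ext
        rintro (a | j)
        · have h1 := CoalgHomClass.map_comp_comul_apply π (D.K a)
          rw [D.comul_K] at h1
          simp [← h1, (hK a).comul_eq_tmul_self]
        · have h1 := CoalgHomClass.map_comp_comul_apply π (D.X j)
          rw [D.comul_X] at h1
          simp [← h1, hX]
      ext x
      obtain ⟨y, rfl⟩ := hπ x
      exact congr($h y))

end TorusDatum

end Bialgebra

/-! ### Serre sums of elements multiplied by toral factors -/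

section Shift

variable {F : Type*} [Field F] {A : Type*} [Ring A] [Algebra F A]

theorem mul_pow_of_smul {x h : A} {t : F} (hx : x * h = t • (h * x)) (n : ℕ) :
    x * h ^ n = t ^ n • (h ^ n * x) := by
  induction n with
  | zero => simp
  | succ n ih =>
    rw [pow_succ, ← mul_assoc, ih, smul_mul_assoc, mul_assoc, hx, mul_smul_comm, smul_smul,
      ← pow_succ, mul_assoc]

theorem pow_mul_of_smul {x h : A} {t : F} (hx : x * h = t • (h * x)) (n : ℕ) :
    x ^ n * h = t ^ n • (h * x ^ n) := by
  induction n with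
  | zero => simp
  | succ n ih =>
    rw [pow_succ, mul_assoc, hx, mul_smul_comm, ← mul_assoc, ih, smul_mul_assoc, smul_smul,
      mul_comm t, ← pow_succ, mul_assoc]

/-- Normal ordering of a monomial: `g` commutes with `x`, so only the passages of `h` through the left
powers of `x`, and of the right powers of `g` through `y`, contribute scalars. -/
theorem shift_pow_mul_mul_pow {g h x y : A} {s t : F} (hgh : Commute g h) (hxg : Commute x g)
    (hxh : x * h = t • (h * x)) (hyg : y * g = s • (g * y)) (a b : ℕ) :
    (g * x) ^ a * (h * y) * (g * x) ^ b =
      (t ^ a * s ^ b) • (g ^ (a + b) * h * (x ^ a * y * x ^ b)) := by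
  rw [hxg.symm.mul_pow, hxg.symm.mul_pow]
  calc g ^ a * x ^ a * (h * y) * (g ^ b * x ^ b)
      = g ^ a * ((x ^ a * h) * (y * g ^ b)) * x ^ b := by simp only [mul_assoc]
    _ = (t ^ a * s ^ b) • (g ^ a * (h * (x ^ a * g ^ b) * y) * x ^ b) := by
        rw [pow_mul_of_smul hxh, mul_pow_of_smul hyg]
        simp only [smul_mul_assoc, mul_smul_comm, smul_smul, mul_assoc, mul_comm (t ^ a)]
    _ = _ := by
        rw [(hxg.pow_pow a b).eq, pow_add]
        simp only [mul_assoc]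
        rw [← mul_assoc h (g ^ b), ← (hgh.pow_left b).eq]
        simp only [mul_assoc]

theorem serreSum_shift {g h x y : A} {s t w : F} (hgh : Commute g h) (hxg : Commute x g)
    (hxh : x * h = t • (h * x)) (hyg : y * g = s • (g * y)) {c c' : ℕ → F} {m : ℕ}
    (hc : ∀ k ≤ m, c' k * (t ^ (m - k) * s ^ k) = w * c k) :
    serreSum c' m (g * x) (h * y) = w • (g ^ m * h * serreSum c m x y) := by
  rw [serreSum, serreSum, Finset.mul_sum, Finset.smul_sum]
  refine Finset.sum_congr rfl fun k hk ↦ ?_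
  have hk := Nat.lt_succ_iff.1 (Finset.mem_range.1 hk)
  rw [shift_pow_mul_mul_pow hgh hxg hxh hyg, smul_smul, hc k hk, Nat.sub_add_cancel hk,
    mul_smul_comm, smul_smul]

theorem serreSumRev_shift {g h x y : A} {s t w : F} (hgh : Commute g h) (hxg : Commute x g)
    (hxh : x * h = t • (h * x)) (hyg : y * g = s • (g * y)) {c c' : ℕ → F} {m : ℕ}
    (hc : ∀ k ≤ m, c' k * (t ^ k * s ^ (m - k)) = w * c k) :
    serreSumRev c' m (g * x) (h * y) = w • (g ^ m * h * serreSumRev c m x y) := by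
  rw [serreSumRev, serreSumRev, Finset.mul_sum, Finset.smul_sum]
  refine Finset.sum_congr rfl fun k hk ↦ ?_
  have hk := Nat.lt_succ_iff.1 (Finset.mem_range.1 hk)
  rw [shift_pow_mul_mul_pow hgh hxg hxh hyg, smul_smul, hc k hk, Nat.add_sub_cancel' hk,
    mul_smul_comm, smul_smul]

theorem serreSum_smul (c : ℕ → F) (m : ℕ) (u v : F) (x y : A) :
    serreSum c m (u • x) (v • y) = (u ^ m * v) • serreSum c m x y := by
  rw [serreSum, serreSum, Finset.smul_sum]
  refine Finset.sum_congr rfl fun k hk ↦ ?_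
  have hk := Nat.lt_succ_iff.1 (Finset.mem_range.1 hk)
  rw [smul_pow, smul_pow, smul_mul_smul_comm, smul_mul_smul_comm, smul_smul, smul_smul,
    mul_right_comm, ← pow_add, Nat.sub_add_cancel hk, mul_comm]

theorem map_serreSum_of_bialgHom {B C : Type*} [Ring B] [Bialgebra F B] [Ring C] [Bialgebra F C]
    (f : B →ₐc[F] C) (c : ℕ → F) (m : ℕ) (x y : B) :
    f (serreSum c m x y) = serreSum c m (f x) (f y) := by
  simp [serreSum]

theorem map_serreSumRev_of_bialgHom {B C : Type*} [Ring B] [Bialgebra F B] [Ring C]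
    [Bialgebra F C] (f : B →ₐc[F] C) (c : ℕ → F) (m : ℕ) (x y : B) :
    f (serreSumRev c m x y) = serreSumRev c m (f x) (f y) := by
  simp [serreSumRev]

/-- Rescaling the parameter `s` of the Serre coefficients multiplies the `k`-th one by `t ^ k`, which is
how the scalars from reordering monomials are absorbed. -/
theorem serreCoeff_mul (p s t : F) (m k : ℕ) :
    serreCoeff p (s * t) m k = serreCoeff p s m k * t ^ k := by
  rw [serreCoeff, serreCoeff, mul_pow, ← mul_assoc]

end Shift

/-! ### Shifted triples -/

section Triples

variable {𝕜 : Type*} [Field 𝕜] {I : Type*} [Fintype I] [DecidableEq I]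

/-- Elements `k_μ`, `e_i`, `f_i` of an algebra that satisfy the relations of `U_{q,M}(𝔤)` up to a
shift of the toral part by the endomorphism `η` of `M`: the commutator of `e_i` and `f_i` is
`c_i (k_{α_i + 2 η(α_i)} - k_{-α_i + 2 η(α_i)})`, and the Serre relations are those of the
multiparameter `q ^ (d_i a_ij + 2 (η(α_i), α_j))`. -/
structure IsShiftedTriple (C : CartanDatum I) (M : RootLattice I) (η : M.carrier →+ M.carrier)
    (c : I → QField 𝕜) {A : Type*} [Ring A] [Algebra (QField 𝕜) A]
    (k : M.carrier → A) (e f : I → A) : Prop where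
  k_zero : k 0 = 1
  k_add : ∀ μ ν, k (μ + ν) = k μ * k ν
  k_mul_e : ∀ μ j, k μ * e j = qPow 𝕜 (ToralTwist.weight C M j μ) • (e j * k μ)
  k_mul_f : ∀ μ j, k μ * f j = qPow 𝕜 (-ToralTwist.weight C M j μ) • (f j * k μ)
  commutator : ∀ i j, e i * f j - f j * e i = (if i = j then c i else 0) •
    (k (M.root i + 2 • η (M.root i)) - k (-M.root i + 2 • η (M.root i)))
  serre_e : ∀ i j, i ≠ j → serreSum (serreCoeff (qPow 𝕜 (2 * C.d i))
    (qPow 𝕜 (C.d i * C.A i j + 2 * ToralTwist.weight C M j (η (M.root i)))) (C.serreIndex i j))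
      (C.serreIndex i j) (e i) (e j) = 0
  serre_f : ∀ i j, i ≠ j → serreSumRev (serreCoeff (qPow 𝕜 (2 * C.d i))
    (qPow 𝕜 (C.d i * C.A i j + 2 * ToralTwist.weight C M j (η (M.root i)))) (C.serreIndex i j))
      (C.serreIndex i j) (f i) (f j) = 0

namespace IsShiftedTriple

variable {C : CartanDatum I} {M : RootLattice I} {η : M.carrier →+ M.carrier} {c : I → QField 𝕜}
  {A : Type*} [Ring A] [Algebra (QField 𝕜) A] {k : M.carrier → A} {e f : I → A}

theorem commute_k (h : IsShiftedTriple C M η c k e f) (μ ν : M.carrier) : Commute (k μ) (k ν) := by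
  rw [Commute, SemiconjBy, ← h.k_add, ← h.k_add, add_comm]

theorem e_mul_k (h : IsShiftedTriple C M η c k e f) (μ : M.carrier) (j : I) :
    e j * k μ = qPow 𝕜 (-ToralTwist.weight C M j μ) • (k μ * e j) := by
  rw [h.k_mul_e, smul_smul, ← qPow_add, neg_add_cancel, qPow_zero, one_smul]

theorem f_mul_k (h : IsShiftedTriple C M η c k e f) (μ : M.carrier) (j : I) :
    f j * k μ = qPow 𝕜 (ToralTwist.weight C M j μ) • (k μ * f j) := by
  rw [h.k_mul_f, smul_smul, ← qPow_add, add_neg_cancel, qPow_zero, one_smul]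

/-- Multiplying `e_i` and `f_i` by `k_{θ(α_i)}`, with `θ` antisymmetric on the roots, adds `θ` to
the shift: the two toral factors commute past `e_i` and `f_j` with the same scalar, and in a Serre
sum the powers of this scalar change only the parameter `q_ij`. -/
theorem shift (h : IsShiftedTriple C M η c k e f) (θ : M.carrier →+ M.carrier)
    (hθ : ∀ i j, ToralTwist.weight C M j (θ (M.root i)) = -ToralTwist.weight C M i (θ (M.root j)))
    (u : I → QField 𝕜) :
    IsShiftedTriple C M (η + θ) (fun i ↦ u i * c i) k (fun i ↦ u i • (k (θ (M.root i)) * e i))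
      (fun i ↦ k (θ (M.root i)) * f i) := by
  -- Antisymmetry on the diagonal: `k_{θ(α_i)}` commutes with `e_i` and `f_i`.
  have hself : ∀ i, ToralTwist.weight C M i (θ (M.root i)) = 0 := fun i ↦ by linarith [hθ i i]
  have hw : ∀ i j, qPow 𝕜 (C.d i * C.A i j +
      2 * ToralTwist.weight C M j ((η + θ) (M.root i))) =
      qPow 𝕜 (C.d i * C.A i j + 2 * ToralTwist.weight C M j (η (M.root i))) *
        qPow 𝕜 (2 * ToralTwist.weight C M j (θ (M.root i))) := by
    intro i j
    rw [← qPow_add, AddMonoidHom.add_apply, map_add]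
    congr 1
    ring
  refine ⟨h.k_zero, h.k_add, fun μ j ↦ ?_, fun μ j ↦ ?_, fun i j ↦ ?_, fun i j hij ↦ ?_,
    fun i j hij ↦ ?_⟩
  · rw [mul_smul_comm, ← mul_assoc, (h.commute_k _ _).eq, mul_assoc, h.k_mul_e]
    simp only [mul_smul_comm, smul_mul_assoc, smul_smul, mul_assoc]
    rw [mul_comm]
  · rw [← mul_assoc, (h.commute_k _ _).eq, mul_assoc, h.k_mul_f]
    simp only [mul_smul_comm, mul_assoc]
  · have h1 : k (θ (M.root i)) * e i * (k (θ (M.root j)) * f j) =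
        qPow 𝕜 (ToralTwist.weight C M j (θ (M.root i))) •
          (k (θ (M.root i)) * k (θ (M.root j)) * (e i * f j)) := by
      rw [mul_assoc, ← mul_assoc (e i), h.e_mul_k, hθ i j]
      simp only [smul_mul_assoc, mul_smul_comm, mul_assoc]
    have h2 : k (θ (M.root j)) * f j * (k (θ (M.root i)) * e i) =
        qPow 𝕜 (ToralTwist.weight C M j (θ (M.root i))) •
          (k (θ (M.root i)) * k (θ (M.root j)) * (f j * e i)) := by
      rw [mul_assoc, ← mul_assoc (f j), h.f_mul_k, (h.commute_k (θ (M.root i)) _).eq]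
      simp only [smul_mul_assoc, mul_smul_comm, mul_assoc]
    rw [smul_mul_assoc, mul_smul_comm, ← smul_sub, h1, h2, ← smul_sub, ← mul_sub, h.commutator]
    by_cases hij : i = j
    · subst hij
      rw [if_pos rfl, if_pos rfl, hself, qPow_zero, one_smul, mul_smul_comm, smul_smul, mul_sub,
        ← h.k_add, ← h.k_add, ← h.k_add]
      simp only [AddMonoidHom.add_apply, two_nsmul]
      congr 3 <;> abel
    · simp [hij]
  -- Reordering contributes `t ^ (m - k) s ^ k` with `s = t⁻¹`, that is, `t ^ m` times the factor
  -- `t ^ (-2 k)`, and the latter is cancelled by the change of `q_ij`.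
  · rw [serreSum_smul, serreSum_shift (h.commute_k _ _) (t := qPow 𝕜
        (-ToralTwist.weight C M i (θ (M.root j)))) (s := qPow 𝕜
        (-ToralTwist.weight C M j (θ (M.root i)))) _ (h.e_mul_k _ _) (h.e_mul_k _ _)
        (w := qPow 𝕜 (ToralTwist.weight C M j (θ (M.root i))) ^ C.serreIndex i j),
        h.serre_e i j hij, mul_zero, smul_zero, smul_zero]
    · intro n hn
      obtain ⟨l, hl⟩ := Nat.exists_eq_add_of_le hn
      rw [hw i j, serreCoeff_mul, ← hθ, hl, Nat.add_sub_cancel_left, mul_right_comm, mul_assoc,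
        mul_comm]
      congr 1
      rw [qPow_pow, qPow_pow, qPow_pow, qPow_pow, ← qPow_add, ← qPow_add]
      congr 1
      push_cast
      ring
    · rw [Commute, SemiconjBy, h.e_mul_k, hself, neg_zero, qPow_zero, one_smul]
  · rw [serreSumRev_shift (h.commute_k _ _) (t := qPow 𝕜
        (ToralTwist.weight C M i (θ (M.root j)))) (s := qPow 𝕜
        (ToralTwist.weight C M j (θ (M.root i)))) _ (h.f_mul_k _ _) (h.f_mul_k _ _)
        (w := qPow 𝕜 (ToralTwist.weight C M j (θ (M.root i))) ^ C.serreIndex i j),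
        h.serre_f i j hij, mul_zero, smul_zero]
    · intro n hn
      obtain ⟨l, hl⟩ := Nat.exists_eq_add_of_le hn
      rw [hw i j, serreCoeff_mul, hθ j i, hl, Nat.add_sub_cancel_left, mul_right_comm, mul_assoc,
        mul_comm]
      congr 1
      rw [qPow_pow, qPow_pow, qPow_pow, qPow_pow, ← qPow_add, ← qPow_add]
      congr 1
      push_cast
      ring
    · rw [Commute, SemiconjBy, h.f_mul_k, hself, qPow_zero, one_smul]

end IsShiftedTriple

end Triples

/-! ### Weights of the multiparameter of `Ψ` -/

section Presentations

variable {𝕜 : Type*} [Field 𝕜] {I : Type*} [Fintype I] [DecidableEq I] {C : CartanDatum I}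

namespace ToralTwist

variable {M : RootLattice I} (T : ToralTwist C M)

theorem minus_apply (μ : M.carrier) : T.minus μ = -T.plus μ :=
  Subtype.ext (C.psiMinus_eq_neg T.antisymm μ)

theorem weight_plus_root_antisymm (i j : I) :
    weight C M j (T.plus (M.root i)) = -weight C M i (T.plus (M.root j)) := by
  rw [weight_plus, minus_apply, map_neg]

/-- `(ψ_+(μ), α_j) = ∑ k, μ_k (Aᵀ Ψ A)_{jk}`. -/
theorem weight_plus_apply (μ : M.carrier) (j : I) :
    weight C M j (T.plus μ) =
      ∑ k, (μ : I → ℚ) k * (C.cartan.transpose * T.Ψ * C.cartan) j k := by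
  have hd : ∀ k, (C.d k : ℚ) ≠ 0 := fun k ↦ by exact_mod_cast (C.d_pos k).ne'
  change C.form (C.psiPlus T.Ψ μ) (simpleRoot j) = _
  rw [C.form_root]
  simp only [CartanDatum.psiPlus, Matrix.toLin'_apply, Matrix.mulVec, dotProduct, Matrix.of_apply,
    Matrix.mul_apply, Finset.sum_mul, Finset.mul_sum, Matrix.transpose_apply]
  rw [Finset.sum_comm]
  refine Finset.sum_congr rfl fun k _ ↦ ?_
  rw [Finset.sum_comm]
  refine Finset.sum_congr rfl fun l _ ↦ Finset.sum_congr rfl fun i _ ↦ ?_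
  have := hd i
  simp only [CartanDatum.cartan, Matrix.map_apply]
  field_simp

theorem transpose_mul_mul_antisymm (i j : I) :
    (C.cartan.transpose * T.Ψ * C.cartan) i j = -(C.cartan.transpose * T.Ψ * C.cartan) j i := by
  have h : (C.cartan.transpose * T.Ψ * C.cartan).transpose =
      -(C.cartan.transpose * T.Ψ * C.cartan) := by
    simp [Matrix.transpose_mul, T.antisymm, Matrix.mul_assoc]
  exact congr($h j i)

end ToralTwist

/-- `(μ, α_j) = ∑ k, μ_k d_k a_kj`. -/
theorem weight_apply {M : RootLattice I} (μ : M.carrier) (j : I) :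
    ToralTwist.weight C M j μ = ∑ k, (μ : I → ℚ) k * C.symmetrized k j :=
  C.form_root μ j

theorem symmetrized_comm {I : Type*} (C : CartanDatum I) (i j : I) : C.symmetrized i j = C.symmetrized j i := by
  simp only [CartanDatum.symmetrized, Matrix.of_apply]
  exact_mod_cast C.symm i j

namespace Multiparameter

variable {M : RootLattice I} (P : Multiparameter C) (T : ToralTwist C M)

/-- The projection `M × M → M` that induces the toral part of `U_{𝐪,M•}(𝔤) → U^Ψ_{q,M}(𝔤)`. -/
noncomputable def toralProj : M.carrier × M.carrier →+ M.carrier :=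
  (AddMonoidHom.id _ + 2 • T.plus).coprod (2 • T.plus - AddMonoidHom.id _)

theorem toralProj_apply (x : M.carrier × M.carrier) :
    toralProj T x = x.1 + 2 • T.plus x.1 + (2 • T.plus x.2 - x.2) := rfl

variable {P T} in
/-- In `U_{𝐪,M•}(𝔤_D)` the element `K_μ L_ν` acts on `E_j` by the weight of the image of `(μ, ν)` in `M`;
this is where the relation between `𝐪` and `Ψ` enters. -/
theorem weight_eq (hP : P.R = C.symmetrized + C.cartan.transpose * (T.Ψ.transpose - T.Ψ) * C.cartan)
    (j : I) (x : M.carrier × M.carrier) :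
    P.weight M j x = ToralTwist.weight C M j (toralProj T x) := by
  have hR : ∀ i j, P.R i j = C.symmetrized i j + 2 * (C.cartan.transpose * T.Ψ * C.cartan) j i := by
    intro i j
    have h1 : T.Ψ.transpose - T.Ψ = (-2 : ℚ) • T.Ψ := by
      rw [T.antisymm, neg_smul, two_smul]; abel
    rw [hP, h1, Matrix.mul_smul, Matrix.smul_mul, Matrix.add_apply, Matrix.smul_apply,
      T.transpose_mul_mul_antisymm, smul_eq_mul]
    ring
  rw [toralProj_apply]
  simp only [map_add, map_sub, map_nsmul, T.weight_plus_apply, weight_apply, nsmul_eq_mul]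
  change ∑ k, (x.1 : I → ℚ) k * P.R k j - ∑ k, P.R j k * (x.2 : I → ℚ) k = _
  simp only [hR, Finset.mul_sum, ← Finset.sum_add_distrib, ← Finset.sum_sub_distrib]
  refine Finset.sum_congr rfl fun k _ ↦ ?_
  rw [T.transpose_mul_mul_antisymm k j, symmetrized_comm C j k]
  push_cast
  ring

variable {P T} in
theorem R_eq (hP : P.R = C.symmetrized + C.cartan.transpose * (T.Ψ.transpose - T.Ψ) * C.cartan)
    (i j : I) :
    P.R i j = C.d i * C.A i j + 2 * ToralTwist.weight C M j (T.plus (M.root i)) := by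
  rw [← P.weight_root_left M, weight_eq hP, toralProj_apply]
  simp [ToralTwist.weight_root]

end Multiparameter

end Presentations

/-! ### Universal properties of the quantum groups -/

section UniversalProperties

variable {𝕜 : Type*} [Field 𝕜] {I : Type*} [Fintype I] [DecidableEq I] {C : CartanDatum I}
  {A : Type*} [Ring A] [Algebra (QField 𝕜) A]

namespace Multiparameter

namespace Double

variable (𝕜) (P : Multiparameter C) (M : RootLattice I)

/-- The projection onto `U_{𝐪,M•}(𝔤_D)`. -/
noncomputable def mkHom : (P.torusDatum 𝕜 M).Alg →ₐc[QField 𝕜] P.Double 𝕜 M :=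
  have : (idealOf {u | P.Relator 𝕜 M u}).IsHopfIdeal (QField 𝕜) :=
    isHopfIdeal_idealOf fun _ hu ↦ Relator.isSkewPrimitive hu
  Bialgebra.Quotient.mkBialgHom (idealOf {u | P.Relator 𝕜 M u})

theorem mkHom_apply (x : (P.torusDatum 𝕜 M).Alg) : mkHom 𝕜 P M x = mk 𝕜 P M x := rfl

theorem mkHom_surjective : Function.Surjective (mkHom 𝕜 P M) := Ideal.Quotient.mk_surjective

variable {𝕜 P M} in
/-- The universal property of `U_{𝐪,M•}(𝔤_D)`. -/
noncomputable def lift (f : (P.torusDatum 𝕜 M).Alg →ₐ[QField 𝕜] A)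
    (h : ∀ u, P.Relator 𝕜 M u → f u = 0) : P.Double 𝕜 M →ₐ[QField 𝕜] A :=
  idealOfLift (A := (P.torusDatum 𝕜 M).Alg) f h

theorem lift_mk (f : (P.torusDatum 𝕜 M).Alg →ₐ[QField 𝕜] A) (h) (x : (P.torusDatum 𝕜 M).Alg) :
    lift f h (mk 𝕜 P M x) = f x := rfl

theorem mk_relator {u : (P.torusDatum 𝕜 M).Alg} (hu : P.Relator 𝕜 M u) : mkHom 𝕜 P M u = 0 :=
  mk_idealOf_eq_zero hu

end Double

namespace Single

variable (𝕜) {M : RootLattice I} (P : Multiparameter C) (T : ToralTwist C M)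

/-- The projection onto `U_{𝐪,M•}(𝔤)`. -/
noncomputable def mkHom : P.Double 𝕜 M →ₐc[QField 𝕜] P.Single 𝕜 T :=
  have : (idealOf (P.psiRelators 𝕜 T)).IsHopfIdeal (QField 𝕜) :=
    isHopfIdeal_idealOf fun _ hu ↦ P.isSkewPrimitive_of_mem_psiRelators 𝕜 T hu
  Bialgebra.Quotient.mkBialgHom (idealOf (P.psiRelators 𝕜 T))

theorem mkHom_apply (x : P.Double 𝕜 M) : mkHom 𝕜 P T x = mk 𝕜 P T x := rfl

theorem mkHom_surjective : Function.Surjective (mkHom 𝕜 P T) := Ideal.Quotient.mk_surjective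

variable {𝕜 P T} in
/-- The universal property of the quotient by `I_Ψ`. -/
noncomputable def lift (f : P.Double 𝕜 M →ₐ[QField 𝕜] A)
    (h : ∀ u ∈ P.psiRelators 𝕜 T, f u = 0) : P.Single 𝕜 T →ₐ[QField 𝕜] A :=
  idealOfLift (A := P.Double 𝕜 M) f h

theorem lift_mk (f : P.Double 𝕜 M →ₐ[QField 𝕜] A) (h) (x : P.Double 𝕜 M) :
    lift (T := T) f h (mk 𝕜 P T x) = f x := rfl

/-- The projection from the presenting algebra onto `U_{𝐪,M•}(𝔤)`. -/
noncomputable def presentation : (P.torusDatum 𝕜 M).Alg →ₐc[QField 𝕜] P.Single 𝕜 T :=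
  (mkHom 𝕜 P T).comp (Double.mkHom 𝕜 P M)

theorem presentation_surjective : Function.Surjective (presentation 𝕜 P T) :=
  (mkHom_surjective 𝕜 P T).comp (Double.mkHom_surjective 𝕜 P M)

/-- The relation `K_κ L_κ = K_{2 ψ_+(κ)} L_{2 ψ_-(κ)}`, as the triviality of one toral element. -/
theorem presentation_K_relation (κ : M.carrier) :
    presentation 𝕜 P T ((P.torusDatum 𝕜 M).K (κ - 2 • T.plus κ, κ + 2 • T.plus κ)) = 1 := by
  have h : mkHom 𝕜 P T (Double.K 𝕜 P M κ * Double.L 𝕜 P M κ -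
      Double.K 𝕜 P M (2 • T.plus κ) * Double.L 𝕜 P M (2 • T.minus κ)) = 0 :=
    mk_idealOf_eq_zero (A := P.Double 𝕜 M) ⟨κ, rfl⟩
  have hKL : ∀ a b, Double.K 𝕜 P M a * Double.L 𝕜 P M b =
      Double.mkHom 𝕜 P M ((P.torusDatum 𝕜 M).K (a, b)) := by
    intro a b
    change Double.mkHom 𝕜 P M _ * Double.mkHom 𝕜 P M _ = _
    rw [← map_mul, ← TorusDatum.K_add, Prod.mk_add_mk, add_zero, zero_add]
  rw [map_sub, sub_eq_zero, hKL, hKL] at h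
  have e : ((κ - 2 • T.plus κ, κ + 2 • T.plus κ) : M.carrier × M.carrier) =
      (κ, κ) + -(2 • T.plus κ, 2 • T.minus κ) := by
    rw [T.minus_apply, smul_neg, Prod.neg_mk, Prod.mk_add_mk, neg_neg, sub_eq_add_neg]
  rw [e, TorusDatum.K_add, map_mul]
  have h : presentation 𝕜 P T ((P.torusDatum 𝕜 M).K (κ, κ)) =
    presentation 𝕜 P T ((P.torusDatum 𝕜 M).K (2 • T.plus κ, 2 • T.minus κ)) := h
  rw [h]
  rw [← map_mul, TorusDatum.K_mul_neg, map_one]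

/-- Modulo `I_Ψ` the toral part is indexed by `M`, by way of `toralProj`, with section
`μ ↦ (μ - ψ_+(μ), ψ_+(μ))`: a pair and the section of its image differ by an element
`(κ - 2 ψ_+(κ), κ + 2 ψ_+(κ))`. -/
theorem presentation_K (x : M.carrier × M.carrier) :
    presentation 𝕜 P T ((P.torusDatum 𝕜 M).K (toralProj T x - T.plus (toralProj T x),
      T.plus (toralProj T x))) = presentation 𝕜 P T ((P.torusDatum 𝕜 M).K x) := by
  obtain ⟨a, b⟩ := x
  -- The two pairs differ by the relation for `κ = b - ψ_+(a + b)`.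
  have e : ((a, b) : M.carrier × M.carrier) = (toralProj T (a, b) - T.plus (toralProj T (a, b)),
      T.plus (toralProj T (a, b))) + ((b - T.plus (a + b)) - 2 • T.plus (b - T.plus (a + b)),
        (b - T.plus (a + b)) + 2 • T.plus (b - T.plus (a + b))) := by
    rw [toralProj_apply, Prod.mk_add_mk]
    simp only [map_add, map_sub, map_nsmul]
    ext1 <;> dsimp only <;> abel
  conv_rhs => rw [e, TorusDatum.K_add, map_mul, presentation_K_relation, mul_one]

variable {T} in
theorem toralProj_section (μ : M.carrier) : toralProj T (μ - T.plus μ, T.plus μ) = μ := by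
  rw [toralProj_apply]
  simp only [map_sub]
  abel

variable {P T} in
/-- The generators of `U_{𝐪,M•}(𝔤)` satisfy the relations of `U_{q,M}(𝔤)` shifted by `ψ_+`. -/
theorem isShiftedTriple
    (hP : P.R = C.symmetrized + C.cartan.transpose * (T.Ψ.transpose - T.Ψ) * C.cartan) :
    IsShiftedTriple C M T.plus (fun i ↦ qPow 𝕜 (2 * C.d i) / (qPow 𝕜 (2 * C.d i) - 1))
      (fun μ ↦ presentation 𝕜 P T ((P.torusDatum 𝕜 M).K (μ - T.plus μ, T.plus μ)))
      (fun i ↦ presentation 𝕜 P T ((P.torusDatum 𝕜 M).X (.inl i)))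
      (fun i ↦ presentation 𝕜 P T ((P.torusDatum 𝕜 M).X (.inr i))) := by
  have hrel : ∀ u, P.Relator 𝕜 M u → presentation 𝕜 P T u = 0 := fun u hu ↦ by
    change mkHom 𝕜 P T (Double.mkHom 𝕜 P M u) = 0
    rw [Double.mk_relator 𝕜 P M hu, map_zero]
  refine ⟨?_, fun μ ν ↦ ?_, fun μ j ↦ ?_, fun μ j ↦ ?_, fun i j ↦ ?_, fun i j hij ↦ ?_,
    fun i j hij ↦ ?_⟩
  · rw [map_zero, sub_zero, ← Prod.zero_eq_mk, TorusDatum.K_zero, map_one]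
  · rw [← map_mul, ← TorusDatum.K_add, Prod.mk_add_mk, map_add, add_sub_add_comm]
  · rw [← map_mul, TorusDatum.K_mul_X, map_smul, map_mul]
    congr 1
    change qPow 𝕜 (P.weight M j _) = _
    rw [weight_eq hP, toAdd_ofAdd, toralProj_section]
  · rw [← map_mul, TorusDatum.K_mul_X, map_smul, map_mul]
    congr 1
    change qPow 𝕜 (-P.weight M j _) = _
    rw [weight_eq hP, toAdd_ofAdd, toralProj_section]
  · have h := hrel _ (.commutator i j)
    rw [map_sub, map_sub, map_mul, map_mul, sub_eq_zero, map_smul, map_sub, P.R_diag] at h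
    rw [h, ← presentation_K, ← presentation_K 𝕜 P T (0, _), toralProj_apply, toralProj_apply]
    simp only [map_zero, nsmul_zero, add_zero, zero_add, sub_zero]
    rw [← sub_eq_neg_add]
  · have h := hrel _ (.serre_E i j hij)
    rwa [P.R_diag, R_eq hP, map_serreSum_of_bialgHom] at h
  · have h := hrel _ (.serre_F i j hij)
    rwa [P.R_diag, R_eq hP, map_serreSumRev_of_bialgHom] at h

end Single
end Multiparameter


namespace Multiparameter

variable {M : RootLattice I} {T : ToralTwist C M} {P : Multiparameter C}

namespace Single

variable {k : M.carrier → A} {e f : I → A}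

theorem respects
    (hP : P.R = C.symmetrized + C.cartan.transpose * (T.Ψ.transpose - T.Ψ) * C.cartan)
    {c : I → QField 𝕜} (h : IsShiftedTriple C M T.plus c k e f) :
    (P.torusDatum 𝕜 M).Respects (fun x ↦ k (Multiparameter.toralProj T x)) (Sum.elim e f) where
  K_zero := by rw [map_zero, h.k_zero]
  K_add x y := by rw [map_add, h.k_add]
  K_mul_X := by
    rintro x (j | j)
    · refine (h.k_mul_e _ j).trans ?_
      rw [← Multiparameter.weight_eq hP]
      rfl
    · refine (h.k_mul_f _ j).trans ?_
      rw [← Multiparameter.weight_eq hP]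
      rfl

theorem lift_relator
    (hP : P.R = C.symmetrized + C.cartan.transpose * (T.Ψ.transpose - T.Ψ) * C.cartan)
    (h : IsShiftedTriple C M T.plus (fun i ↦ qPow 𝕜 (2 * C.d i) / (qPow 𝕜 (2 * C.d i) - 1)) k e f)
    {u : (P.torusDatum 𝕜 M).Alg} (hu : P.Relator 𝕜 M u) :
    TorusDatum.lift (respects hP h) u = 0 := by
  cases hu with
  | commutator i j =>
    rw [map_sub, map_sub, map_mul, map_mul, map_smul, map_sub, sub_eq_zero, P.R_diag]
    simp only [TorusDatum.lift_X, TorusDatum.lift_K, Sum.elim_inl, Sum.elim_inr, toralProj_apply,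
      map_zero, nsmul_zero, add_zero, zero_add, sub_zero]
    rw [h.commutator, neg_add_eq_sub]
  | serre_E i j hij =>
    rw [TorusDatum.map_serreSum, TorusDatum.lift_X, TorusDatum.lift_X, P.R_diag, R_eq hP]
    exact h.serre_e i j hij
  | serre_F i j hij =>
    rw [TorusDatum.map_serreSumRev, TorusDatum.lift_X, TorusDatum.lift_X, P.R_diag, R_eq hP]
    exact h.serre_f i j hij

/-- The universal property of `U_{𝐪,M•}(𝔤)` for triples shifted by `ψ_+`. -/
noncomputable def liftTriple
    (hP : P.R = C.symmetrized + C.cartan.transpose * (T.Ψ.transpose - T.Ψ) * C.cartan)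
    (h : IsShiftedTriple C M T.plus (fun i ↦ qPow 𝕜 (2 * C.d i) / (qPow 𝕜 (2 * C.d i) - 1)) k e f) :
    P.Single 𝕜 T →ₐ[QField 𝕜] A :=
  lift (Double.lift (TorusDatum.lift (respects hP h)) fun _ hu ↦ lift_relator hP h hu) (by
    rintro _ ⟨μ, rfl⟩
    rw [map_sub, map_mul, map_mul, sub_eq_zero]
    simp only [Double.K, Double.L, Double.lift_mk, TorusDatum.lift_K, ← h.k_add, toralProj_apply,
      T.minus_apply, map_zero, map_nsmul, map_neg]
    congr 1
    abel)

theorem liftTriple_presentation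
    (hP : P.R = C.symmetrized + C.cartan.transpose * (T.Ψ.transpose - T.Ψ) * C.cartan)
    (h : IsShiftedTriple C M T.plus (fun i ↦ qPow 𝕜 (2 * C.d i) / (qPow 𝕜 (2 * C.d i) - 1)) k e f)
    (x : (P.torusDatum 𝕜 M).Alg) :
    liftTriple hP h (presentation 𝕜 P T x) = TorusDatum.lift (respects hP h) x := rfl

end Single
end Multiparameter

/-- The symmetric form of the Serre relations. -/
theorem serreSum_qBinomSym {I : Type*} {C : CartanDatum I} {i j : I} (hij : i ≠ j) (x y : A) :
    serreSum (fun k ↦ (-1) ^ k * qBinomSym (qPow 𝕜 (C.d i)) (C.serreIndex i j) k)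
      (C.serreIndex i j) x y =
    serreSum (serreCoeff (qPow 𝕜 (2 * C.d i)) (qPow 𝕜 (C.d i * C.A i j)) (C.serreIndex i j))
      (C.serreIndex i j) x y := by
  obtain ⟨n, hn, ha⟩ := C.serreIndex_eq hij
  have hd : (2 * C.d i : ℚ) ≠ 0 := by
    have := C.d_pos i
    positivity
  have e : qPow 𝕜 (2 * C.d i) = qPow 𝕜 (C.d i) ^ 2 := by
    rw [qPow_pow]; congr 1
  rw [hn]
  refine Finset.sum_congr rfl fun k hk ↦ ?_
  rw [e, serreCoeff_sq (qPow_ne_zero _) _ _ (Nat.lt_succ_iff.1 (Finset.mem_range.1 hk))]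
  · rw [← e]
    exact fun h ↦ hd (qPow_eq_one h)
  · rw [qPow_pow, ← qPow_add, ha, ← qPow_zero]; congr 1; ring

/-- With symmetric coefficients the order of the factors in a Serre sum does not matter. -/
theorem serreSumRev_eq_zero_iff {I : Type*} {C : CartanDatum I} {i j : I} (hij : i ≠ j) (x y : A) :
    serreSumRev (serreCoeff (qPow 𝕜 (2 * C.d i)) (qPow 𝕜 (C.d i * C.A i j)) (C.serreIndex i j))
      (C.serreIndex i j) x y = 0 ↔
    serreSum (serreCoeff (qPow 𝕜 (2 * C.d i)) (qPow 𝕜 (C.d i * C.A i j)) (C.serreIndex i j))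
      (C.serreIndex i j) x y = 0 := by
  obtain ⟨n, hn, ha⟩ := C.serreIndex_eq hij
  rw [hn, serreSumRev_eq (s := qPow 𝕜 (C.d i * C.A i j)), smul_eq_zero_iff_right]
  · simp [qPow_ne_zero]
  · rw [qPow_pow, ← qPow_add, ← qPow_add, ha, ← qPow_zero]
    congr 1; ring

namespace ToralTwist.TwistedQuantumGroup

variable {M : RootLattice I} (T : ToralTwist C M)

variable (𝕜) in
/-- The projection onto `U^Ψ_{q,M}(𝔤)`. -/
noncomputable def mkHom : (T.torusDatum 𝕜).Alg →ₐc[QField 𝕜] T.TwistedQuantumGroup 𝕜 :=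
  have : (idealOf {u | T.Relator 𝕜 u}).IsHopfIdeal (QField 𝕜) :=
    isHopfIdeal_idealOf fun _ hu ↦ Relator.isSkewPrimitive hu
  Bialgebra.Quotient.mkBialgHom (idealOf {u | T.Relator 𝕜 u})

variable (𝕜) in
theorem mkHom_surjective : Function.Surjective (mkHom 𝕜 T) := Ideal.Quotient.mk_surjective

variable (𝕜) in
/-- The generators of `U_{q,M}(𝔤)` form an unshifted triple. -/
theorem isShiftedTriple :
    IsShiftedTriple C M 0 (fun i ↦ (qPow 𝕜 (C.d i) - (qPow 𝕜 (C.d i))⁻¹)⁻¹)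
      (K 𝕜 T) (E 𝕜 T) (F 𝕜 T) := by
  have hrel : ∀ u, T.Relator 𝕜 u → mkHom 𝕜 T u = 0 := fun u hu ↦ mk_idealOf_eq_zero hu
  change IsShiftedTriple C M 0 _ (fun μ ↦ mkHom 𝕜 T _) (fun i ↦ mkHom 𝕜 T _)
    (fun i ↦ mkHom 𝕜 T _)
  refine ⟨?_, fun μ ν ↦ ?_, fun μ j ↦ ?_, fun μ j ↦ ?_, fun i j ↦ ?_, fun i j hij ↦ ?_,
    fun i j hij ↦ ?_⟩
  · rw [TorusDatum.K_zero, map_one]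
  · rw [← map_mul, ← TorusDatum.K_add]
  · rw [← map_mul, TorusDatum.K_mul_X, map_smul, map_mul]
    rfl
  · rw [← map_mul, TorusDatum.K_mul_X, map_smul, map_mul]
    rfl
  · have h := hrel _ (.commutator i j)
    rw [map_sub, map_sub, map_mul, map_mul, sub_eq_zero, map_smul, map_sub] at h
    simpa using h
  · have h := hrel _ (.serre_E i j hij)
    rw [serreSum_qBinomSym hij, map_serreSum_of_bialgHom] at h
    simpa using h
  · have h := hrel _ (.serre_F i j hij)
    rw [serreSum_qBinomSym hij, map_serreSum_of_bialgHom, ← serreSumRev_eq_zero_iff hij] at h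
    simpa using h

variable {T} {k : M.carrier → A} {e f : I → A}

theorem respects {c : I → QField 𝕜} (h : IsShiftedTriple C M 0 c k e f) :
    (T.torusDatum 𝕜).Respects k (Sum.elim e f) where
  K_zero := h.k_zero
  K_add := h.k_add
  K_mul_X := by
    rintro x (j | j)
    · exact h.k_mul_e _ j
    · exact h.k_mul_f _ j

theorem lift_relator
    (h : IsShiftedTriple C M 0 (fun i ↦ (qPow 𝕜 (C.d i) - (qPow 𝕜 (C.d i))⁻¹)⁻¹) k e f)
    {u : (T.torusDatum 𝕜).Alg} (hu : T.Relator 𝕜 u) :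
    TorusDatum.lift (respects h) u = 0 := by
  cases hu with
  | commutator i j =>
    rw [map_sub, map_sub, map_mul, map_mul, map_smul, map_sub, sub_eq_zero]
    simp only [TorusDatum.lift_X, TorusDatum.lift_K, Sum.elim_inl, Sum.elim_inr]
    simpa using h.commutator i j
  | serre_E i j hij =>
    rw [serreSum_qBinomSym hij, TorusDatum.map_serreSum, TorusDatum.lift_X, TorusDatum.lift_X]
    simpa using h.serre_e i j hij
  | serre_F i j hij =>
    rw [serreSum_qBinomSym hij, TorusDatum.map_serreSum, TorusDatum.lift_X, TorusDatum.lift_X,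
      ← serreSumRev_eq_zero_iff hij]
    simpa using h.serre_f i j hij

variable (T) in
/-- The universal property of `U^Ψ_{q,M}(𝔤)`, as an algebra. -/
noncomputable def lift
    (h : IsShiftedTriple C M 0 (fun i ↦ (qPow 𝕜 (C.d i) - (qPow 𝕜 (C.d i))⁻¹)⁻¹) k e f) :
    T.TwistedQuantumGroup 𝕜 →ₐ[QField 𝕜] A :=
  idealOfLift (A := (T.torusDatum 𝕜).Alg) (TorusDatum.lift (respects h))
    fun _ hu ↦ lift_relator h hu

theorem lift_mkHom
    (h : IsShiftedTriple C M 0 (fun i ↦ (qPow 𝕜 (C.d i) - (qPow 𝕜 (C.d i))⁻¹)⁻¹) k e f)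
    (x : (T.torusDatum 𝕜).Alg) :
    lift T h (mkHom 𝕜 T x) = TorusDatum.lift (respects h) x := rfl

end ToralTwist.TwistedQuantumGroup

end UniversalProperties

/-! ### The isomorphism with the twisted quantum group -/

section SingleTwisted

variable {𝕜 : Type*} [Field 𝕜] {I : Type*} [Fintype I] [DecidableEq I] {C : CartanDatum I}
  {M : RootLattice I}

/-- The factor `q_i` in the image of `E_i` converts one normalization of the commutator into the other. -/
theorem qPow_mul_inv_sub {I : Type*} (C : CartanDatum I) (i : I) :
    qPow 𝕜 (C.d i) * (qPow 𝕜 (C.d i) - (qPow 𝕜 (C.d i))⁻¹)⁻¹ =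
      qPow 𝕜 (2 * C.d i) / (qPow 𝕜 (2 * C.d i) - 1) := by
  have h0 := qPow_ne_zero (𝕜 := 𝕜) (C.d i)
  have e : qPow 𝕜 (2 * C.d i) = qPow 𝕜 (C.d i) ^ 2 := by
    rw [qPow_pow]; congr 1
  have hd : (2 * C.d i : ℚ) ≠ 0 := by
    have := C.d_pos i
    positivity
  have h1 : qPow 𝕜 (C.d i) ^ 2 - 1 ≠ 0 := by
    rw [← e]
    exact sub_ne_zero.2 fun h ↦ hd (qPow_eq_one h)
  have h2 : qPow 𝕜 (C.d i) - (qPow 𝕜 (C.d i))⁻¹ = (qPow 𝕜 (C.d i) ^ 2 - 1) / qPow 𝕜 (C.d i) := by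
    field_simp
  rw [e, h2]
  field_simp

namespace ToralTwist.TwistedQuantumGroup

variable (𝕜) in
/-- `q_i K_{ψ_+(α_i)} E_i` and `K_{ψ_+(α_i)} F_i` satisfy the relations of `U_{𝐪,M•}(𝔤)`. -/
theorem isShiftedTriple_plus (T : ToralTwist C M) :
    IsShiftedTriple C M T.plus (fun i ↦ qPow 𝕜 (2 * C.d i) / (qPow 𝕜 (2 * C.d i) - 1))
      (K 𝕜 T) (fun i ↦ qPow 𝕜 (C.d i) • (K 𝕜 T (T.plus (M.root i)) * E 𝕜 T i))
      (fun i ↦ K 𝕜 T (T.plus (M.root i)) * F 𝕜 T i) := by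
  have h := (isShiftedTriple 𝕜 T).shift T.plus T.weight_plus_root_antisymm fun i ↦ qPow 𝕜 (C.d i)
  simpa only [zero_add, qPow_mul_inv_sub] using h

end ToralTwist.TwistedQuantumGroup

namespace Multiparameter.Single

open ToralTwist.TwistedQuantumGroup (isShiftedTriple_plus)

variable {P : Multiparameter C} {T : ToralTwist C M}
  (hP : P.R = C.symmetrized + C.cartan.transpose * (T.Ψ.transpose - T.Ψ) * C.cartan)

/-- `q_i⁻¹ k_{-ψ_+(α_i)} E_i` and `k_{-ψ_+(α_i)} F_i` satisfy the relations of `U_{q,M}(𝔤)`, where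
`k_μ` is the class of `K_{μ - ψ_+(μ)} L_{ψ_+(μ)}`. -/
theorem isShiftedTriple_zero
    (hP : P.R = C.symmetrized + C.cartan.transpose * (T.Ψ.transpose - T.Ψ) * C.cartan) :
    IsShiftedTriple C M 0 (fun i ↦ (qPow 𝕜 (C.d i) - (qPow 𝕜 (C.d i))⁻¹)⁻¹)
      (fun μ ↦ presentation 𝕜 P T ((P.torusDatum 𝕜 M).K (μ - T.plus μ, T.plus μ)))
      (fun i ↦ (qPow 𝕜 (C.d i))⁻¹ •
        (presentation 𝕜 P T ((P.torusDatum 𝕜 M).K ((-T.plus) (M.root i) -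
          T.plus ((-T.plus) (M.root i)), T.plus ((-T.plus) (M.root i)))) *
        presentation 𝕜 P T ((P.torusDatum 𝕜 M).X (.inl i))))
      (fun i ↦ presentation 𝕜 P T ((P.torusDatum 𝕜 M).K ((-T.plus) (M.root i) -
          T.plus ((-T.plus) (M.root i)), T.plus ((-T.plus) (M.root i)))) *
        presentation 𝕜 P T ((P.torusDatum 𝕜 M).X (.inr i))) := by
  have h := (isShiftedTriple (𝕜 := 𝕜) hP).shift (-T.plus)
    (fun i j ↦ by simp [T.weight_plus_root_antisymm i j]) fun i ↦ (qPow 𝕜 (C.d i))⁻¹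
  have hc : ∀ i, (qPow 𝕜 (C.d i))⁻¹ * (qPow 𝕜 (2 * C.d i) / (qPow 𝕜 (2 * C.d i) - 1)) =
      (qPow 𝕜 (C.d i) - (qPow 𝕜 (C.d i))⁻¹)⁻¹ := fun i ↦ by
    rw [← qPow_mul_inv_sub, inv_mul_cancel_left₀ (qPow_ne_zero _)]
  simpa only [add_neg_cancel, hc] using h

variable (𝕜) in
/-- The homomorphism of algebras `U_{𝐪,M•}(𝔤) → U^Ψ_{q,M}(𝔤)`. -/
noncomputable def toTwisted : P.Single 𝕜 T →ₐ[QField 𝕜] T.TwistedQuantumGroup 𝕜 :=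
  liftTriple hP (isShiftedTriple_plus 𝕜 T)

variable (𝕜) in
/-- The inverse homomorphism `U^Ψ_{q,M}(𝔤) → U_{𝐪,M•}(𝔤)`. -/
noncomputable def ofTwisted : T.TwistedQuantumGroup 𝕜 →ₐ[QField 𝕜] P.Single 𝕜 T :=
  ToralTwist.TwistedQuantumGroup.lift T (isShiftedTriple_zero hP)

open ToralTwist (TwistedQuantumGroup)

theorem toTwisted_K (x : M.carrier × M.carrier) :
    toTwisted 𝕜 hP (presentation 𝕜 P T ((P.torusDatum 𝕜 M).K x)) =
      TwistedQuantumGroup.K 𝕜 T (toralProj T x) := by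
  rw [toTwisted, liftTriple_presentation, TorusDatum.lift_K]

theorem toTwisted_E (i : I) :
    toTwisted 𝕜 hP (presentation 𝕜 P T ((P.torusDatum 𝕜 M).X (.inl i))) =
      qPow 𝕜 (C.d i) •
        (TwistedQuantumGroup.K 𝕜 T (T.plus (M.root i)) * TwistedQuantumGroup.E 𝕜 T i) := by
  rw [toTwisted, liftTriple_presentation, TorusDatum.lift_X, Sum.elim_inl]

theorem toTwisted_F (i : I) :
    toTwisted 𝕜 hP (presentation 𝕜 P T ((P.torusDatum 𝕜 M).X (.inr i))) =
      TwistedQuantumGroup.K 𝕜 T (T.plus (M.root i)) * TwistedQuantumGroup.F 𝕜 T i := by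
  rw [toTwisted, liftTriple_presentation, TorusDatum.lift_X, Sum.elim_inr]

theorem ofTwisted_K (μ : M.carrier) :
    ofTwisted 𝕜 hP (TwistedQuantumGroup.K 𝕜 T μ) =
      presentation 𝕜 P T ((P.torusDatum 𝕜 M).K (μ - T.plus μ, T.plus μ)) := by
  change ofTwisted 𝕜 hP (TwistedQuantumGroup.mkHom 𝕜 T _) = _
  rw [ofTwisted, TwistedQuantumGroup.lift_mkHom, TorusDatum.lift_K]

theorem ofTwisted_E (i : I) :
    ofTwisted 𝕜 hP (TwistedQuantumGroup.E 𝕜 T i) = (qPow 𝕜 (C.d i))⁻¹ •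
      (ofTwisted 𝕜 hP (TwistedQuantumGroup.K 𝕜 T (-T.plus (M.root i))) *
        presentation 𝕜 P T ((P.torusDatum 𝕜 M).X (.inl i))) := by
  rw [ofTwisted_K]
  change ofTwisted 𝕜 hP (TwistedQuantumGroup.mkHom 𝕜 T _) = _
  rw [ofTwisted, TwistedQuantumGroup.lift_mkHom, TorusDatum.lift_X]
  rfl

theorem ofTwisted_F (i : I) :
    ofTwisted 𝕜 hP (TwistedQuantumGroup.F 𝕜 T i) =
      ofTwisted 𝕜 hP (TwistedQuantumGroup.K 𝕜 T (-T.plus (M.root i))) *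
        presentation 𝕜 P T ((P.torusDatum 𝕜 M).X (.inr i)) := by
  rw [ofTwisted_K]
  change ofTwisted 𝕜 hP (TwistedQuantumGroup.mkHom 𝕜 T _) = _
  rw [ofTwisted, TwistedQuantumGroup.lift_mkHom, TorusDatum.lift_X]
  rfl

theorem twisted_K_mul (μ ν : M.carrier) : TwistedQuantumGroup.K 𝕜 T μ * TwistedQuantumGroup.K 𝕜 T ν =
    TwistedQuantumGroup.K 𝕜 T (μ + ν) :=
  ((TwistedQuantumGroup.isShiftedTriple 𝕜 T).k_add μ ν).symm

theorem twisted_K_zero : TwistedQuantumGroup.K 𝕜 T 0 = 1 :=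
  (TwistedQuantumGroup.isShiftedTriple 𝕜 T).k_zero

theorem ofTwisted_toTwisted (x : P.Single 𝕜 T) : ofTwisted 𝕜 hP (toTwisted 𝕜 hP x) = x := by
  have h : ((ofTwisted 𝕜 hP).comp (toTwisted 𝕜 hP)).comp
      (presentation 𝕜 P T : (P.torusDatum 𝕜 M).Alg →ₐ[QField 𝕜] P.Single 𝕜 T) =
      (presentation 𝕜 P T : (P.torusDatum 𝕜 M).Alg →ₐ[QField 𝕜] P.Single 𝕜 T) := by
    apply TorusDatum.algHom_ext
    rintro (a | i | i)
    · change ofTwisted 𝕜 hP (toTwisted 𝕜 hP (presentation 𝕜 P T _)) = presentation 𝕜 P T _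
      rw [toTwisted_K, ofTwisted_K, presentation_K]
    · change ofTwisted 𝕜 hP (toTwisted 𝕜 hP (presentation 𝕜 P T _)) = presentation 𝕜 P T _
      rw [toTwisted_E, map_smul, map_mul, ofTwisted_E, mul_smul_comm, smul_smul,
        mul_inv_cancel₀ (qPow_ne_zero _), one_smul, ← mul_assoc, ← map_mul, twisted_K_mul,
        add_neg_cancel, twisted_K_zero, map_one, one_mul]
    · change ofTwisted 𝕜 hP (toTwisted 𝕜 hP (presentation 𝕜 P T _)) = presentation 𝕜 P T _
      rw [toTwisted_F, map_mul, ofTwisted_F, ← mul_assoc, ← map_mul, twisted_K_mul,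
        add_neg_cancel, twisted_K_zero, map_one, one_mul]
  obtain ⟨y, rfl⟩ := presentation_surjective 𝕜 P T x
  exact congr($h y)

theorem toTwisted_ofTwisted_K (μ : M.carrier) :
    toTwisted 𝕜 hP (ofTwisted 𝕜 hP (TwistedQuantumGroup.K 𝕜 T μ)) =
      TwistedQuantumGroup.K 𝕜 T μ := by
  rw [ofTwisted_K, toTwisted_K, toralProj_section]

theorem toTwisted_ofTwisted (x : T.TwistedQuantumGroup 𝕜) :
    toTwisted 𝕜 hP (ofTwisted 𝕜 hP x) = x := by
  have h : ((toTwisted 𝕜 hP).comp (ofTwisted 𝕜 hP)).comp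
      (TwistedQuantumGroup.mkHom 𝕜 T : (T.torusDatum 𝕜).Alg →ₐ[QField 𝕜] T.TwistedQuantumGroup 𝕜) =
      (TwistedQuantumGroup.mkHom 𝕜 T :
        (T.torusDatum 𝕜).Alg →ₐ[QField 𝕜] T.TwistedQuantumGroup 𝕜) := by
    apply TorusDatum.algHom_ext
    rintro (a | i | i)
    · exact toTwisted_ofTwisted_K hP a
    · change toTwisted 𝕜 hP (ofTwisted 𝕜 hP (TwistedQuantumGroup.E 𝕜 T i)) =
        TwistedQuantumGroup.E 𝕜 T i
      rw [ofTwisted_E, map_smul, map_mul, toTwisted_ofTwisted_K, toTwisted_E, mul_smul_comm,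
        smul_smul, inv_mul_cancel₀ (qPow_ne_zero _), one_smul, ← mul_assoc, twisted_K_mul,
        neg_add_cancel, twisted_K_zero, one_mul]
    · change toTwisted 𝕜 hP (ofTwisted 𝕜 hP (TwistedQuantumGroup.F 𝕜 T i)) =
        TwistedQuantumGroup.F 𝕜 T i
      rw [ofTwisted_F, map_mul, toTwisted_ofTwisted_K, toTwisted_F, ← mul_assoc, twisted_K_mul,
        neg_add_cancel, twisted_K_zero, one_mul]
  obtain ⟨y, rfl⟩ := TwistedQuantumGroup.mkHom_surjective 𝕜 T x
  exact congr($h y)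

theorem comul_twisted_K (μ : M.carrier) :
    Coalgebra.comul (R := QField 𝕜) (TwistedQuantumGroup.K 𝕜 T μ) =
      TwistedQuantumGroup.K 𝕜 T μ ⊗ₜ TwistedQuantumGroup.K 𝕜 T μ := by
  have h := CoalgHomClass.map_comp_comul_apply (TwistedQuantumGroup.mkHom 𝕜 T)
    ((T.torusDatum 𝕜).K μ)
  rw [TorusDatum.comul_K] at h
  exact h.symm

theorem comul_twisted_X (j : I ⊕ I) :
    Coalgebra.comul (R := QField 𝕜) (TwistedQuantumGroup.mk 𝕜 T ((T.torusDatum 𝕜).X j)) =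
      TwistedQuantumGroup.mk 𝕜 T ((T.torusDatum 𝕜).X j) ⊗ₜ
          TwistedQuantumGroup.K 𝕜 T ((T.torusDatum 𝕜).right j) +
        TwistedQuantumGroup.K 𝕜 T ((T.torusDatum 𝕜).left j) ⊗ₜ
          TwistedQuantumGroup.mk 𝕜 T ((T.torusDatum 𝕜).X j) := by
  have h := CoalgHomClass.map_comp_comul_apply (TwistedQuantumGroup.mkHom 𝕜 T)
    ((T.torusDatum 𝕜).X j)
  rw [TorusDatum.comul_X, map_add] at h
  exact h.symm

variable (𝕜) in
/-- The isomorphism of Hopf algebras `U_{𝐪,M•}(𝔤) ≅ U^Ψ_{q,M}(𝔤)`. -/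
noncomputable def twistedEquiv : P.Single 𝕜 T ≃ₐc[QField 𝕜] T.TwistedQuantumGroup 𝕜 :=
  BialgEquiv.ofBijective
    (TorusDatum.bialgHomOfGen (presentation 𝕜 P T) (presentation_surjective 𝕜 P T)
      (toTwisted 𝕜 hP)
      (fun a ↦ by
        rw [toTwisted_K]
        refine ⟨?_, comul_twisted_K _⟩
        exact (CoalgHomClass.counit_comp_apply (TwistedQuantumGroup.mkHom 𝕜 T)
          ((T.torusDatum 𝕜).K _)).trans (TorusDatum.counit_K _ _))
      (by
        rintro (i | i)
        · rw [toTwisted_E, map_smul, Bialgebra.comul_mul, comul_twisted_K, toTwisted_K, toTwisted_K]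
          have h := comul_twisted_X (𝕜 := 𝕜) (T := T) (.inl i)
          change Coalgebra.comul (R := QField 𝕜) (TwistedQuantumGroup.E 𝕜 T i) =
            TwistedQuantumGroup.E 𝕜 T i ⊗ₜ TwistedQuantumGroup.K 𝕜 T (T.minus (M.root i)) +
            TwistedQuantumGroup.K 𝕜 T (M.root i + T.plus (M.root i)) ⊗ₜ
              TwistedQuantumGroup.E 𝕜 T i at h
          rw [h, mul_add, Algebra.TensorProduct.tmul_mul_tmul, Algebra.TensorProduct.tmul_mul_tmul,
            twisted_K_mul, twisted_K_mul, smul_add, TensorProduct.smul_tmul',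
            TensorProduct.tmul_smul, T.minus_apply, toralProj_apply, toralProj_apply]
          simp only [torusDatum, Sum.elim_inl, Prod.fst_zero, Prod.snd_zero, map_zero, nsmul_zero,
            add_zero, sub_zero, add_neg_cancel]
          rw [two_nsmul, add_left_comm]
        · rw [toTwisted_F, Bialgebra.comul_mul, comul_twisted_K, toTwisted_K, toTwisted_K]
          have h := comul_twisted_X (𝕜 := 𝕜) (T := T) (.inr i)
          change Coalgebra.comul (R := QField 𝕜) (TwistedQuantumGroup.F 𝕜 T i) =
            TwistedQuantumGroup.F 𝕜 T i ⊗ₜ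
              TwistedQuantumGroup.K 𝕜 T (-(M.root i + T.minus (M.root i))) +
            TwistedQuantumGroup.K 𝕜 T (-T.plus (M.root i)) ⊗ₜ TwistedQuantumGroup.F 𝕜 T i at h
          rw [h, mul_add, Algebra.TensorProduct.tmul_mul_tmul, Algebra.TensorProduct.tmul_mul_tmul,
            twisted_K_mul, twisted_K_mul, T.minus_apply, toralProj_apply, toralProj_apply]
          simp only [torusDatum, Sum.elim_inr, Prod.fst_zero, Prod.snd_zero, map_zero, nsmul_zero,
            add_zero, zero_add, sub_zero, add_neg_cancel]
          congr 3
          abel))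
    (Function.bijective_iff_has_inverse.2
      ⟨ofTwisted 𝕜 hP, ofTwisted_toTwisted hP, toTwisted_ofTwisted hP⟩)

theorem twistedEquiv_K (μ : M.carrier) : twistedEquiv 𝕜 hP (mk 𝕜 P T (Double.K 𝕜 P M μ)) =
    TwistedQuantumGroup.K 𝕜 T (μ + T.plus μ - T.minus μ) := by
  refine (toTwisted_K hP (μ, 0)).trans ?_
  rw [toralProj_apply, T.minus_apply, map_zero, nsmul_zero, sub_zero, add_zero]
  congr 1
  abel

theorem twistedEquiv_L (μ : M.carrier) : twistedEquiv 𝕜 hP (mk 𝕜 P T (Double.L 𝕜 P M μ)) =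
    TwistedQuantumGroup.K 𝕜 T (-(μ + T.minus μ - T.plus μ)) := by
  refine (toTwisted_K hP (0, μ)).trans ?_
  rw [toralProj_apply, T.minus_apply, map_zero, nsmul_zero, add_zero, zero_add]
  congr 1
  abel

theorem twistedEquiv_E (i : I) : twistedEquiv 𝕜 hP (mk 𝕜 P T (Double.E 𝕜 P M i)) =
    qPow 𝕜 (C.d i) •
      (TwistedQuantumGroup.K 𝕜 T (-T.minus (M.root i)) * TwistedQuantumGroup.E 𝕜 T i) := by
  rw [T.minus_apply, neg_neg]
  exact toTwisted_E hP i

theorem twistedEquiv_F (i : I) : twistedEquiv 𝕜 hP (mk 𝕜 P T (Double.F 𝕜 P M i)) =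
    TwistedQuantumGroup.K 𝕜 T (T.plus (M.root i)) * TwistedQuantumGroup.F 𝕜 T i :=
  toTwisted_F hP i

end Multiparameter.Single

end SingleTwisted

/-! ### The deformed product of bihomogeneous elements -/

section Bihomogeneous

open WithConv Coalgebra

variable {F : Type*} [Field F] {Λ : Type*} [AddCommGroup Λ] {H : Type*} [Ring H] [Bialgebra F H]
  (p : H →ₐc[F] AddMonoidAlgebra F Λ)

/-- `x` is homogeneous of degree `l` for the left coaction `(p ⊗ id) ∘ Δ` of the group algebra, and
of degree `r` for the right coaction `(id ⊗ p) ∘ Δ`. -/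
structure IsBihomogeneous (l r : Λ) (x : H) : Prop where
  left : Algebra.TensorProduct.map (p : H →ₐ[F] AddMonoidAlgebra F Λ) (AlgHom.id F H)
    (comul (R := F) x) = AddMonoidAlgebra.single l 1 ⊗ₜ x
  right : Algebra.TensorProduct.map (AlgHom.id F H) (p : H →ₐ[F] AddMonoidAlgebra F Λ)
    (comul (R := F) x) = x ⊗ₜ AddMonoidAlgebra.single r 1

variable {p}

theorem IsBihomogeneous.one : IsBihomogeneous p 0 0 1 :=
  ⟨by rw [Bialgebra.comul_one, map_one, Algebra.TensorProduct.one_def, AddMonoidAlgebra.one_def],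
    by rw [Bialgebra.comul_one, map_one, Algebra.TensorProduct.one_def, AddMonoidAlgebra.one_def]⟩

theorem IsBihomogeneous.mul {l r l' r' : Λ} {x y : H} (hx : IsBihomogeneous p l r x)
    (hy : IsBihomogeneous p l' r' y) : IsBihomogeneous p (l + l') (r + r') (x * y) :=
  ⟨by rw [Bialgebra.comul_mul, map_mul, hx.left, hy.left, Algebra.TensorProduct.tmul_mul_tmul,
      AddMonoidAlgebra.single_mul_single, mul_one],
    by rw [Bialgebra.comul_mul, map_mul, hx.right, hy.right, Algebra.TensorProduct.tmul_mul_tmul,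
      AddMonoidAlgebra.single_mul_single, mul_one]⟩

theorem IsBihomogeneous.smul {l r : Λ} {x : H} (hx : IsBihomogeneous p l r x) (c : F) :
    IsBihomogeneous p l r (c • x) :=
  ⟨by rw [map_smul, map_smul, hx.left, TensorProduct.tmul_smul],
    by rw [map_smul, map_smul, hx.right, TensorProduct.smul_tmul']⟩

theorem IsBihomogeneous.pow {l r : Λ} {x : H} (hx : IsBihomogeneous p l r x) (n : ℕ) :
    IsBihomogeneous p (n • l) (n • r) (x ^ n) := by
  induction n with
  | zero => simpa using .one
  | succ n ih => simpa only [pow_succ, succ_nsmul] using ih.mul hx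

/-- Left convolution with a functional that factors through `p ⊗ p` sees only the left degrees. -/
theorem scalar_convMul_tmul {b : Λ → Λ → F} {s : WithConv (H ⊗[F] H →ₗ[F] F)}
    (hs : s = pull (toConv (bilinOfFun b)) (Coalgebra.TensorProduct.map p.toCoalgHom p.toCoalgHom))
    (f : WithConv (H ⊗[F] H →ₗ[F] H)) {l r l' r' : Λ} {x y : H} (hx : IsBihomogeneous p l r x)
    (hy : IsBihomogeneous p l' r' y) :
    (scalar H s * f) (x ⊗ₜ y) = b l l' • f (x ⊗ₜ y) := by
  have key : ∀ t u : H ⊗[F] H,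
      LinearMap.mul' F H (TensorProduct.map (scalar H s).ofConv f.ofConv
        (TensorProduct.tensorTensorTensorComm F H H H H (t ⊗ₜ u))) =
      LinearMap.mul' F H (TensorProduct.map (scalar H (toConv (bilinOfFun b))).ofConv f.ofConv
        (TensorProduct.tensorTensorTensorComm F _ _ _ _
          (Algebra.TensorProduct.map (p : H →ₐ[F] AddMonoidAlgebra F Λ) (AlgHom.id F H) t ⊗ₜ
            Algebra.TensorProduct.map (p : H →ₐ[F] AddMonoidAlgebra F Λ) (AlgHom.id F H) u))) := by
    intro t u
    induction t with
    | zero => simp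
    | add t t' h h' => simp only [map_add, TensorProduct.add_tmul, h, h']
    | tmul t t' =>
      induction u with
      | zero => simp
      | add u u' h h' => simp only [map_add, TensorProduct.tmul_add, h, h']
      | tmul u u' =>
        subst hs
        rfl
  have h := key (comul x) (comul y)
  rw [hx.left, hy.left] at h
  refine Eq.trans ?_ (h.trans ?_)
  · rw [LinearMap.convMul_def]
    rfl
  · simp [scalar, bilinOfFun_single, Algebra.smul_def]

/-- Right convolution with a functional that factors through `p ⊗ p` sees only the right degrees. -/
theorem convMul_scalar_tmul {b : Λ → Λ → F} {s : WithConv (H ⊗[F] H →ₗ[F] F)}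
    (hs : s = pull (toConv (bilinOfFun b)) (Coalgebra.TensorProduct.map p.toCoalgHom p.toCoalgHom))
    (f : WithConv (H ⊗[F] H →ₗ[F] H)) {l r l' r' : Λ} {x y : H} (hx : IsBihomogeneous p l r x)
    (hy : IsBihomogeneous p l' r' y) :
    (f * scalar H s) (x ⊗ₜ y) = b r r' • f (x ⊗ₜ y) := by
  have key : ∀ t u : H ⊗[F] H,
      LinearMap.mul' F H (TensorProduct.map f.ofConv (scalar H s).ofConv
        (TensorProduct.tensorTensorTensorComm F H H H H (t ⊗ₜ u))) =
      LinearMap.mul' F H (TensorProduct.map f.ofConv (scalar H (toConv (bilinOfFun b))).ofConv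
        (TensorProduct.tensorTensorTensorComm F _ _ _ _
          (Algebra.TensorProduct.map (AlgHom.id F H) (p : H →ₐ[F] AddMonoidAlgebra F Λ) t ⊗ₜ
            Algebra.TensorProduct.map (AlgHom.id F H) (p : H →ₐ[F] AddMonoidAlgebra F Λ) u))) := by
    intro t u
    induction t with
    | zero => simp
    | add t t' h h' => simp only [map_add, TensorProduct.add_tmul, h, h']
    | tmul t t' =>
      induction u with
      | zero => simp
      | add u u' h h' => simp only [map_add, TensorProduct.tmul_add, h, h']
      | tmul u u' =>
        subst hs
        rfl
  have h := key (comul x) (comul y)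
  rw [hx.right, hy.right] at h
  refine Eq.trans ?_ (h.trans ?_)
  · rw [LinearMap.convMul_def]
    rfl
  · simp [scalar, bilinOfFun_single, Algebra.smul_def, ← Algebra.commutes]

/-- On bihomogeneous elements the deformed product is a multiple of the product. -/
theorem mulMap_tmul {b : Λ → Λ → F} {hb hl hr} {l r l' r' : Λ} {x y : H}
    (hx : IsBihomogeneous p l r x) (hy : IsBihomogeneous p l' r' y) :
    ((TwoCocycle.ofBicharacter b hb hl hr).comap p).mulMap (x ⊗ₜ y) =
      (b l l' * (b r r')⁻¹) • (x * y) := by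
  rw [TwoCocycle.mulMap, mul_assoc]
  refine (scalar_convMul_tmul rfl _ hx hy).trans ?_
  have h := convMul_scalar_tmul (p := p) (b := fun μ ν ↦ (b μ ν)⁻¹) rfl
    (toConv (LinearMap.mul' F H)) hx hy
  rw [mul_smul]
  exact congrArg (b l l' • ·) h

end Bihomogeneous

/-! ### Degrees of the generators -/

section DoubleDeformation

variable {𝕜 : Type*} [Field 𝕜] {I : Type*} [Fintype I] [DecidableEq I] {C : CartanDatum I}
  {M : RootLattice I}

theorem toralHom_mk_K (P : Multiparameter C) (x : M.carrier × M.carrier) :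
    P.toralHom 𝕜 M (.mk 𝕜 P M ((P.torusDatum 𝕜 M).K x)) = AddMonoidAlgebra.single (x.1 + x.2) 1 :=
  TorusDatum.lift_K _ (P.toral_respects 𝕜 M) x

theorem toralHom_mk_X (P : Multiparameter C) (j : I ⊕ I) :
    P.toralHom 𝕜 M (.mk 𝕜 P M ((P.torusDatum 𝕜 M).X j)) = 0 :=
  TorusDatum.lift_X _ (P.toral_respects 𝕜 M) j

theorem comul_double_K (P : Multiparameter C) (x : M.carrier × M.carrier) :
    Coalgebra.comul (R := QField 𝕜) (Multiparameter.Double.mk 𝕜 P M ((P.torusDatum 𝕜 M).K x)) =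
      Multiparameter.Double.mk 𝕜 P M ((P.torusDatum 𝕜 M).K x) ⊗ₜ
        Multiparameter.Double.mk 𝕜 P M ((P.torusDatum 𝕜 M).K x) :=
  (Multiparameter.Double.isGroupLikeElem_mk 𝕜 P M).comul_eq_tmul_self

theorem comul_double_X (P : Multiparameter C) (j : I ⊕ I) :
    Coalgebra.comul (R := QField 𝕜) (Multiparameter.Double.mk 𝕜 P M ((P.torusDatum 𝕜 M).X j)) =
      Multiparameter.Double.mk 𝕜 P M ((P.torusDatum 𝕜 M).X j) ⊗ₜ
        Multiparameter.Double.mk 𝕜 P M ((P.torusDatum 𝕜 M).K ((P.torusDatum 𝕜 M).right j)) +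
      Multiparameter.Double.mk 𝕜 P M ((P.torusDatum 𝕜 M).K ((P.torusDatum 𝕜 M).left j)) ⊗ₜ
        Multiparameter.Double.mk 𝕜 P M ((P.torusDatum 𝕜 M).X j) := by
  have h := CoalgHomClass.map_comp_comul_apply (Multiparameter.Double.mkHom 𝕜 P M)
    ((P.torusDatum 𝕜 M).X j)
  rw [TorusDatum.comul_X, map_add] at h
  exact h.symm

theorem isBihomogeneous_K (P : Multiparameter C) (x : M.carrier × M.carrier) :
    IsBihomogeneous (P.toralHom 𝕜 M) (x.1 + x.2) (x.1 + x.2)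
      (.mk 𝕜 P M ((P.torusDatum 𝕜 M).K x)) := by
  constructor <;> simp [comul_double_K, toralHom_mk_K]

theorem torusDatum_left_inl (P : Multiparameter C) (i : I) :
    (P.torusDatum 𝕜 M).left (.inl i) = (M.root i, 0) := rfl

theorem torusDatum_left_inr (P : Multiparameter C) (i : I) :
    (P.torusDatum 𝕜 M).left (.inr i) = 0 := rfl

theorem torusDatum_right_inl (P : Multiparameter C) (i : I) :
    (P.torusDatum 𝕜 M).right (.inl i) = 0 := rfl

theorem torusDatum_right_inr (P : Multiparameter C) (i : I) :
    (P.torusDatum 𝕜 M).right (.inr i) = (0, M.root i) := rfl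

theorem isBihomogeneous_E (P : Multiparameter C) (i : I) :
    IsBihomogeneous (P.toralHom 𝕜 M) (M.root i) 0
      (.mk 𝕜 P M ((P.torusDatum 𝕜 M).X (.inl i))) := by
  constructor <;>
    simp [comul_double_X, toralHom_mk_K, toralHom_mk_X, torusDatum_left_inl, torusDatum_right_inl]

theorem isBihomogeneous_F (P : Multiparameter C) (i : I) :
    IsBihomogeneous (P.toralHom 𝕜 M) 0 (M.root i)
      (.mk 𝕜 P M ((P.torusDatum 𝕜 M).X (.inr i))) := by
  constructor <;>
    simp [comul_double_X, toralHom_mk_K, toralHom_mk_X, torusDatum_left_inr, torusDatum_right_inr]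

end DoubleDeformation

/-! ### Relations in the cocycle deformation -/

section DeformedDouble

variable {𝕜 : Type*} [Field 𝕜] {I : Type*} [Fintype I] [DecidableEq I] {C : CartanDatum I}
  {M : RootLattice I}

/-- `β` is additive in each variable. -/
structure IsBiadditive {Λ : Type*} [AddCommGroup Λ] (β : Λ → Λ → ℚ) : Prop where
  add_left : ∀ μ μ' ν, β (μ + μ') ν = β μ ν + β μ' ν
  add_right : ∀ μ ν ν', β μ (ν + ν') = β μ ν + β μ ν'

namespace IsBiadditive

variable {Λ : Type*} [AddCommGroup Λ] {β : Λ → Λ → ℚ}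

theorem zero_left (h : IsBiadditive β) (ν : Λ) : β 0 ν = 0 := by
  simpa using h.add_left 0 0 ν

theorem zero_right (h : IsBiadditive β) (μ : Λ) : β μ 0 = 0 := by
  simpa using h.add_right μ 0 0

theorem nsmul_left (h : IsBiadditive β) (n : ℕ) (μ ν : Λ) : β (n • μ) ν = n * β μ ν := by
  induction n with
  | zero => simp [h.zero_left]
  | succ n ih => rw [succ_nsmul, h.add_left, ih]; push_cast; ring

theorem nsmul_right (h : IsBiadditive β) (n : ℕ) (μ ν : Λ) : β μ (n • ν) = n * β μ ν := by
  induction n with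
  | zero => simp [h.zero_right]
  | succ n ih => rw [succ_nsmul, h.add_right, ih]; push_cast; ring

theorem neg (h : IsBiadditive β) : IsBiadditive fun μ ν ↦ -β μ ν :=
  ⟨fun μ μ' ν ↦ by rw [h.add_left]; ring, fun μ ν ν' ↦ by rw [h.add_right]; ring⟩

end IsBiadditive

variable (𝕜) in
/-- The cocycle of `U_{𝐩,M•}(𝔤_D)` with `σ(K_μ, K_ν) = q ^ β(μ, ν)`. -/
noncomputable def expCocycle (P : Multiparameter C) {β : M.carrier → M.carrier → ℚ}
    (hβ : IsBiadditive β) : TwoCocycle (QField 𝕜) (P.Double 𝕜 M) :=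
  (TwoCocycle.ofBicharacter (fun μ ν ↦ qPow 𝕜 (β μ ν)) (fun _ _ ↦ qPow_ne_zero _)
    (fun μ μ' ν ↦ by rw [← qPow_add, hβ.add_left])
    (fun μ ν ν' ↦ by rw [← qPow_add, hβ.add_right])).comap (P.toralHom 𝕜 M)

section Products

variable {P : Multiparameter C} {β : M.carrier → M.carrier → ℚ} (hβ : IsBiadditive β)
  {l r l' r' : M.carrier} {x y : P.Double 𝕜 M}

theorem deformed_mul (hx : IsBihomogeneous (P.toralHom 𝕜 M) l r x)
    (hy : IsBihomogeneous (P.toralHom 𝕜 M) l' r' y) :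
    (expCocycle 𝕜 P hβ).toDeformed x * (expCocycle 𝕜 P hβ).toDeformed y =
      qPow 𝕜 (β l l' - β r r') • (expCocycle 𝕜 P hβ).toDeformed (x * y) := by
  rw [TwoCocycle.toDeformed_mul_toDeformed, ← map_smul]
  congr 1
  refine (mulMap_tmul hx hy).trans ?_
  rw [sub_eq_add_neg, qPow_add]
  congr 2
  exact (eq_inv_of_mul_eq_one_left (by rw [← qPow_add, neg_add_cancel, qPow_zero])).symm

theorem deformed_one : (expCocycle 𝕜 P hβ).toDeformed 1 = 1 := rfl

/-- The exponent is the pairing of degrees times the binomial coefficient `n choose 2`. -/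
theorem deformed_pow (hx : IsBihomogeneous (P.toralHom 𝕜 M) l r x) (n : ℕ) :
    (expCocycle 𝕜 P hβ).toDeformed x ^ n =
      qPow 𝕜 ((β l l - β r r) * (n * (n - 1) / 2)) • (expCocycle 𝕜 P hβ).toDeformed (x ^ n) := by
  induction n with
  | zero => simp [qPow_zero, deformed_one]
  | succ n ih =>
    rw [pow_succ, ih, smul_mul_assoc, deformed_mul hβ (hx.pow n) hx, smul_smul, ← qPow_add,
      hβ.nsmul_left, hβ.nsmul_left, ← pow_succ]
    congr 2
    push_cast
    ring

theorem deformed_pow_mul_mul_pow (hx : IsBihomogeneous (P.toralHom 𝕜 M) l r x)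
    (hy : IsBihomogeneous (P.toralHom 𝕜 M) l' r' y) (a b : ℕ) :
    (expCocycle 𝕜 P hβ).toDeformed x ^ a * (expCocycle 𝕜 P hβ).toDeformed y *
        (expCocycle 𝕜 P hβ).toDeformed x ^ b =
      qPow 𝕜 ((β l l - β r r) * ((a + b) * (a + b - 1) / 2) + a * (β l l' - β r r') +
        b * (β l' l - β r' r)) • (expCocycle 𝕜 P hβ).toDeformed (x ^ a * y * x ^ b) := by
  rw [deformed_pow hβ hx, deformed_pow hβ hx, smul_mul_assoc, deformed_mul hβ (hx.pow a) hy,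
    smul_smul, smul_mul_assoc, mul_smul_comm, deformed_mul hβ ((hx.pow a).mul hy) (hx.pow b),
    smul_smul, smul_smul, ← qPow_add, ← qPow_add, ← qPow_add]
  congr 2
  simp only [hβ.add_left, hβ.nsmul_left, hβ.nsmul_right]
  ring

/-- A Serre sum for the deformed product is proportional to one for the original product: the scalar of
the `k`-th monomial is a constant times `q ^ (-k t)`, which a shift of the parameter by `t` absorbs. -/
theorem serreSum_deformed (hx : IsBihomogeneous (P.toralHom 𝕜 M) l r x)
    (hy : IsBihomogeneous (P.toralHom 𝕜 M) l' r' y) (p : QField 𝕜) (s t : ℚ) (m : ℕ)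
    (ht : t = (β l l' - β r r') - (β l' l - β r' r)) :
    ∃ w : QField 𝕜, serreSum (serreCoeff p (qPow 𝕜 (s + t)) m) m
      ((expCocycle 𝕜 P hβ).toDeformed x) ((expCocycle 𝕜 P hβ).toDeformed y) =
        w • (expCocycle 𝕜 P hβ).toDeformed (serreSum (serreCoeff p (qPow 𝕜 s) m) m x y) := by
  refine ⟨qPow 𝕜 ((β l l - β r r) * (m * (m - 1) / 2) + m * (β l l' - β r r')), ?_⟩
  rw [serreSum, serreSum, map_sum, Finset.smul_sum]
  refine Finset.sum_congr rfl fun k hk ↦ ?_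
  obtain ⟨n, rfl⟩ := Nat.exists_eq_add_of_le (Nat.lt_succ_iff.1 (Finset.mem_range.1 hk))
  rw [deformed_pow_mul_mul_pow hβ hx hy, map_smul, smul_smul, smul_smul, qPow_add, serreCoeff_mul,
    mul_assoc, mul_comm, qPow_pow, ← qPow_add, Nat.add_sub_cancel_left, ht]
  congr 3
  push_cast
  ring

theorem serreSumRev_deformed (hx : IsBihomogeneous (P.toralHom 𝕜 M) l r x)
    (hy : IsBihomogeneous (P.toralHom 𝕜 M) l' r' y) (p : QField 𝕜) (s t : ℚ) (m : ℕ)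
    (ht : t = (β l' l - β r' r) - (β l l' - β r r')) :
    ∃ w : QField 𝕜, serreSumRev (serreCoeff p (qPow 𝕜 (s + t)) m) m
      ((expCocycle 𝕜 P hβ).toDeformed x) ((expCocycle 𝕜 P hβ).toDeformed y) =
        w • (expCocycle 𝕜 P hβ).toDeformed (serreSumRev (serreCoeff p (qPow 𝕜 s) m) m x y) := by
  refine ⟨qPow 𝕜 ((β l l - β r r) * (m * (m - 1) / 2) + m * (β l' l - β r' r)), ?_⟩
  rw [serreSumRev, serreSumRev, map_sum, Finset.smul_sum]
  refine Finset.sum_congr rfl fun k hk ↦ ?_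
  obtain ⟨n, rfl⟩ := Nat.exists_eq_add_of_le (Nat.lt_succ_iff.1 (Finset.mem_range.1 hk))
  rw [deformed_pow_mul_mul_pow hβ hx hy, map_smul, smul_smul, smul_smul, qPow_add, serreCoeff_mul,
    mul_assoc, mul_comm, qPow_pow, ← qPow_add, Nat.add_sub_cancel_left, ht]
  congr 3
  push_cast
  ring

end Products

section Hom

variable (P P' : Multiparameter C) {β : M.carrier → M.carrier → ℚ} (hβ : IsBiadditive β)

/-- The multiparameter `P'` is the deformation of `P` by the bicharacter `q ^ β`, expressed through the
weights: those of `K_μ L_ν` on `E_j` differ by the antisymmetrization of `β` at `(μ + ν, α_j)`, where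
`μ + ν` is the degree of `K_μ L_ν` in the group algebra of `M`. -/
def IsDeformation (M : RootLattice I) (P P' : Multiparameter C) (β : M.carrier → M.carrier → ℚ) :
    Prop :=
  ∀ j x, P'.weight M j x =
    P.weight M j x + (β (x.1 + x.2) (M.root j) - β (M.root j) (x.1 + x.2))

variable {P P'}

theorem IsDeformation.symm (h : IsDeformation M P P' β) :
    IsDeformation M P' P fun μ ν ↦ -β μ ν := fun j x ↦ by
  rw [h j x]; ring

theorem IsDeformation.R_eq (h : IsDeformation M P P' β) (i j : I) :
    P'.R i j = P.R i j + (β (M.root i) (M.root j) - β (M.root j) (M.root i)) := by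
  rw [← P.weight_root_left M, ← P'.weight_root_left M, h, add_zero]

theorem deformed_respects (h : IsDeformation M P P' β) :
    (P'.torusDatum 𝕜 M).Respects
      (fun x ↦ (expCocycle 𝕜 P hβ).toDeformed (.mk 𝕜 P M ((P.torusDatum 𝕜 M).K x)))
      (fun j ↦ (expCocycle 𝕜 P hβ).toDeformed (.mk 𝕜 P M ((P.torusDatum 𝕜 M).X j))) where
  K_zero := by
    rw [TorusDatum.K_zero]
    rfl
  K_add x y := by
    rw [deformed_mul hβ (isBihomogeneous_K P x) (isBihomogeneous_K P y), sub_self, qPow_zero,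
      one_smul, TorusDatum.K_add]
    rfl
  K_mul_X := by
    rintro x (j | j)
    · rw [deformed_mul hβ (isBihomogeneous_K P x) (isBihomogeneous_E P j),
        deformed_mul hβ (isBihomogeneous_E P j) (isBihomogeneous_K P x)]
      have e : Multiparameter.Double.mk 𝕜 P M ((P.torusDatum 𝕜 M).K x) *
          Multiparameter.Double.mk 𝕜 P M ((P.torusDatum 𝕜 M).X (.inl j)) =
          qPow 𝕜 (P.weight M j x) • (Multiparameter.Double.mk 𝕜 P M ((P.torusDatum 𝕜 M).X (.inl j)) *
            Multiparameter.Double.mk 𝕜 P M ((P.torusDatum 𝕜 M).K x)) :=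
        congr(Multiparameter.Double.mkHom 𝕜 P M $((P.torusDatum 𝕜 M).K_mul_X x (.inl j)))
      have hw : (P'.torusDatum 𝕜 M).wt (.inl j) (.ofAdd x) = qPow 𝕜 (P'.weight M j x) := rfl
      rw [e, map_smul, smul_smul, smul_smul, hw, h, ← qPow_add, ← qPow_add, hβ.zero_right,
        hβ.zero_left]
      congr 2
      ring
    · rw [deformed_mul hβ (isBihomogeneous_K P x) (isBihomogeneous_F P j),
        deformed_mul hβ (isBihomogeneous_F P j) (isBihomogeneous_K P x)]
      have e : Multiparameter.Double.mk 𝕜 P M ((P.torusDatum 𝕜 M).K x) *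
          Multiparameter.Double.mk 𝕜 P M ((P.torusDatum 𝕜 M).X (.inr j)) =
          qPow 𝕜 (-P.weight M j x) •
            (Multiparameter.Double.mk 𝕜 P M ((P.torusDatum 𝕜 M).X (.inr j)) *
              Multiparameter.Double.mk 𝕜 P M ((P.torusDatum 𝕜 M).K x)) :=
        congr(Multiparameter.Double.mkHom 𝕜 P M $((P.torusDatum 𝕜 M).K_mul_X x (.inr j)))
      have hw : (P'.torusDatum 𝕜 M).wt (.inr j) (.ofAdd x) = qPow 𝕜 (-P'.weight M j x) := rfl
      rw [e, map_smul, smul_smul, smul_smul, hw, h, ← qPow_add, ← qPow_add, hβ.zero_right,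
        hβ.zero_left]
      congr 2
      ring

/-- The generators satisfy the remaining relations of `P'` in the deformed algebra: the deformation
rescales each monomial of a relation, and only the parameter `q_ij` of a Serre sum is affected. -/
theorem deformed_relator (h : IsDeformation M P P' β) {u : (P'.torusDatum 𝕜 M).Alg}
    (hu : P'.Relator 𝕜 M u) : TorusDatum.lift (deformed_respects (𝕜 := 𝕜) hβ h) u = 0 := by
  cases hu with
  | commutator i j =>
    have e := Multiparameter.Double.mk_relator 𝕜 P M (.commutator i j)
    rw [map_sub, map_sub, map_mul, map_mul, map_smul, map_sub, P.R_diag, sub_eq_zero] at e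
    rw [map_sub, map_sub, map_mul, map_mul, map_smul, map_sub, P'.R_diag, sub_eq_zero]
    simp only [TorusDatum.lift_X, TorusDatum.lift_K]
    rw [deformed_mul hβ (isBihomogeneous_E P i) (isBihomogeneous_F P j),
      deformed_mul hβ (isBihomogeneous_F P j) (isBihomogeneous_E P i)]
    simp only [hβ.zero_left, hβ.zero_right, sub_self, qPow_zero, one_smul]
    rw [← map_sub, ← map_sub, ← map_smul]
    exact congrArg _ e
  | serre_E i j hij =>
    have e := Multiparameter.Double.mk_relator 𝕜 P M (.serre_E i j hij)
    rw [map_serreSum_of_bialgHom, P.R_diag] at e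
    rw [TorusDatum.map_serreSum, TorusDatum.lift_X, TorusDatum.lift_X, P'.R_diag, h.R_eq]
    obtain ⟨w, hw⟩ := serreSum_deformed hβ (isBihomogeneous_E (𝕜 := 𝕜) P i)
      (isBihomogeneous_E P j) (qPow 𝕜 (2 * C.d i)) (P.R i j)
      (β (M.root i) (M.root j) - β (M.root j) (M.root i)) (C.serreIndex i j)
      (by simp only [hβ.zero_left]; ring)
    rw [hw]
    exact (congrArg (fun z ↦ w • (expCocycle 𝕜 P hβ).toDeformed z) e).trans (by simp)
  | serre_F i j hij =>
    have e := Multiparameter.Double.mk_relator 𝕜 P M (.serre_F i j hij)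
    rw [map_serreSumRev_of_bialgHom, P.R_diag] at e
    rw [TorusDatum.map_serreSumRev, TorusDatum.lift_X, TorusDatum.lift_X, P'.R_diag, h.R_eq]
    obtain ⟨w, hw⟩ := serreSumRev_deformed hβ (isBihomogeneous_F (𝕜 := 𝕜) P i)
      (isBihomogeneous_F P j) (qPow 𝕜 (2 * C.d i)) (P.R i j)
      (β (M.root i) (M.root j) - β (M.root j) (M.root i)) (C.serreIndex i j)
      (by simp only [hβ.zero_left]; ring)
    rw [hw]
    exact (congrArg (fun z ↦ w • (expCocycle 𝕜 P hβ).toDeformed z) e).trans (by simp)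

variable (𝕜) in
/-- The homomorphism of algebras from `U_{𝐩',M•}(𝔤_D)` to the deformation of `U_{𝐩,M•}(𝔤_D)`. -/
noncomputable def deformHom (h : IsDeformation M P P' β) :
    P'.Double 𝕜 M →ₐ[QField 𝕜] (expCocycle 𝕜 P hβ).Deformed :=
  Multiparameter.Double.lift (TorusDatum.lift (deformed_respects hβ h))
    fun _ hu ↦ deformed_relator hβ h hu

theorem deformHom_gen (h : IsDeformation M P P' β) (g : TorusGen (M.carrier × M.carrier) (I ⊕ I)) :
    deformHom 𝕜 hβ h (.mk 𝕜 P' M ((P'.torusDatum 𝕜 M).gen g)) =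
      (expCocycle 𝕜 P hβ).toDeformed (.mk 𝕜 P M ((P.torusDatum 𝕜 M).gen g)) := by
  rw [deformHom, Multiparameter.Double.lift_mk]
  cases g with
  | K a => rw [TorusDatum.lift_K]
  | X j => rw [TorusDatum.lift_X]

end Hom

end DeformedDouble

/-! ### The cocycle deformation as a multiparameter quantum group -/

section DeformationEquiv

variable {𝕜 : Type*} [Field 𝕜] {I : Type*} [Fintype I] [DecidableEq I] {C : CartanDatum I}
  {M : RootLattice I}

section Inverse

variable {P P' : Multiparameter C} {β β' : M.carrier → M.carrier → ℚ} (hβ : IsBiadditive β)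
  (hβ' : IsBiadditive β') (h : IsDeformation M P P' β) (h' : IsDeformation M P' P β')

/-- The bihomogeneous elements whose degrees are preserved by `deformHom` and on which the opposite
deformation is inverse to it. -/
noncomputable def invertedElements (hββ' : ∀ μ ν, β' μ ν = -β μ ν) :
    Submonoid (P'.Double 𝕜 M) where
  carrier := {x | ∃ l r, IsBihomogeneous (P'.toralHom 𝕜 M) l r x ∧
    IsBihomogeneous (P.toralHom 𝕜 M) l r
      ((expCocycle 𝕜 P hβ).toDeformed.symm (deformHom 𝕜 hβ h x)) ∧
    deformHom 𝕜 hβ' h' ((expCocycle 𝕜 P hβ).toDeformed.symm (deformHom 𝕜 hβ h x)) =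
      (expCocycle 𝕜 P' hβ').toDeformed x}
  one_mem' := ⟨0, 0, .one, by rw [map_one]; exact .one, by
    rw [map_one]
    exact map_one (deformHom 𝕜 hβ' h')⟩
  mul_mem' := by
    rintro x y ⟨l, r, hx, hfx, hgx⟩ ⟨l', r', hy, hfy, hgy⟩
    have e : (expCocycle 𝕜 P hβ).toDeformed.symm (deformHom 𝕜 hβ h (x * y)) =
        qPow 𝕜 (β l l' - β r r') •
          ((expCocycle 𝕜 P hβ).toDeformed.symm (deformHom 𝕜 hβ h x) *
            (expCocycle 𝕜 P hβ).toDeformed.symm (deformHom 𝕜 hβ h y)) := by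
      rw [LinearEquiv.symm_apply_eq, map_smul, ← deformed_mul hβ hfx hfy,
        LinearEquiv.apply_symm_apply, LinearEquiv.apply_symm_apply, map_mul]
    refine ⟨l + l', r + r', hx.mul hy, ?_, ?_⟩
    · rw [e]
      exact (hfx.mul hfy).smul _
    · rw [e, map_smul, map_mul, hgx, hgy, deformed_mul hβ' hx hy, smul_smul, ← qPow_add, hββ', hββ']
      have : β l l' - β r r' + (-β l l' - -β r r') = 0 := by ring
      rw [this, qPow_zero, one_smul]

/-- Deforming by `q ^ β` and then by `q ^ (-β)` gives back the original algebra. -/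
theorem deformHom_deformHom (hββ' : ∀ μ ν, β' μ ν = -β μ ν) (x : P'.Double 𝕜 M) :
    deformHom 𝕜 hβ' h' ((expCocycle 𝕜 P hβ).toDeformed.symm (deformHom 𝕜 hβ h x)) =
      (expCocycle 𝕜 P' hβ').toDeformed x := by
  let S : Submonoid (P'.Double 𝕜 M) := invertedElements hβ hβ' h h' hββ'
  have hgen : ∀ g, Multiparameter.Double.mk 𝕜 P' M ((P'.torusDatum 𝕜 M).gen g) ∈ S := by
    intro g
    have e : (expCocycle 𝕜 P hβ).toDeformed.symm
        (deformHom 𝕜 hβ h (.mk 𝕜 P' M ((P'.torusDatum 𝕜 M).gen g))) =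
        .mk 𝕜 P M ((P.torusDatum 𝕜 M).gen g) := by
      rw [deformHom_gen, LinearEquiv.symm_apply_apply]
    have e' : ∀ y, y = Multiparameter.Double.mk 𝕜 P M ((P.torusDatum 𝕜 M).gen g) →
        deformHom 𝕜 hβ' h' y =
          (expCocycle 𝕜 P' hβ').toDeformed (.mk 𝕜 P' M ((P'.torusDatum 𝕜 M).gen g)) := by
      rintro _ rfl
      exact deformHom_gen hβ' h' g
    rcases g with (a | i | i)
    · exact ⟨_, _, isBihomogeneous_K P' a, by rw [e]; exact isBihomogeneous_K P a, e' _ e⟩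
    · exact ⟨_, _, isBihomogeneous_E P' i, by rw [e]; exact isBihomogeneous_E P i, e' _ e⟩
    · exact ⟨_, _, isBihomogeneous_F P' i, by rw [e]; exact isBihomogeneous_F P i, e' _ e⟩
  have hadjoin : x ∈ Algebra.adjoin (QField 𝕜) (S : Set (P'.Double 𝕜 M)) := by
    obtain ⟨y, rfl⟩ := Multiparameter.Double.mkHom_surjective 𝕜 P' M x
    induction y using (P'.torusDatum 𝕜 M).induction with
    | hs c =>
      rw [Algebra.algebraMap_eq_smul_one, map_smul, map_one]
      exact Subalgebra.smul_mem _ (Subalgebra.one_mem _) c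
    | hg g => exact Algebra.subset_adjoin (hgen g)
    | ha x y hx hy =>
      rw [map_add]
      exact Subalgebra.add_mem _ hx hy
    | hm x y hx hy =>
      rw [map_mul]
      exact Subalgebra.mul_mem _ hx hy
  -- The elements in question form a submonoid, so their linear span is already a subalgebra.
  rw [← Subalgebra.mem_toSubmodule, Algebra.adjoin_eq_span, Submonoid.closure_eq] at hadjoin
  induction hadjoin using Submodule.span_induction with
  | mem x hx =>
    obtain ⟨_, _, -, -, hx⟩ := hx
    exact hx
  | zero => simp
  | add x y _ _ hx hy => simp only [map_add, hx, hy]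
  | smul c x _ hx => simp only [map_smul, hx]

theorem deformHom_bijective : Function.Bijective (deformHom 𝕜 hβ h) := by
  have h1 := deformHom_deformHom (𝕜 := 𝕜) hβ hβ.neg h h.symm fun _ _ ↦ rfl
  have h2 := deformHom_deformHom (𝕜 := 𝕜) hβ.neg hβ h.symm h fun _ _ ↦ (neg_neg _).symm
  refine ⟨fun x y hxy ↦ ?_, fun z ↦ ⟨_, (h2 ((expCocycle 𝕜 P hβ).toDeformed.symm z)).trans
    (LinearEquiv.apply_symm_apply _ _)⟩⟩
  apply (expCocycle 𝕜 P' hβ.neg).toDeformed.injective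
  rw [← h1, ← h1, hxy]

variable (𝕜) in
/-- If `P'` is the deformation of `P` by the bicharacter `q ^ β`, then `U_{𝐩',M•}(𝔤_D)` is the cocycle
deformation of `U_{𝐩,M•}(𝔤_D)`. -/
noncomputable def deformEquiv : P'.Double 𝕜 M ≃ₐc[QField 𝕜] (expCocycle 𝕜 P hβ).Deformed :=
  BialgEquiv.ofBijective
    (TorusDatum.bialgHomOfGen (Multiparameter.Double.mkHom 𝕜 P' M)
      (Multiparameter.Double.mkHom_surjective 𝕜 P' M) (deformHom 𝕜 hβ h)
      (fun a ↦ by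
        rw [Multiparameter.Double.mkHom_apply, deformHom_gen]
        exact ToralTwist.isGroupLikeElem_toDeformed _
          (Multiparameter.Double.isGroupLikeElem_mk 𝕜 P M))
      (fun j ↦ by
        simp only [Multiparameter.Double.mkHom_apply, deformHom_gen]
        rw [TwoCocycle.comul_toDeformed, comul_double_X, map_add]
        rfl))
    (deformHom_bijective hβ h)

end Inverse

theorem comul_map_double_X {P : Multiparameter C} {B : Type*} [Ring B] [Bialgebra (QField 𝕜) B]
    (χ : P.Double 𝕜 M →ₐc[QField 𝕜] B) (j : I ⊕ I) :
    Coalgebra.comul (R := QField 𝕜) (χ (.mk 𝕜 P M ((P.torusDatum 𝕜 M).X j))) =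
      χ (.mk 𝕜 P M ((P.torusDatum 𝕜 M).X j)) ⊗ₜ[QField 𝕜]
        χ (.mk 𝕜 P M ((P.torusDatum 𝕜 M).K ((P.torusDatum 𝕜 M).right j))) +
      χ (.mk 𝕜 P M ((P.torusDatum 𝕜 M).K ((P.torusDatum 𝕜 M).left j))) ⊗ₜ[QField 𝕜]
        χ (.mk 𝕜 P M ((P.torusDatum 𝕜 M).X j)) := by
  have h := CoalgHomClass.map_comp_comul_apply χ (.mk 𝕜 P M ((P.torusDatum 𝕜 M).X j))
  rw [comul_double_X, map_add] at h
  exact h.symm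

namespace ToralTwist

variable (T : ToralTwist C M) {P : Multiparameter C}

/-- The exponent `-(μ + ψ_-(μ), ν)` of the bicharacter that defines the cocycle. -/
noncomputable def exponent (μ ν : M.carrier) : ℚ :=
  -C.form (μ + T.minus μ : M.carrier) (ν : I → ℚ)

theorem isBiadditive_exponent : IsBiadditive T.exponent where
  add_left μ μ' ν := by
    simp only [exponent, map_add, AddSubgroup.coe_add, LinearMap.add_apply]
    ring
  add_right μ ν ν' := by
    simp only [exponent, map_add, AddSubgroup.coe_add]
    ring

theorem form_eq_sum (C : CartanDatum I) (x y : I → ℚ) :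
    C.form x y = ∑ k, y k * C.form x (simpleRoot k) := by
  conv_lhs => rw [pi_eq_sum_univ' y, map_sum]
  refine Finset.sum_congr rfl fun k _ ↦ ?_
  rw [map_smul, smul_eq_mul]
  congr 2

theorem form_root_left (j : I) (μ : M.carrier) :
    C.form (M.root j : M.carrier) (μ : I → ℚ) = weight C M j μ := by
  rw [form_eq_sum, weight_apply]
  refine Finset.sum_congr rfl fun k _ ↦ ?_
  change _ * C.form (simpleRoot j) (simpleRoot k) = _
  rw [C.form_root_root, symmetrized_comm]
  rfl

theorem form_plus_root_left (j : I) (μ : M.carrier) :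
    C.form (T.plus (M.root j) : M.carrier) (μ : I → ℚ) = -weight C M j (T.plus μ) := by
  rw [form_eq_sum, weight_plus_apply, ← Finset.sum_neg_distrib]
  refine Finset.sum_congr rfl fun k _ ↦ ?_
  change _ * weight C M k (T.plus (M.root j)) = _
  rw [weight_plus_apply, T.transpose_mul_mul_antisymm j k]
  simp [RootLattice.root, simpleRoot, Pi.single_apply]

/-- The multiparameter of `Ψ` is the deformation of the canonical one by the bicharacter. -/
theorem isDeformation
    (hP : P.R = C.symmetrized + C.cartan.transpose * (T.Ψ.transpose - T.Ψ) * C.cartan) :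
    IsDeformation M (Multiparameter.canonical C) P T.exponent := by
  intro j x
  have h1 : (Multiparameter.canonical C).weight M j x = weight C M j x.1 - weight C M j x.2 := by
    rw [weight_apply, weight_apply]
    change ∑ k, (x.1 : I → ℚ) k * C.symmetrized k j - ∑ k, C.symmetrized j k * (x.2 : I → ℚ) k = _
    congr 1
    exact Finset.sum_congr rfl fun k _ ↦ by rw [symmetrized_comm C j k, mul_comm]
  have h2 : ∀ μ : M.carrier, T.exponent μ (M.root j) =
      -(weight C M j μ - weight C M j (T.plus μ)) := fun μ ↦ by
    rw [← map_sub, sub_eq_add_neg, ← T.minus_apply]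
    rfl
  have h3 : ∀ μ : M.carrier, T.exponent (M.root j) μ =
      -(weight C M j μ + weight C M j (T.plus μ)) := fun μ ↦ by
    rw [exponent, T.minus_apply, AddSubgroup.coe_add, map_add, LinearMap.add_apply,
      AddSubgroup.coe_neg, map_neg, LinearMap.neg_apply, form_root_left, T.form_plus_root_left,
      neg_neg]
  rw [Multiparameter.weight_eq hP, Multiparameter.toralProj_apply, h1, h2, h3]
  simp only [map_add, map_sub, map_nsmul, nsmul_eq_mul]
  push_cast
  ring

variable (𝕜) in
/-- The isomorphism of bialgebras `U_{𝐪,M•}(𝔤_D) ≅ (U_{q̌,M•}(𝔤_D))_σ`. -/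
noncomputable def doubleEquiv
    (hP : P.R = C.symmetrized + C.cartan.transpose * (T.Ψ.transpose - T.Ψ) * C.cartan) :
    P.Double 𝕜 M ≃ₐc[QField 𝕜] (T.cocycle 𝕜).Deformed :=
  deformEquiv 𝕜 T.isBiadditive_exponent (T.isDeformation hP)

theorem doubleEquiv_gen
    (hP : P.R = C.symmetrized + C.cartan.transpose * (T.Ψ.transpose - T.Ψ) * C.cartan)
    (g : TorusGen (M.carrier × M.carrier) (I ⊕ I)) :
    T.doubleEquiv 𝕜 hP (.mk 𝕜 P M ((P.torusDatum 𝕜 M).gen g)) =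
      T.toDeformedDouble 𝕜 (.mk 𝕜 _ M (((Multiparameter.canonical C).torusDatum 𝕜 M).gen g)) :=
  deformHom_gen T.isBiadditive_exponent (T.isDeformation hP) g

namespace DeformedSingle

variable (𝕜) in
/-- The projection onto `(U_{q,M•}(𝔤))_σ`. -/
noncomputable def mkHom : (T.cocycle 𝕜).Deformed →ₐc[QField 𝕜] T.DeformedSingle 𝕜 :=
  have : ((idealOf (T.deformedRelators 𝕜)).restrictScalars (QField 𝕜)).IsCoideal :=
    isCoideal_idealOf fun _ hu ↦ T.isSkewPrimitive_of_mem_deformedRelators 𝕜 hu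
  Bialgebra.Quotient.mkBialgHom (idealOf (T.deformedRelators 𝕜))

theorem mkHom_apply (x : (Multiparameter.canonical C).Double 𝕜 M) :
    mkHom 𝕜 T (T.toDeformedDouble 𝕜 x) = mk 𝕜 T x := rfl

variable (𝕜) in
theorem mkHom_surjective : Function.Surjective (mkHom 𝕜 T) := Ideal.Quotient.mk_surjective

variable {T}
  (hP : P.R = C.symmetrized + C.cartan.transpose * (T.Ψ.transpose - T.Ψ) * C.cartan)

/-- `doubleEquiv` matches the generators of the two ideals `I_Ψ`. -/
theorem doubleEquiv_relator (μ : M.carrier) : T.doubleEquiv 𝕜 hP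
      (Multiparameter.Double.K 𝕜 P M μ * Multiparameter.Double.L 𝕜 P M μ -
        Multiparameter.Double.K 𝕜 P M (2 • T.plus μ) *
          Multiparameter.Double.L 𝕜 P M (2 • T.minus μ)) =
    T.toDeformedDouble 𝕜 (.K 𝕜 _ M μ) * T.toDeformedDouble 𝕜 (.L 𝕜 _ M μ) -
      T.toDeformedDouble 𝕜 (.K 𝕜 _ M (2 • T.plus μ)) *
        T.toDeformedDouble 𝕜 (.L 𝕜 _ M (2 • T.minus μ)) := by
  simp only [map_sub, map_mul, Multiparameter.Double.K, Multiparameter.Double.L, TorusDatum.K,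
    doubleEquiv_gen]

variable (𝕜) in
/-- The projection of `U_{𝐪,M•}(𝔤_D)` onto `(U_{q,M•}(𝔤))_σ` by way of `doubleEquiv`. -/
noncomputable def ofDouble : P.Double 𝕜 M →ₐc[QField 𝕜] T.DeformedSingle 𝕜 :=
  (mkHom 𝕜 T).comp (T.doubleEquiv 𝕜 hP).toBialgHom

theorem ofDouble_apply (x : P.Double 𝕜 M) :
    ofDouble 𝕜 hP x = mkHom 𝕜 T (T.doubleEquiv 𝕜 hP x) := rfl

variable (𝕜) in
/-- The homomorphism `U_{𝐪,M•}(𝔤) → (U_{q,M•}(𝔤))_σ` induced by `doubleEquiv`. -/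
noncomputable def ofSingle : P.Single 𝕜 T →ₐ[QField 𝕜] T.DeformedSingle 𝕜 :=
  Multiparameter.Single.lift (ofDouble 𝕜 hP : P.Double 𝕜 M →ₐ[QField 𝕜] T.DeformedSingle 𝕜) (by
    rintro _ ⟨μ, rfl⟩
    change mkHom 𝕜 T (T.doubleEquiv 𝕜 hP _) = 0
    rw [doubleEquiv_relator]
    exact mk_idealOf_eq_zero ⟨μ, rfl⟩)

theorem ofSingle_mk (x : P.Double 𝕜 M) :
    ofSingle 𝕜 hP (.mk 𝕜 P T x) = ofDouble 𝕜 hP x := rfl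

theorem ofSingle_presentation (x : (P.torusDatum 𝕜 M).Alg) :
    ofSingle 𝕜 hP (Multiparameter.Single.presentation 𝕜 P T x) =
      ofDouble 𝕜 hP (.mk 𝕜 P M x) := rfl

variable (𝕜) in
/-- The inverse of `ofSingle`. -/
noncomputable def toSingle : T.DeformedSingle 𝕜 →ₐ[QField 𝕜] P.Single 𝕜 T :=
  idealOfLift (A := (T.cocycle 𝕜).Deformed)
    (((Multiparameter.Single.mkHom 𝕜 P T).comp (T.doubleEquiv 𝕜 hP).symm.toBialgHom :
      (T.cocycle 𝕜).Deformed →ₐc[QField 𝕜] P.Single 𝕜 T) :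
        (T.cocycle 𝕜).Deformed →ₐ[QField 𝕜] P.Single 𝕜 T) (by
    rintro _ ⟨μ, rfl⟩
    change Multiparameter.Single.mkHom 𝕜 P T ((T.doubleEquiv 𝕜 hP).symm _) = 0
    dsimp only
    rw [← doubleEquiv_relator hP, BialgEquiv.symm_apply_apply]
    exact mk_idealOf_eq_zero (A := P.Double 𝕜 M) ⟨μ, rfl⟩)

theorem toSingle_mk (x : (T.cocycle 𝕜).Deformed) : toSingle 𝕜 hP (mkHom 𝕜 T x) =
    Multiparameter.Single.mkHom 𝕜 P T ((T.doubleEquiv 𝕜 hP).symm x) := rfl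

theorem ofSingle_bijective : Function.Bijective (ofSingle 𝕜 hP) := by
  refine Function.bijective_iff_has_inverse.2 ⟨toSingle 𝕜 hP, fun x ↦ ?_, fun x ↦ ?_⟩
  · obtain ⟨y, rfl⟩ := Multiparameter.Single.mkHom_surjective 𝕜 P T x
    rw [Multiparameter.Single.mkHom_apply, ofSingle_mk, ofDouble_apply, toSingle_mk, BialgEquiv.symm_apply_apply,
      Multiparameter.Single.mkHom_apply]
  · obtain ⟨y, rfl⟩ := mkHom_surjective 𝕜 T x
    rw [toSingle_mk, Multiparameter.Single.mkHom_apply, ofSingle_mk, ofDouble_apply,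
      BialgEquiv.apply_symm_apply]

variable (𝕜) in
/-- The isomorphism of bialgebras `U_{𝐪,M•}(𝔤) ≅ (U_{q,M•}(𝔤))_σ`. -/
noncomputable def singleEquiv : P.Single 𝕜 T ≃ₐc[QField 𝕜] T.DeformedSingle 𝕜 :=
  BialgEquiv.ofBijective
    (TorusDatum.bialgHomOfGen (Multiparameter.Single.presentation 𝕜 P T)
      (Multiparameter.Single.presentation_surjective 𝕜 P T) (ofSingle 𝕜 hP)
      (fun a ↦ by
        rw [ofSingle_presentation]
        exact (Multiparameter.Double.isGroupLikeElem_mk 𝕜 P M).map (ofDouble 𝕜 hP))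
      (by simpa only [ofSingle_presentation] using comul_map_double_X (ofDouble 𝕜 hP)))
    (ofSingle_bijective hP)

theorem singleEquiv_apply (x : P.Single 𝕜 T) : singleEquiv 𝕜 hP x = ofSingle 𝕜 hP x := rfl

theorem singleEquiv_symm_mk (g : TorusGen (M.carrier × M.carrier) (I ⊕ I)) :
    (singleEquiv 𝕜 hP).symm (.mk 𝕜 T (.mk 𝕜 _ M
      (((Multiparameter.canonical C).torusDatum 𝕜 M).gen g))) =
      .mk 𝕜 P T (.mk 𝕜 P M ((P.torusDatum 𝕜 M).gen g)) := by
  have h : singleEquiv 𝕜 hP (.mk 𝕜 P T (.mk 𝕜 P M ((P.torusDatum 𝕜 M).gen g))) =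
      .mk 𝕜 T (.mk 𝕜 _ M (((Multiparameter.canonical C).torusDatum 𝕜 M).gen g)) := by
    rw [singleEquiv_apply, ofSingle_mk, ofDouble_apply, doubleEquiv_gen, mkHom_apply]
  rw [← h, BialgEquiv.symm_apply_apply]

end DeformedSingle
end ToralTwist

end DeformationEquiv

end QuantumDouble

open QuantumDouble in
theorem mainTheorem2 (𝕜 : Type*) [Field 𝕜] [CharZero 𝕜] {I : Type*} [Fintype I] [DecidableEq I]
    (C : CartanDatum I) (M : RootLattice I) (T : ToralTwist C M) (P : Multiparameter C)
    (hP : P.R = C.symmetrized + C.cartan.transpose * (T.Ψ.transpose - T.Ψ) * C.cartan) :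
    (∃ φ : P.Single 𝕜 T ≃ₐc[QField 𝕜] T.TwistedQuantumGroup 𝕜,
      (∀ x, φ (HopfAlgebra.antipode (QField 𝕜) x) = HopfAlgebra.antipode (QField 𝕜) (φ x)) ∧
      (∀ μ : M.carrier, φ (.mk 𝕜 P T (.K 𝕜 P M μ)) = .K 𝕜 T (μ + T.plus μ - T.minus μ)) ∧
      (∀ μ : M.carrier, φ (.mk 𝕜 P T (.L 𝕜 P M μ)) = .K 𝕜 T (-(μ + T.minus μ - T.plus μ))) ∧
      (∀ i, φ (.mk 𝕜 P T (.E 𝕜 P M i)) =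
        qPow 𝕜 (C.d i) • (.K 𝕜 T (-T.minus (M.root i)) * .E 𝕜 T i)) ∧
      (∀ i, φ (.mk 𝕜 P T (.F 𝕜 P M i)) = .K 𝕜 T (T.plus (M.root i)) * .F 𝕜 T i)) ∧
    (∃ φ : T.DeformedSingle 𝕜 ≃ₐc[QField 𝕜] T.TwistedQuantumGroup 𝕜,
      (∀ μ : M.carrier, φ (.mk 𝕜 T (.K 𝕜 _ M μ)) = .K 𝕜 T (μ + T.plus μ - T.minus μ)) ∧
      (∀ μ : M.carrier, φ (.mk 𝕜 T (.L 𝕜 _ M μ)) = .K 𝕜 T (-(μ + T.minus μ - T.plus μ))) ∧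
      (∀ i, φ (.mk 𝕜 T (.E 𝕜 _ M i)) =
        qPow 𝕜 (C.d i) • (.K 𝕜 T (-T.minus (M.root i)) * .E 𝕜 T i)) ∧
      (∀ i, φ (.mk 𝕜 T (.F 𝕜 _ M i)) = .K 𝕜 T (T.plus (M.root i)) * .F 𝕜 T i)) := by
  open Multiparameter.Single in
  refine ⟨⟨twistedEquiv 𝕜 hP, ?_, twistedEquiv_K hP, twistedEquiv_L hP, twistedEquiv_E hP,
    twistedEquiv_F hP⟩, ⟨(ToralTwist.DeformedSingle.singleEquiv 𝕜 hP).symm.trans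
      (twistedEquiv 𝕜 hP), ?_, ?_, ?_, ?_⟩⟩
  · exact map_antipode_of_bialgHom (twistedEquiv 𝕜 hP).toBialgHom
  · exact fun μ ↦ (congrArg _ (ToralTwist.DeformedSingle.singleEquiv_symm_mk hP _)).trans
      (Multiparameter.Single.twistedEquiv_K hP μ)
  · exact fun μ ↦ (congrArg _ (ToralTwist.DeformedSingle.singleEquiv_symm_mk hP _)).trans
      (Multiparameter.Single.twistedEquiv_L hP μ)
  · exact fun i ↦ (congrArg _ (ToralTwist.DeformedSingle.singleEquiv_symm_mk hP _)).trans
      (Multiparameter.Single.twistedEquiv_E hP i)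
  · exact fun i ↦ (congrArg _ (ToralTwist.DeformedSingle.singleEquiv_symm_mk hP _)).trans
      (Multiparameter.Single.twistedEquiv_F hP i)
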